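/- **Theorem 3.2 (global gradient estimate).** Let $1\le k\le n-1$ and let $\Omega\subset\mathbb{C}^n$ be a bounded domain with $C^4$ boundary (no curvature or convexity condition is imposed on $\partial\Omega$), with unit outer normal vector $\nu$. Let $\beta>0$, $\phi\in C^3(\partial\Omega)$ and $0\le\psi\in C^2(\overline\Omega)$. For a real function $u$ write $u_{i\bar j}=\partial^2u/\partial z_i\partial\bar z_j$, $\partial\bar\partial u=(u_{i\bar j})$, $\Delta u=\sum_j u_{j\bar j}$ and $|\nabla u|^2=\sum_j|\partial u/\partial z_j|^2$. For a Hermitian matrix $A$ let $\sigma_i(A)$ be the $i$-th elementary symmetric function of its eigenvalues. Call $u$ $k$-admissible if $\sigma_i(\Delta u\, I-\partial\bar\partial u)>0$ in $\Omega$ for all $1\le i\le k$. Suppose that $u\in C^3(\overline\Omega)$ is $k$-admissible and solves either $$\sigma_k(\Delta u\, I-\partial\bar\partial u)=\psi(z)\ \text{ in }\Omega,\qquad u_\nu=-\beta u+\phi(z)\ \text{ on }\partial\Omega,$$ or, for some $1\le l<k$, $$\frac{\sigma_k(\Delta u\, I-\partial\bar\partial u)}{\sigma_l(\Delta u\, I-\partial\bar\partial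 u)}=\psi(z)\ \text{ in }\Omega,\qquad u_\nu=-\beta u+\phi(z)\ \text{ on }\partial\Omega.$$ Then $$\sup_\Omega|\nabla u|\le C,$$ where $C$ depends only on $n$, $k$, $\Omega$, $\beta$ and on upper bounds for $|u|_{C^0(\Omega)}$, $|\phi|_{C^3(\partial\Omega)}$ and $|\psi|_{C^2(\overline\Omega)}$; in particular $C$ does not depend on a positive lower bound of $\psi$. Here $|\psi|_{C^2(\overline\Omega)}$ is the supremum over $\overline\Omega$ of the norms of the derivatives of $\psi$ of order at most $2$, and $|\phi|_{C^3(\partial\Omega)}$ is the infimum, over all $C^3$ extensions of $\phi$ to $\mathbb{C}^n$, of the supremum of the norms of the derivatives of order at most $3$. -/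

import Mathlib

noncomputable section

namespace NeumannHessian

/-- Complex Euclidean space `ℂⁿ`, with its Euclidean norm. -/
abbrev Cn (n : ℕ) : Type := EuclideanSpace ℂ (Fin n)

/-! ### Elementary symmetric functions and the Gårding cone -/

/-- The `k`-th elementary symmetric function `σ_k(v)` of `v ∈ ℝⁿ` (so `σ_0 = 1`). -/
def sigma {n : ℕ} (k : ℕ) (v : Fin n → ℝ) : ℝ :=
  ∑ S ∈ Finset.powersetCard k (Finset.univ : Finset (Fin n)), ∏ i ∈ S, v i

/-- The Gårding cone `Γ_k = {v ∈ ℝⁿ : σ_i(v) > 0 for all 1 ≤ i ≤ k}`. -/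
def gardingCone (n k : ℕ) : Set (Fin n → ℝ) :=
  {v | ∀ i : ℕ, 1 ≤ i → i ≤ k → 0 < sigma i v}

open Classical in
/-- The eigenvalues, with multiplicity, of a Hermitian matrix. The default value `0` for other
matrices is never met below: the matrices considered there are Hermitian wherever `u` is `C²`. -/
def hermEigenvalues {n : ℕ} (A : Matrix (Fin n) (Fin n) ℂ) : Fin n → ℝ :=
  if h : A.IsHermitian then h.eigenvalues else 0

/-! ### Complex derivatives -/

/-- The Wirtinger derivative `∂f/∂z_j = ½ (∂f/∂x_j - √-1 ∂f/∂y_j)`, where `z_j = x_j + √-1 y_j`. -/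
def dz {n : ℕ} (j : Fin n) (f : Cn n → ℂ) (z : Cn n) : ℂ :=
  (1 / 2 : ℂ) * (fderiv ℝ f z (EuclideanSpace.single j (1 : ℂ))
    - Complex.I * fderiv ℝ f z (EuclideanSpace.single j Complex.I))

/-- The Wirtinger derivative `∂f/∂z̄_j = ½ (∂f/∂x_j + √-1 ∂f/∂y_j)`. -/
def dzbar {n : ℕ} (j : Fin n) (f : Cn n → ℂ) (z : Cn n) : ℂ :=
  (1 / 2 : ℂ) * (fderiv ℝ f z (EuclideanSpace.single j (1 : ℂ))
    + Complex.I * fderiv ℝ f z (EuclideanSpace.single j Complex.I))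

/-- The complex Hessian `∂∂̄u = (u_{i j̄})`, `u_{i j̄} = ∂²u / ∂z_i ∂z̄_j`. -/
def complexHessian {n : ℕ} (u : Cn n → ℝ) (z : Cn n) : Matrix (Fin n) (Fin n) ℂ :=
  Matrix.of fun i j => dz i (dzbar j fun w => (u w : ℂ)) z

/-- The matrix `Δu I - ∂∂̄u`, where `Δu = ∑_j u_{j j̄}` is the complex Laplacian; its eigenvalues
are `η_i = ∑_j λ_j - λ_i` if `λ_1, …, λ_n` are those of `∂∂̄u`. -/
def etaMatrix {n : ℕ} (u : Cn n → ℝ) (z : Cn n) : Matrix (Fin n) (Fin n) ℂ :=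
  (complexHessian u z).trace • (1 : Matrix (Fin n) (Fin n) ℂ) - complexHessian u z

/-- The eigenvalues of `Δu I - ∂∂̄u` at `z`. -/
def eta {n : ℕ} (u : Cn n → ℝ) (z : Cn n) : Fin n → ℝ :=
  hermEigenvalues (etaMatrix u z)

/-- `|∇u|(z)`, where `|∇u|² = ∑_j |∂u/∂z_j|²` (which is `¼ |Du|²`). -/
def gradNorm {n : ℕ} (u : Cn n → ℝ) (z : Cn n) : ℝ :=
  Real.sqrt (∑ j : Fin n, ‖dz j (fun w => (u w : ℂ)) z‖ ^ 2)

/-- `u` is `k`-admissible in `Ω`: the eigenvalues of `Δu I - ∂∂̄u` lie in `Γ_k` on `Ω`. -/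
def IsAdmissible {n : ℕ} (k : ℕ) (Ω : Set (Cn n)) (u : Cn n → ℝ) : Prop :=
  ∀ z ∈ Ω, eta u z ∈ gardingCone n k

/-! ### Domains with `C⁴` boundary -/

/-- `ρ` is a `C⁴` defining function of `Ω` near `x`, on the neighbourhood `U` of `x`. -/
structure IsLocalDefiningFunction {n : ℕ} (Ω : Set (Cn n)) (x : Cn n) (U : Set (Cn n))
    (ρ : Cn n → ℝ) : Prop where
  isOpen : IsOpen U
  mem : x ∈ U
  contDiffOn : ContDiffOn ℝ 4 ρ U
  fderiv_ne_zero : fderiv ℝ ρ x ≠ 0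
  mem_iff : ∀ y ∈ U, y ∈ Ω ↔ ρ y < 0

/-- `Ω` is a bounded domain (open and connected) in `ℂⁿ` with `C⁴` boundary. -/
structure IsC4Domain {n : ℕ} (Ω : Set (Cn n)) : Prop where
  isOpen : IsOpen Ω
  isConnected : IsConnected Ω
  isBounded : Bornology.IsBounded Ω
  boundary : ∀ x ∈ frontier Ω, ∃ (U : Set (Cn n)) (ρ : Cn n → ℝ), IsLocalDefiningFunction Ω x U ρ

/-- `v` is the unit outer normal vector of `∂Ω` at `x`: it has length one and is a positive
multiple of the (real) gradient at `x` of a defining function. -/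
def IsOuterUnitNormal {n : ℕ} (Ω : Set (Cn n)) (x v : Cn n) : Prop :=
  ‖v‖ = 1 ∧ ∃ (U : Set (Cn n)) (ρ : Cn n → ℝ), IsLocalDefiningFunction Ω x U ρ ∧
    ∃ c : ℝ, 0 < c ∧ ∀ w : Cn n, fderiv ℝ ρ x w = c * (inner ℂ v w).re

/-! ### Regularity of the data -/

/-- `ψ ∈ C²(Ω̄)`, with its derivatives of order at most two bounded by `K` on `Ω̄`. -/
def C2ClosureBound {n : ℕ} (Ω : Set (Cn n)) (ψ : Cn n → ℝ) (K : ℝ) : Prop :=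
  ContDiffOn ℝ 2 ψ (closure Ω) ∧
    ∀ j : ℕ, j ≤ 2 → ∀ x ∈ closure Ω, ‖iteratedFDerivWithin ℝ j ψ (closure Ω) x‖ ≤ K

/-- `φ ∈ C³(∂Ω)`, with norm at most `K`: `φ` is the restriction to `∂Ω` of a `C³` function all of
whose derivatives of order at most three are bounded by `K`. Only the values of `φ` on `∂Ω`
matter. -/
def C3BoundaryBound {n : ℕ} (Ω : Set (Cn n)) (φ : Cn n → ℝ) (K : ℝ) : Prop :=
  ∃ Φ : Cn n → ℝ, ContDiff ℝ 3 Φ ∧ (∀ x ∈ frontier Ω, Φ x = φ x) ∧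
    ∀ j : ℕ, j ≤ 3 → ∀ x, ‖iteratedFDeriv ℝ j Φ x‖ ≤ K

/-! ### The two Neumann problems -/

/-- The boundary condition `u_ν = -β u + φ` on `∂Ω`. -/
def NeumannCondition {n : ℕ} (Ω : Set (Cn n)) (β : ℝ) (φ u : Cn n → ℝ) : Prop :=
  ∀ x ∈ frontier Ω, ∀ ν : Cn n, IsOuterUnitNormal Ω x ν →
    fderivWithin ℝ u (closure Ω) x ν = -β * u x + φ x

/-- `u` is a solution of the Neumann problem `σ_k(Δu I - ∂∂̄u) = ψ` in `Ω`,
`u_ν = -β u + φ` on `∂Ω`. -/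
def SolvesHessian {n : ℕ} (k : ℕ) (Ω : Set (Cn n)) (β : ℝ) (φ ψ u : Cn n → ℝ) : Prop :=
  (∀ z ∈ Ω, sigma k (eta u z) = ψ z) ∧ NeumannCondition Ω β φ u

/-- `u` is a solution of the Neumann problem
`σ_k(Δu I - ∂∂̄u) / σ_l(Δu I - ∂∂̄u) = ψ` in `Ω`, `u_ν = -β u + φ` on `∂Ω`. -/
def SolvesQuotient {n : ℕ} (k l : ℕ) (Ω : Set (Cn n)) (β : ℝ) (φ ψ u : Cn n → ℝ) : Prop :=
  (∀ z ∈ Ω, sigma k (eta u z) / sigma l (eta u z) = ψ z) ∧ NeumannCondition Ω β φ u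

end NeumannHessian

end

/-! The estimate comes from doubling the variables, so the equation is never differentiated. It
enters only through `ψ ≤ K`, which is why the constant needs no positive lower bound of `ψ`.

Let `w` behave to first order like the distance to the boundary. Then `v = exp(-β w) u + Φ w` has
vanishing normal derivative on the boundary. With the concave modulus `θ(r) = r - B r²/2` and the
weight `m = exp(-γ w)`, the claim is `v(x) - v(y) ≤ L θ(|x - y|) m(x) m(y)` for nearby points of the
closure. Letting `y → x` then bounds the gradient. If the claim fails, the difference of the two
sides has a positive maximum at distinct points `x`, `y`, and there are three cases.

Pairs at the largest admitted distance are excluded by taking `L` large against the supremum of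
`|v|`.

If `x` or `y` lies on the boundary, the pair is tested along the inner normal. Since `w ≥ 0` on the
closure, Taylor's formula shows that the distance grows there at rate at most `W |x - y|`, whatever
the curvature. The decay of `m` is faster, and this contradicts maximality
(`boundary_doubling_false`).

If both points are interior, moving them in parallel bounds the real Hessian of `u` at `x`, weighted
by `a = exp(-β w)`, by the weighted Hessian at `y` plus `O(L)`. Moving them in opposite directions
along `x - y` uses the concavity of `θ` and gains a term of order `B L`. Hence `D = a(y) ∂∂̄u(y) -
a(x) ∂∂̄u(x) + s I` is positive semidefinite with an eigenvalue at least `T`, where `s = O(L)`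
independently of `B` and `T` is of order `B L`. Passing to `tr(A) I - A` adds `tr(D) I - D` to a
matrix in the Gårding cone, and this addition is the decisive point: `tr(D) I - D` is a nonnegative
combination of projections `I - e e*`. As `k ≤ n - 1`, such a direction misses only one coordinate,
and Newton's inequality makes every quotient `σ_{j+1}/σ_j` with `j < k` grow linearly along it
(`uniform_ellipticity`, `exists_ratio_bound`, `exists_ratio_bound_matrix`). Fixing `B` first and
then `L > K`, all these quotients are at least `L` at `y` (`ratio_of_interior_doubling`). So
`σ_k/σ_l ≥ L > K` for every `l < k`, with `σ_0 = 1`, against the equation (`not_large_ratio`). -/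

noncomputable section

namespace NeumannHessian

/-! ### Elementary symmetric functions of finite families -/

/-- The `j`-th elementary symmetric function of the family `(v i)_{i ∈ s}`. -/
def esym {ι : Type*} (s : Finset ι) (j : ℕ) (v : ι → ℝ) : ℝ :=
  ∑ S ∈ Finset.powersetCard j s, ∏ i ∈ S, v i

theorem sigma_eq_esym {n : ℕ} (j : ℕ) (v : Fin n → ℝ) : sigma j v = esym Finset.univ j v := rfl

section esym

variable {ι : Type*} [DecidableEq ι]

theorem esym_zero (s : Finset ι) (v : ι → ℝ) : esym s 0 v = 1 := by
  simp [esym]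

theorem esym_eq_zero {s : Finset ι} {j : ℕ} (h : s.card < j) (v : ι → ℝ) : esym s j v = 0 := by
  simp [esym, Finset.powersetCard_eq_empty.2 h]

theorem esym_insert {s : Finset ι} {a : ι} (ha : a ∉ s) (j : ℕ) (v : ι → ℝ) :
    esym (insert a s) (j + 1) v = esym s (j + 1) v + v a * esym s j v := by
  unfold esym
  rw [Finset.powersetCard_succ_insert ha, Finset.sum_union, Finset.sum_image, Finset.mul_sum]
  · congr 1
    refine Finset.sum_congr rfl fun S hS => ?_
    rw [Finset.prod_insert fun h => ha ((Finset.mem_powersetCard.1 hS).1 h)]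
  · intro S hS S' hS' h
    have h1 : a ∉ S := fun h => ha ((Finset.mem_powersetCard.1 hS).1 h)
    have h2 : a ∉ S' := fun h => ha ((Finset.mem_powersetCard.1 hS').1 h)
    rw [← Finset.erase_insert h1, ← Finset.erase_insert h2]
    exact congrArg (fun t => Finset.erase t a) h
  · rw [Finset.disjoint_left]
    intro S hS hS'
    obtain ⟨T, -, rfl⟩ := Finset.mem_image.1 hS'
    exact ha ((Finset.mem_powersetCard.1 hS).1 (Finset.mem_insert_self _ _))

theorem esym_erase {s : Finset ι} {a : ι} (ha : a ∈ s) (j : ℕ) (v : ι → ℝ) :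
    esym s (j + 1) v = esym (s.erase a) (j + 1) v + v a * esym (s.erase a) j v := by
  conv_lhs => rw [← Finset.insert_erase ha]
  exact esym_insert (Finset.notMem_erase _ _) j v

theorem esym_congr {s : Finset ι} {v w : ι → ℝ} (h : ∀ i ∈ s, v i = w i) (j : ℕ) :
    esym s j v = esym s j w :=
  Finset.sum_congr rfl fun _ hS =>
    Finset.prod_congr rfl fun i hi => h i ((Finset.mem_powersetCard.1 hS).1 hi)

/-- Euler's relation for the deletions of an elementary symmetric function. -/
theorem sum_esym_erase (s : Finset ι) (j : ℕ) (v : ι → ℝ) :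
    ∑ i ∈ s, esym (s.erase i) j v = ((s.card : ℝ) - j) * esym s j v := by
  induction s using Finset.induction_on generalizing j with
  | empty =>
    rcases j with _ | j
    · simp
    · simp [esym_eq_zero (s := (∅ : Finset ι)) (j := j + 1) (by simp)]
  | insert a s ha ih =>
    have key : ∀ i ∈ s, (insert a s).erase i = insert a (s.erase i) := fun i hi =>
      Finset.erase_insert_of_ne fun h => ha (h ▸ hi)
    rw [Finset.sum_insert ha, Finset.erase_insert ha]
    rcases j with _ | j
    · rw [Finset.sum_congr rfl fun i hi => by rw [esym_zero]]
      simp [esym_zero, Finset.card_insert_of_notMem ha]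
      ring
    · have h2 : ∀ i ∈ s, esym ((insert a s).erase i) (j + 1) v
          = esym (s.erase i) (j + 1) v + v a * esym (s.erase i) j v := fun i hi => by
        rw [key i hi, esym_insert fun h => ha (Finset.mem_of_mem_erase h)]
      rw [Finset.sum_congr rfl h2, Finset.sum_add_distrib, ← Finset.mul_sum, ih, ih,
        esym_insert ha, Finset.card_insert_of_notMem ha]
      push_cast
      ring

theorem hasDerivAt_esym (s : Finset ι) (j : ℕ) (v p : ι → ℝ) (t : ℝ) :
    HasDerivAt (fun t : ℝ => esym s (j + 1) (fun i => v i + t * p i))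
      (∑ i ∈ s, p i * esym (s.erase i) j (fun i => v i + t * p i)) t := by
  induction s using Finset.induction_on generalizing j with
  | empty =>
    simp only [esym_eq_zero (s := (∅ : Finset ι)) (j := j + 1) (by simp), Finset.sum_empty]
    exact hasDerivAt_const _ _
  | insert a s ha ih =>
    have key : ∀ i ∈ s, (insert a s).erase i = insert a (s.erase i) := fun i hi =>
      Finset.erase_insert_of_ne fun h => ha (h ▸ hi)
    simp only [esym_insert ha]
    have hlin : HasDerivAt (fun t : ℝ => v a + t * p a) (p a) t := by
      simpa using ((hasDerivAt_id t).mul_const (p a)).const_add (v a)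
    rw [Finset.sum_insert ha, Finset.erase_insert ha]
    rcases j with _ | j
    · simp only [esym_zero, mul_one]
      have h := (ih 0).add hlin
      simp only [esym_zero, mul_one] at h
      convert! h using 1
      ring
    · have h := (ih (j + 1)).add (hlin.mul (ih j))
      convert! h using 1
      have h2 : ∀ i ∈ s, p i * esym ((insert a s).erase i) (j + 1) (fun i => v i + t * p i)
          = p i * esym (s.erase i) (j + 1) (fun i => v i + t * p i)
            + (v a + t * p a) * (p i * esym (s.erase i) j (fun i => v i + t * p i)) :=
          fun i hi => by
        rw [key i hi, esym_insert fun h => ha (Finset.mem_of_mem_erase h)]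
        ring
      rw [Finset.sum_congr rfl h2, Finset.sum_add_distrib, ← Finset.mul_sum]
      ring

end esym

/-! ### Newton's inequality -/

-- Rolle's theorem in counting form: passing to the derivative loses at most one real root with
-- multiplicity, and the degree drops by at least one.
open Polynomial in
theorem splits_derivative_real {p : ℝ[X]} (hp : p.Splits) : (derivative p).Splits := by
  rcases Nat.eq_zero_or_pos p.natDegree with h0 | h0
  · have : derivative p = 0 := by
      rw [natDegree_eq_zero.1 h0 |>.choose_spec.symm]; simp
    rw [this]; exact Splits.zero
  · rw [splits_iff_card_roots]
    have h1 := card_roots_le_derivative p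
    have h2 := splits_iff_card_roots.1 hp
    have h3 := (derivative p).card_roots'
    have h4 := natDegree_derivative_lt (p := p) (by omega)
    omega

open Polynomial in
/-- The three lowest coefficients of a real-rooted polynomial of degree at least one. -/
theorem coeff_inequality_multiset (b : Multiset ℝ) (hb : b ≠ 0) :
    2 * (b.card : ℝ) * ((b.map fun a => X - C a).prod.coeff 0 *
        (b.map fun a => X - C a).prod.coeff 2)
      ≤ ((b.card : ℝ) - 1) * (b.map fun a => X - C a).prod.coeff 1 ^ 2 := by
  induction b using Multiset.induction_on with
  | empty => exact absurd rfl hb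
  | cons a b ih =>
    rcases eq_or_ne b 0 with rfl | hb0
    · simp [coeff_X, coeff_C]
    have ih := ih hb0
    have hd : (0 : ℝ) < b.card := by
      exact_mod_cast Multiset.card_pos.2 hb0
    rw [Multiset.map_cons, Multiset.prod_cons, Multiset.card_cons]
    set P := (b.map fun a => X - C a).prod
    have e0 : ((X - C a) * P).coeff 0 = -a * P.coeff 0 := by
      rw [sub_mul, coeff_sub, coeff_C_mul, mul_coeff_zero]; simp
    have e1 : ((X - C a) * P).coeff 1 = P.coeff 0 - a * P.coeff 1 := by
      rw [sub_mul, coeff_sub, coeff_C_mul, show (1 : ℕ) = 0 + 1 from rfl, coeff_X_mul]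
    have e2 : ((X - C a) * P).coeff 2 = P.coeff 1 - a * P.coeff 2 := by
      rw [sub_mul, coeff_sub, coeff_C_mul, show (2 : ℕ) = 1 + 1 from rfl, coeff_X_mul]
    rw [e0, e1, e2]
    push_cast
    generalize P.coeff 0 = x at *
    generalize P.coeff 1 = y at *
    generalize P.coeff 2 = z at *
    generalize (b.card : ℝ) = d at *
    have h1 : 0 ≤ (a * y + d * x) ^ 2 := sq_nonneg _
    have h2 := mul_le_mul_of_nonneg_left ih (mul_nonneg (sq_nonneg a) (by linarith : 0 ≤ d + 1))
    -- Multiplied by `d`, the defect in the inequality after adding the root `a` is at least the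
    -- square `(a y + d x)²`, by the induction hypothesis times `a² (d + 1)`. No division by roots
    -- is involved, so zero roots cause no trouble.
    have h3 : 0 ≤ d * (d * (x - a * y) ^ 2 - 2 * (d + 1) * (-a * x * (y - a * z))) := by
      nlinarith
    have h4 := nonneg_of_mul_nonneg_right h3 hd
    linarith

open Polynomial in
theorem coeff_inequality_of_splits {q : ℝ[X]} (hq : q.Splits) {d : ℕ} (hd : q.natDegree = d)
    (hd1 : 1 ≤ d) :
    2 * (d : ℝ) * (q.coeff 0 * q.coeff 2) ≤ ((d : ℝ) - 1) * q.coeff 1 ^ 2 := by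
  have h1 := hq.eq_prod_roots
  have h2 : q.roots.card = d := by rw [splits_iff_card_roots.1 hq, hd]
  have h3 := coeff_inequality_multiset q.roots (by
    intro h; rw [h] at h2; simp at h2; omega)
  rw [h2] at h3
  rw [h1]
  simp only [coeff_C_mul]
  have := mul_le_mul_of_nonneg_left h3 (sq_nonneg q.leadingCoeff)
  linarith

open Polynomial in
/-- **Newton's inequality** for the elementary symmetric functions of a real family. -/
theorem newton_inequality {ι : Type*} [DecidableEq ι] (s : Finset ι) (v : ι → ℝ) (r : ℕ) :
    ((r : ℝ) + 2) * ((s.card : ℝ) - r) * (esym s (r + 2) v * esym s r v)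
      ≤ ((r : ℝ) + 1) * ((s.card : ℝ) - r - 1) * esym s (r + 1) v ^ 2 := by
  rcases lt_or_ge s.card (r + 2) with hm | hm
  · rw [esym_eq_zero hm]
    rcases lt_or_ge s.card (r + 1) with hm1 | hm1
    · rw [esym_eq_zero hm1]; simp
    · have : s.card = r + 1 := by omega
      rw [this]; push_cast; simp
  · obtain ⟨k, hk⟩ : ∃ k, s.card = k + (r + 2) := ⟨s.card - (r + 2), by omega⟩
    set P : ℝ[X] := ∏ i ∈ s, (X + C (v i)) with hP
    have hsp : P.Splits := Splits.prod fun i _ => Splits.X_add_C _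
    have hdeg : P.natDegree = s.card := by
      rw [hP, natDegree_prod_of_monic _ _ fun i _ => monic_X_add_C _]
      simp
    have hcoef : ∀ j, j ≤ s.card → P.coeff j = esym s (s.card - j) v := fun j hj => by
      rw [hP, Finset.prod_X_add_C_coeff s v hj]; rfl
    -- The `k`-fold derivative is still real-rooted, has degree `r + 2`, and its three lowest
    -- coefficients are multiples of `σ_{r+2}`, `σ_{r+1}` and `σ_r`.
    set Q : ℝ[X] := derivative^[k] P with hQ
    have hQs : Q.Splits :=
      Function.Iterate.rec (motive := fun p : ℝ[X] => p.Splits)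
        hsp (fun _ h => splits_derivative_real h) k
    have hQc : ∀ j, Q.coeff j = ((j + k).descFactorial k : ℝ) * P.coeff (j + k) := fun j => by
      rw [hQ, coeff_iterate_derivative, nsmul_eq_mul]
    have hQd : Q.natDegree = r + 2 := by
      apply le_antisymm
      · have := natDegree_iterate_derivative P k
        rw [← hQ] at this; omega
      · apply le_natDegree_of_ne_zero
        rw [hQc, hcoef _ (by omega), show s.card - (r + 2 + k) = 0 by omega, esym_zero, mul_one]
        exact_mod_cast (Nat.descFactorial_pos.2 (by omega)).ne'
    have h := coeff_inequality_of_splits hQs hQd (by omega)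
    rw [hQc, hQc, hQc, hcoef _ (by omega), hcoef _ (by omega), hcoef _ (by omega),
      show s.card - (0 + k) = r + 2 by omega, show s.card - (1 + k) = r + 1 by omega,
      show s.card - (2 + k) = r by omega] at h
    have f0 : ((0 + k).descFactorial k : ℝ) = k.factorial := by
      rw [zero_add, Nat.descFactorial_self]
    have f1 : ((1 + k).descFactorial k : ℝ) = (k + 1) * k.factorial := by
      have := Nat.factorial_mul_descFactorial (n := 1 + k) (k := k) (by omega)
      rw [show 1 + k - k = 1 by omega, Nat.factorial_one, one_mul] at this
      rw [this, add_comm 1 k, Nat.factorial_succ]; push_cast; ring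
    have f2 : 2 * ((2 + k).descFactorial k : ℝ) = (k + 2) * (k + 1) * k.factorial := by
      have := Nat.factorial_mul_descFactorial (n := 2 + k) (k := k) (by omega)
      rw [show 2 + k - k = 2 by omega, Nat.factorial_two] at this
      have h' : (2 * ((2 + k).descFactorial k : ℝ)) = ((2 + k).factorial : ℝ) := by
        exact_mod_cast this
      rw [h', add_comm 2 k, Nat.factorial_succ, Nat.factorial_succ]; push_cast; ring
    have hF : (0 : ℝ) < k.factorial := by exact_mod_cast k.factorial_pos
    rw [f0, f1] at h
    rw [hk]
    push_cast at h ⊢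
    generalize (k.factorial : ℝ) = F at *
    generalize ((2 + k).descFactorial k : ℝ) = G at *
    have hG : G = (k + 2) * (k + 1) * F / 2 := by linarith
    rw [hG] at h
    have hk1 : (0 : ℝ) < ((k : ℝ) + 1) * F ^ 2 := by positivity
    refine le_of_mul_le_mul_left ?_ hk1
    linarith

/-! ### The Gårding cone of a finite family -/

section cone

variable {ι : Type*} [DecidableEq ι]

/-- The first `k` elementary symmetric functions of the family `(v i)_{i ∈ s}` are positive. -/
def InCone (s : Finset ι) (k : ℕ) (v : ι → ℝ) : Prop :=
  ∀ j ≤ k, 0 < esym s j v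

theorem InCone.mono {s : Finset ι} {k l : ℕ} {v : ι → ℝ} (h : InCone s k v) (hl : l ≤ k) :
    InCone s l v := fun j hj => h j (hj.trans hl)

/-- A weak form of Newton's inequality. -/
theorem newton_inequality_weak (s : Finset ι) (v : ι → ℝ) (r : ℕ) :
    esym s (r + 2) v * esym s r v ≤ esym s (r + 1) v ^ 2 := by
  have h := newton_inequality s v r
  rcases le_or_gt (esym s (r + 2) v * esym s r v) 0 with h0 | h0
  · exact h0.trans (sq_nonneg _)
  · have hm : (r : ℝ) + 2 ≤ s.card := by
      by_contra hlt
      have : s.card < r + 2 := by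
        by_contra h'; exact hlt (by exact_mod_cast not_lt.1 h')
      rw [esym_eq_zero this] at h0; simp at h0
    have hr : (0 : ℝ) ≤ r := Nat.cast_nonneg r
    generalize (s.card : ℝ) = m at *
    generalize (r : ℝ) = ρ at *
    have hc : 0 < (ρ + 1) * (m - ρ - 1) := by apply mul_pos <;> linarith
    refine le_of_mul_le_mul_left ?_ hc
    refine le_trans ?_ h
    exact mul_le_mul_of_nonneg_right (by nlinarith) h0.le

/-- Write `a`, `b`, `c` for the deleted functions of order `j+1`, `j`, `j+2`, and `x = v i`. If `a ≤
0 < b`, positivity of `a + x b` and `c + x a` forces `x > 0` and `c b > -x a b ≥ a²`, against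
Newton's inequality. -/
theorem InCone.erase {s : Finset ι} {k : ℕ} {v : ι → ℝ} (h : InCone s (k + 1) v) {i : ι}
    (hi : i ∈ s) : InCone (s.erase i) k v := by
  intro j
  induction j using Nat.strong_induction_on with
  | _ j ih =>
    intro hj
    rcases j with _ | j
    · rw [esym_zero]; exact one_pos
    have hb := ih j (by omega) (by omega)
    have h1 := h (j + 2) (by omega)
    have h2 := h (j + 1) (by omega)
    rw [esym_erase hi] at h1 h2
    have hN := newton_inequality_weak (s.erase i) v j
    by_contra hneg
    rw [not_lt] at hneg
    generalize esym (s.erase i) (j + 2) v = c at *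
    generalize esym (s.erase i) (j + 1) v = a at *
    generalize esym (s.erase i) j v = b at *
    generalize v i = x at *
    have hx : 0 < x * b := by linarith
    have hx0 : 0 < x := pos_of_mul_pos_left hx hb.le
    have h3 : 0 ≤ (a + x * b) * (-a) := mul_nonneg h2.le (by linarith)
    nlinarith [mul_pos h1 hb]

/-- Uniform ellipticity: no single coordinate carries the whole trace of the linearised
operator. -/
theorem uniform_ellipticity {s : Finset ι} {r : ℕ} {v : ι → ℝ} (h : InCone s (r + 1) v)
    (hr : r + 2 ≤ s.card) {i : ι} (hi : i ∈ s) :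
    esym s r v ≤ s.card * ∑ t ∈ s.erase i, esym (s.erase t) r v := by
  have hsum := sum_esym_erase s r v
  rw [← Finset.add_sum_erase s _ hi] at hsum
  have hN : (0 : ℝ) < s.card := by exact_mod_cast (by omega : 0 < s.card)
  have hrN : (r : ℝ) + 2 ≤ s.card := by exact_mod_cast hr
  have hr0 : (0 : ℝ) ≤ r := Nat.cast_nonneg r
  have hE := h r (by omega)
  -- By Euler's relation, it suffices to bound the deletion at `i` by a proper part of the sum of
  -- all deletions. The sharp Newton constants matter: `(ρ+2)(N-1-ρ) - (ρ+1)(N-2-ρ) = N` for `r = ρ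
  -- + 1`. The remainder is at least `(N-r)(N-r-1)/N` times `σ_r`, and `r + 2 ≤ N` keeps this factor
  -- at least `1/N`.
  suffices hs : s.card * esym (s.erase i) r v ≤ (r + 1) * (s.card - r) * esym s r v by
    have e : ∑ t ∈ s.erase i, esym (s.erase t) r v
        = (s.card - r) * esym s r v - esym (s.erase i) r v := by linarith
    rw [e]
    generalize (s.card : ℝ) = N at *
    generalize (r : ℝ) = ρ at *
    have h1 : 1 ≤ (N - ρ) * (N - ρ - 1) := by nlinarith
    nlinarith
  rcases r with _ | r
  · simp [esym_zero]
  have hm : ((s.erase i).card : ℝ) = s.card - 1 := by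
    rw [Finset.card_erase_of_mem hi, Nat.cast_sub (by omega)]; simp
  have hNw := newton_inequality (s.erase i) v r
  rw [hm] at hNw
  have hc := h.erase hi
  have ha := hc (r + 1) le_rfl
  have hb := hc r (by omega)
  have h1 := h (r + 2) le_rfl
  rw [esym_erase hi] at h1
  rw [esym_erase hi r] at hE ⊢
  push_cast at *
  generalize esym (s.erase i) (r + 2) v = c at *
  generalize esym (s.erase i) (r + 1) v = a at *
  generalize esym (s.erase i) r v = b at *
  generalize v i = x at *
  generalize (s.card : ℝ) = N at *
  generalize (r : ℝ) = ρ at *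
  refine le_of_mul_le_mul_left ?_ ha
  have h2 : 0 ≤ (c + x * a) * b := mul_nonneg h1.le hb.le
  have h3 : 0 ≤ (ρ + 2) * (N - 1 - ρ) := by apply mul_nonneg <;> linarith
  have h4 := mul_nonneg h3 h2
  nlinarith

end cone

end NeumannHessian

end

/-! ### Monotonicity and growth of the quotients `σ_{j+1}/σ_j` in the cone -/

noncomputable section

namespace NeumannHessian

section cone

variable {ι : Type*} [DecidableEq ι]

theorem esym_add_single {s : Finset ι} {i : ι} (hi : i ∈ s) (j : ℕ) (v : ι → ℝ) (τ : ℝ) :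
    esym s (j + 1) (v + Pi.single i τ) = esym s (j + 1) v + τ * esym (s.erase i) j v := by
  have h : ∀ j, esym (s.erase i) j (v + Pi.single i τ) = esym (s.erase i) j v := fun j =>
    esym_congr (fun t ht => by simp [Finset.ne_of_mem_erase ht]) j
  rw [esym_erase hi, esym_erase hi j v, h, h]
  simp
  ring

theorem InCone.add_single {s : Finset ι} {k : ℕ} {v : ι → ℝ} (h : InCone s k v) {i : ι}
    (hi : i ∈ s) {τ : ℝ} (hτ : 0 ≤ τ) : InCone s k (v + Pi.single i τ) := by
  intro j hj
  rcases j with _ | j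
  · rw [esym_zero]; exact one_pos
  · rw [esym_add_single hi]
    have := ((h.mono hj).erase hi) j le_rfl
    have := h (j + 1) hj
    positivity

/-- Both sides are affine in `τ`, so only the slopes need comparing: a lower bound `κ` for the
quotient of `v` must pass to the quotient, one order lower, of the family with `i` deleted. This is
Newton's inequality for the deleted family. -/
theorem ratio_add_single {s : Finset ι} {k : ℕ} {v : ι → ℝ} (h : InCone s k v) {i : ι}
    (hi : i ∈ s) {τ : ℝ} (hτ : 0 ≤ τ) {j : ℕ} (hj : j < k) {κ : ℝ}
    (hκ : κ * esym s j v ≤ esym s (j + 1) v) :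
    κ * esym s j (v + Pi.single i τ) ≤ esym s (j + 1) (v + Pi.single i τ) := by
  have hc := (h.mono hj).erase hi
  rw [esym_add_single hi]
  rcases j with _ | j
  · rw [esym_zero] at *
    rw [esym_zero]
    simpa using hκ.trans (le_add_of_nonneg_right hτ)
  · rw [esym_add_single hi]
    suffices hs : κ * esym (s.erase i) j v ≤ esym (s.erase i) (j + 1) v by
      nlinarith
    have hE := h (j + 1) (by omega)
    have hb := hc j (by omega)
    have hN := newton_inequality_weak (s.erase i) v j
    refine le_of_mul_le_mul_right ?_ hE
    have h1 := mul_le_mul_of_nonneg_right hκ hb.le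
    rw [esym_erase hi] at h1
    rw [esym_erase hi] at h1 ⊢
    linarith

theorem induction_add_nonneg [Fintype ι] {P : (ι → ℝ) → Prop}
    (hP : ∀ v i τ, 0 ≤ τ → P v → P (v + Pi.single i τ)) {v p : ι → ℝ} (hv : P v)
    (hp : ∀ i, 0 ≤ p i) : P (v + p) := by
  have key : ∀ s : Finset ι, P (v + ∑ i ∈ s, Pi.single i (p i)) := by
    intro s
    induction s using Finset.induction_on with
    | empty => simpa using hv
    | insert a s ha ih =>
      rw [Finset.sum_insert ha, add_comm (Pi.single a (p a) : ι → ℝ), ← add_assoc]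
      exact hP _ _ _ (hp a) ih
  simpa [Finset.univ_sum_single] using key Finset.univ

theorem InCone.add_nonneg [Fintype ι] {k : ℕ} {v p : ι → ℝ} (h : InCone Finset.univ k v)
    (hp : ∀ i, 0 ≤ p i) : InCone Finset.univ k (v + p) :=
  induction_add_nonneg (P := InCone Finset.univ k)
    (fun _ _ _ hτ hv => hv.add_single (Finset.mem_univ _) hτ) h hp

theorem ratio_add_nonneg [Fintype ι] {k : ℕ} {v p : ι → ℝ} (h : InCone Finset.univ k v)
    (hp : ∀ i, 0 ≤ p i) {j : ℕ} (hj : j < k) {κ : ℝ}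
    (hκ : κ * esym Finset.univ j v ≤ esym Finset.univ (j + 1) v) :
    κ * esym Finset.univ j (v + p) ≤ esym Finset.univ (j + 1) (v + p) :=
  (induction_add_nonneg (P := fun v => InCone Finset.univ k v ∧
      κ * esym Finset.univ j v ≤ esym Finset.univ (j + 1) v)
    (fun _ _ _ hτ hv => ⟨hv.1.add_single (Finset.mem_univ _) hτ,
      ratio_add_single hv.1 (Finset.mem_univ _) hτ hj hv.2⟩) ⟨h, hκ⟩ hp).2

/-- Moving inside the cone in a direction `(1, …, 1, 0, 1, …, 1)` increases the quotients
`σ_{j+1} / σ_j` at least linearly. -/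
theorem exists_ratio_bound [Fintype ι] {k : ℕ} (hk : k + 1 ≤ Fintype.card ι) :
    ∃ c : ℝ, 0 < c ∧ ∀ v : ι → ℝ, InCone Finset.univ k v → ∀ i : ι, ∀ t : ℝ, 0 ≤ t →
      ∀ j < k, c * t * esym Finset.univ j (v + t • (1 - Pi.single i 1))
        ≤ esym Finset.univ (j + 1) (v + t • (1 - Pi.single i 1)) := by
  suffices H : ∀ J ≤ k, ∃ c : ℝ, 0 < c ∧ ∀ v : ι → ℝ, InCone Finset.univ k v → ∀ i : ι,
      ∀ t : ℝ, 0 ≤ t → ∀ j < J, c * t * esym Finset.univ j (v + t • (1 - Pi.single i 1))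
        ≤ esym Finset.univ (j + 1) (v + t • (1 - Pi.single i 1)) from H k le_rfl
  intro J
  induction J with
  | zero => exact fun _ => ⟨1, one_pos, fun _ _ _ _ _ j hj => absurd hj (by omega)⟩
  | succ J ih =>
    intro hJ
    obtain ⟨c, hc, H⟩ := ih (by omega)
    set N : ℝ := (Fintype.card ι : ℝ) with hN
    have hN0 : 0 < N := by
      rw [hN]; exact_mod_cast (by omega : 0 < Fintype.card ι)
    -- With this choice `c' (1 + N / c) = 1 / N`, the ellipticity constant in `hlow`. The two terms
    -- coming from the derivative of `c' t σ_j` are then absorbed by the derivative of `σ_{j+1}`.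
    set c' := c / (N * (c + N)) with hc'
    have hc'0 : 0 < c' := by positivity
    refine ⟨min c c', lt_min hc hc'0, fun v hv i t ht j hj => ?_⟩
    set p : ι → ℝ := 1 - Pi.single i 1 with hp
    have hp0 : ∀ s, 0 ≤ p s := fun s => by
      by_cases h : s = i
      · subst h; simp [hp]
      · simp [hp, h]
    have hcone : ∀ t : ℝ, 0 ≤ t → InCone Finset.univ k (v + t • p) := fun t ht =>
      hv.add_nonneg fun s => mul_nonneg ht (hp0 s)
    have hpos := hcone t ht j (by omega)
    rcases Nat.lt_succ_iff_lt_or_eq.1 hj with hj' | rfl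
    · refine le_trans ?_ (H v hv i t ht j hj')
      exact mul_le_mul_of_nonneg_right (mul_le_mul_of_nonneg_right (min_le_left _ _) ht) hpos.le
    refine le_trans (mul_le_mul_of_nonneg_right
      (mul_le_mul_of_nonneg_right (min_le_right _ _) ht) hpos.le) ?_
    set f : ℕ → ℝ → ℝ := fun j t => esym Finset.univ j (v + t • p) with hf
    set f' : ℕ → ℝ → ℝ := fun j t =>
      ∑ s, p s * esym (Finset.univ.erase s) j (v + t • p) with hf'
    have hder : ∀ j t, HasDerivAt (f (j + 1)) (f' j t) t := fun j t =>
      hasDerivAt_esym Finset.univ j v p t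
    have hf'eq : ∀ j t, f' j t
        = ∑ s ∈ Finset.univ.erase i, esym (Finset.univ.erase s) j (v + t • p) := by
      intro j t
      simp only [hf']
      rw [← Finset.add_sum_erase _ _ (Finset.mem_univ i)]
      simp only [hp, Pi.sub_apply, Pi.one_apply, Pi.single_eq_same, sub_self, zero_mul, zero_add]
      refine Finset.sum_congr rfl fun s hs => ?_
      rw [Pi.single_eq_of_ne (Finset.ne_of_mem_erase hs)]
      simp
    have hlow : ∀ t, 0 ≤ t → f j t ≤ N * f' j t := fun t ht => by
      rw [hf'eq]
      have := uniform_ellipticity (s := Finset.univ) (r := j) ((hcone t ht).mono (by omega))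
        (by rw [Finset.card_univ]; omega) (Finset.mem_univ i)
      rwa [Finset.card_univ] at this
    -- The difference is positive at `t = 0` because `v` lies in the cone, so it is enough that it
    -- be nondecreasing.
    have hmain : ∀ t, 0 ≤ t → ∃ F', HasDerivAt (fun t => f (j + 1) t - c' * t * f j t) F' t ∧
        0 ≤ F' := by
      intro t ht
      have hct : HasDerivAt (fun t : ℝ => c' * t) c' t := by
        simpa using (hasDerivAt_id t).const_mul c'
      have hkey : c' * (c + N) * N = c := by
        rw [hc']; field_simp
      have hfj : 0 < f j t := hcone t ht j (by omega)
      have hl := hlow t ht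
      rcases j with _ | j
      · have h0 : HasDerivAt (f 0) 0 t := by
          have : f 0 = fun _ => 1 := by ext t; exact esym_zero _ _
          rw [this]; exact hasDerivAt_const _ _
        refine ⟨_, (hder 0 t).sub (hct.mul h0), ?_⟩
        have h1 : c' * N ≤ 1 := by
          have h2 : (c' * N) * (c + N) = c := by linarith
          have h3 : 0 < c' * N := by positivity
          by_contra hlt
          rw [not_le] at hlt
          nlinarith
        have h2 : N * (c' * f 0 t) ≤ N * f' 0 t := by nlinarith
        have := le_of_mul_le_mul_left h2 hN0
        linarith
      · refine ⟨_, (hder (j + 1) t).sub (hct.mul (hder j t)), ?_⟩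
        -- Euler's relation with the nonnegative deletion at `i` dropped. Together with the
        -- induction hypothesis `c t σ_j ≤ σ_{j+1}` it controls `t` times the derivative of
        -- `σ_{j+1}`.
        have hup : f' j t ≤ N * f j t := by
          have hsum := sum_esym_erase Finset.univ j (v + t • p)
          rw [← Finset.add_sum_erase _ _ (Finset.mem_univ i), ← hf'eq, Finset.card_univ] at hsum
          have h1 := (((hcone t ht).mono (show j + 1 ≤ k by omega)).erase
            (Finset.mem_univ i)) j le_rfl
          have h2 : 0 ≤ (j : ℝ) * f j t :=
            mul_nonneg (Nat.cast_nonneg _) (hcone t ht j (by omega)).le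
          have h3 : (Fintype.card ι - (j : ℝ)) * f j t = N * f j t - j * f j t := by
            rw [sub_mul]
          have h4 : esym (Finset.univ.erase i) j (v + t • p) + f' j t = N * f j t - j * f j t :=
            hsum.trans h3
          linarith
        have hHj : c * t * f j t ≤ f (j + 1) t := H v hv i t ht j (by omega)
        have e1 : c * (t * f' j t) ≤ N * f (j + 1) t := by
          calc c * (t * f' j t) ≤ c * (t * (N * f j t)) := by gcongr
            _ = N * (c * t * f j t) := by ring
            _ ≤ N * f (j + 1) t := by gcongr
        have e2 : (c * N) * (c' * f (j + 1) t + c' * t * f' j t)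
            ≤ (c * N) * f' (j + 1) t := by
          calc (c * N) * (c' * f (j + 1) t + c' * t * f' j t)
              = N * c' * (c * f (j + 1) t + c * (t * f' j t)) := by ring
            _ ≤ N * c' * (c * f (j + 1) t + N * f (j + 1) t) := by gcongr
            _ = (c' * (c + N) * N) * f (j + 1) t := by ring
            _ = c * f (j + 1) t := by rw [hkey]
            _ ≤ c * (N * f' (j + 1) t) := by gcongr
            _ = _ := by ring
        have := le_of_mul_le_mul_left e2 (by positivity)
        linarith
    have hmono : MonotoneOn (fun t => f (j + 1) t - c' * t * f j t) (Set.Ici 0) := by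
      refine monotoneOn_of_deriv_nonneg (convex_Ici 0) ?_ ?_ ?_
      · intro t ht
        obtain ⟨F', h, -⟩ := hmain t ht
        exact h.continuousAt.continuousWithinAt
      · intro t ht
        rw [interior_Ici] at ht
        obtain ⟨F', h, -⟩ := hmain t (le_of_lt ht)
        exact h.differentiableAt.differentiableWithinAt
      · intro t ht
        rw [interior_Ici] at ht
        obtain ⟨F', h, h0⟩ := hmain t (le_of_lt ht)
        rw [h.deriv]; exact h0
    have hfin := hmono (Set.mem_Ici.2 le_rfl) (Set.mem_Ici.2 ht) ht
    have h0 := hcone 0 le_rfl (j + 1) (by omega)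
    simp only [mul_zero, zero_mul, sub_zero] at hfin
    have hfin' : 0 < f (j + 1) t - c' * t * f j t := lt_of_lt_of_le h0 hfin
    exact (sub_pos.1 hfin').le

/-- Translation along the identity increases the quotients `σ_{j+1} / σ_j` at most linearly. -/
theorem ratio_add_const [Fintype ι] {k : ℕ} {v : ι → ℝ} (h : InCone Finset.univ k v) {s : ℝ}
    (hs : 0 ≤ s) {j : ℕ} (hj : j < k) {κ : ℝ} (hκ : 0 ≤ κ)
    (hv : esym Finset.univ (j + 1) v ≤ κ * esym Finset.univ j v) :
    esym Finset.univ (j + 1) (v + s • 1)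
      ≤ (κ + Fintype.card ι * s) * esym Finset.univ j (v + s • 1) := by
  set N : ℝ := (Fintype.card ι : ℝ) with hN
  set f : ℕ → ℝ → ℝ := fun j t => esym Finset.univ j (v + t • (1 : ι → ℝ)) with hf
  have hder : ∀ j t, HasDerivAt (f (j + 1)) ((N - j) * f j t) t := fun j t => by
    have h := hasDerivAt_esym Finset.univ j v 1 t
    simp only [Pi.one_apply, one_mul] at h
    rw [sum_esym_erase, Finset.card_univ] at h
    have e : ∀ t : ℝ, (fun i => v i + t * 1) = v + t • (1 : ι → ℝ) := fun t => by ext; simp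
    simpa only [hf, hN, e] using h
  have hpos : ∀ t, 0 ≤ t → ∀ j ≤ k, 0 < f j t := fun t ht =>
    h.add_nonneg fun _ => by simpa using ht
  have hN0 : (0 : ℝ) ≤ N := Nat.cast_nonneg _
  -- Along the identity `σ_{j+1}` has derivative `(N - j) σ_j`, which the term `N σ_j` from
  -- differentiating `κ + N t` dominates.
  have hmain : ∀ t, 0 ≤ t → ∃ F', HasDerivAt (fun t => (κ + N * t) * f j t - f (j + 1) t) F' t ∧
      0 ≤ F' := by
    intro t ht
    have hct : HasDerivAt (fun t : ℝ => κ + N * t) N t := by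
      simpa using ((hasDerivAt_id t).const_mul N).const_add κ
    have hfj := hpos t ht j hj.le
    rcases j with _ | j
    · have h0 : HasDerivAt (f 0) 0 t := by
        have : f 0 = fun _ => 1 := by ext t; exact esym_zero _ _
        rw [this]; exact hasDerivAt_const _ _
      refine ⟨_, (hct.mul h0).sub (hder 0 t), le_of_eq ?_⟩
      simp
    · refine ⟨_, (hct.mul (hder j t)).sub (hder (j + 1) t), ?_⟩
      have h1 := hpos t ht j (by omega)
      have h2 : 0 ≤ (κ + N * t) * ((N - j) * f j t) := by
        rcases Nat.lt_or_ge (Fintype.card ι) j with hlt | hge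
        · have : f j t = 0 := esym_eq_zero (by simpa using hlt) _
          rw [this]; simp
        · have : (0 : ℝ) ≤ N - j := sub_nonneg.2 (by rw [hN]; exact_mod_cast hge)
          positivity
      have h3 : 0 ≤ ((j : ℝ) + 1) * f (j + 1) t := by positivity
      push_cast
      linarith
  have hmono : MonotoneOn (fun t => (κ + N * t) * f j t - f (j + 1) t) (Set.Ici 0) := by
    refine monotoneOn_of_deriv_nonneg (convex_Ici 0) ?_ ?_ ?_
    · intro t ht
      obtain ⟨F', h, -⟩ := hmain t ht
      exact h.continuousAt.continuousWithinAt
    · intro t ht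
      rw [interior_Ici] at ht
      obtain ⟨F', h, -⟩ := hmain t (le_of_lt ht)
      exact h.differentiableAt.differentiableWithinAt
    · intro t ht
      rw [interior_Ici] at ht
      obtain ⟨F', h, h0⟩ := hmain t (le_of_lt ht)
      rw [h.deriv]; exact h0
  have hfin := hmono (Set.mem_Ici.2 le_rfl) (Set.mem_Ici.2 hs) hs
  simp only [mul_zero, add_zero] at hfin
  have h0 : f (j + 1) 0 ≤ κ * f j 0 := by simpa [hf] using hv
  have : 0 ≤ (κ + N * s) * f j s - f (j + 1) s := by linarith
  exact sub_nonneg.1 this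

end cone

end NeumannHessian

end

noncomputable section

namespace NeumannHessian

open Matrix
open scoped ComplexOrder

/-! ### Eigenvalues of Hermitian matrices -/

section matrix

variable {n : ℕ}

-- The elementary symmetric functions are coefficients of the product polynomial. An identity for
-- large `x` suffices, which leaves room to divide by the factors `x + μ_i` when it is verified.
open Polynomial in
theorem esym_eq_sum_of_prod_eq {ι κ : Type*} [Fintype ι] [DecidableEq ι] [Fintype κ]
    (ν : ι → ℝ) (w : κ → ℝ) (μ : κ → ι → ℝ) (R : ℝ)
    (h : ∀ x : ℝ, R < x → ∏ s, (x + ν s) = ∑ i, w i * ∏ s, (x + μ i s)) (j : ℕ) :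
    esym Finset.univ j ν = ∑ i, w i * esym Finset.univ j (μ i) := by
  rcases lt_or_ge (Fintype.card ι) j with hj | hj
  · rw [esym_eq_zero (by simpa using hj)]
    simp [esym_eq_zero (s := (Finset.univ : Finset ι)) (j := j) (by simpa using hj)]
  have hp : (∏ s, (X + C (ν s)) : ℝ[X]) = ∑ i, C (w i) * ∏ s, (X + C (μ i s)) := by
    refine eq_of_infinite_eval_eq _ _ (Set.Infinite.mono (s := Set.Ioi R) ?_ (Set.Ioi_infinite R))
    intro x hx
    have := h x hx
    simpa [eval_prod, eval_finsetSum] using this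
  have hc := congrArg (fun p : ℝ[X] => p.coeff (Fintype.card ι - j)) hp
  simp only [finsetSum_coeff, coeff_C_mul] at hc
  have key : ∀ v : ι → ℝ, (∏ s, (X + C (v s)) : ℝ[X]).coeff (Fintype.card ι - j)
      = esym Finset.univ j v := fun v => by
    rw [Finset.prod_X_add_C_coeff Finset.univ v (by simp), Finset.card_univ,
      show Fintype.card ι - (Fintype.card ι - j) = j by omega]
    rfl
  simpa only [key] using hc

theorem hermEigenvalues_of_isHermitian {A : Matrix (Fin n) (Fin n) ℂ} (hA : A.IsHermitian) :
    hermEigenvalues A = hA.eigenvalues := dif_pos hA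

/-- A unitary diagonalisation of a Hermitian matrix. -/
theorem exists_unitary_diagonalization {A : Matrix (Fin n) (Fin n) ℂ} (hA : A.IsHermitian) :
    ∃ U : Matrix (Fin n) (Fin n) ℂ, U * Uᴴ = 1 ∧ Uᴴ * U = 1 ∧
      A = U * diagonal (fun i => (hermEigenvalues A i : ℂ)) * Uᴴ := by
  refine ⟨hA.eigenvectorUnitary, ?_, ?_, ?_⟩
  · exact Unitary.coe_mul_star_self hA.eigenvectorUnitary
  · exact Unitary.coe_star_mul_self hA.eigenvectorUnitary
  · rw [hermEigenvalues_of_isHermitian hA]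
    exact hA.spectral_theorem

theorem det_conj_unitary {U B : Matrix (Fin n) (Fin n) ℂ} (h : U * Uᴴ = 1) (x : ℂ) :
    (x • (1 : Matrix (Fin n) (Fin n) ℂ) + U * B * Uᴴ).det
      = (x • (1 : Matrix (Fin n) (Fin n) ℂ) + B).det := by
  have e : x • (1 : Matrix (Fin n) (Fin n) ℂ) + U * B * Uᴴ
      = U * (x • (1 : Matrix (Fin n) (Fin n) ℂ) + B) * Uᴴ := by
    rw [mul_add, add_mul]; simp [h]
  rw [e, det_mul, det_mul, mul_right_comm, ← det_mul, h, det_one, one_mul]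

theorem det_smul_one_add {A : Matrix (Fin n) (Fin n) ℂ} (hA : A.IsHermitian) (x : ℝ) :
    ((x : ℂ) • (1 : Matrix (Fin n) (Fin n) ℂ) + A).det
      = ((∏ s, (x + hermEigenvalues A s) : ℝ) : ℂ) := by
  obtain ⟨U, h1, -, h3⟩ := exists_unitary_diagonalization hA
  conv_lhs => rw [h3]
  rw [det_conj_unitary h1, ← diagonal_one, ← diagonal_smul, diagonal_add, det_diagonal]
  simp

/-- Elementary symmetric functions of the eigenvalues from a formula for the characteristic
polynomial. -/
theorem esym_hermEigenvalues {κ : Type*} [Fintype κ] {A : Matrix (Fin n) (Fin n) ℂ}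
    (hA : A.IsHermitian) (w : κ → ℝ) (μ : κ → Fin n → ℝ) (R : ℝ)
    (h : ∀ x : ℝ, R < x → ((x : ℂ) • (1 : Matrix (Fin n) (Fin n) ℂ) + A).det
      = ((∑ i, w i * ∏ s, (x + μ i s) : ℝ) : ℂ)) (j : ℕ) :
    esym Finset.univ j (hermEigenvalues A) = ∑ i, w i * esym Finset.univ j (μ i) := by
  refine esym_eq_sum_of_prod_eq _ w μ R (fun x hx => ?_) j
  have := h x hx
  rw [det_smul_one_add hA] at this
  exact_mod_cast this

theorem esym_hermEigenvalues_add_smul_one {A : Matrix (Fin n) (Fin n) ℂ} (hA : A.IsHermitian)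
    (s : ℝ) (hA' : (A + (s : ℂ) • (1 : Matrix (Fin n) (Fin n) ℂ)).IsHermitian) (j : ℕ) :
    esym Finset.univ j (hermEigenvalues (A + (s : ℂ) • (1 : Matrix (Fin n) (Fin n) ℂ)))
      = esym Finset.univ j (hermEigenvalues A + s • 1) := by
  have := esym_hermEigenvalues (κ := Unit) hA' (fun _ => 1)
    (fun _ => hermEigenvalues A + s • 1) 0 (fun x _ => by
      rw [add_comm A, ← add_assoc, ← add_smul, ← Complex.ofReal_add, det_smul_one_add hA]
      simp [add_assoc, add_comm s]) j
  simpa using this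

theorem esym_hermEigenvalues_smul {A : Matrix (Fin n) (Fin n) ℂ} (hA : A.IsHermitian)
    {a : ℝ} (ha : 0 < a) (hA' : ((a : ℂ) • A).IsHermitian) (j : ℕ) :
    esym Finset.univ j (hermEigenvalues ((a : ℂ) • A))
      = a ^ j * esym Finset.univ j (hermEigenvalues A) := by
  have h := esym_hermEigenvalues (κ := Unit) hA' (fun _ => 1)
    (fun _ => a • hermEigenvalues A) 0 (fun x _ => by
      have e : (x : ℂ) • (1 : Matrix (Fin n) (Fin n) ℂ) + (a : ℂ) • A
          = (a : ℂ) • (((x / a : ℝ) : ℂ) • (1 : Matrix (Fin n) (Fin n) ℂ) + A) := by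
        rw [smul_add, smul_smul]
        congr 2
        have : (a : ℂ) ≠ 0 := by exact_mod_cast ha.ne'
        push_cast; field_simp
      rw [e, det_smul, det_smul_one_add hA, Fintype.card_fin]
      simp only [Finset.univ_unique, Finset.sum_const, Finset.card_singleton, one_smul, one_mul,
        Pi.smul_apply, smul_eq_mul]
      rw [← Complex.ofReal_pow, ← Complex.ofReal_mul]
      congr 1
      rw [show a ^ n = ∏ _s : Fin n, a by simp, ← Finset.prod_mul_distrib]
      refine Finset.prod_congr rfl fun s _ => ?_
      field_simp) j
  rw [h]
  simp only [Finset.univ_unique, Finset.sum_const, Finset.card_singleton, one_smul, one_mul]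
  unfold esym
  rw [Finset.mul_sum]
  refine Finset.sum_congr rfl fun S hS => ?_
  simp [Finset.prod_mul_distrib, (Finset.mem_powersetCard.1 hS).2]

/-- The matrix determinant lemma, after factoring out the diagonal. Its right side is matched by
`sum_prod_add_single`, which turns it into an average of products with one factor changed. -/
theorem det_diagonal_sub_vecMulVec (d : Fin n → ℂ) (hd : ∀ i, d i ≠ 0) (p q : Fin n → ℂ) :
    (diagonal d - vecMulVec p q).det = (∏ i, d i) * (1 - ∑ i, q i * p i / d i) := by
  have e : diagonal d - vecMulVec p q
      = diagonal d * (1 + replicateCol Unit (fun i => -(p i / d i)) * replicateRow Unit q) := by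
    rw [← vecMulVec_eq, mul_add, mul_one, sub_eq_add_neg]
    congr 1
    ext i j
    rw [diagonal_mul]
    rw [Matrix.neg_apply, vecMulVec_apply, vecMulVec_apply]
    have := hd i
    field_simp
  rw [e, det_mul, det_diagonal, det_one_add_replicateCol_mul_replicateRow]
  congr 1
  simp only [dotProduct, mul_neg, Finset.sum_neg_distrib, sub_eq_add_neg, mul_div_assoc]

theorem sum_prod_add_single {ι : Type*} [Fintype ι] [DecidableEq ι] (w a : ι → ℝ)
    (hw : ∑ i, w i = 1) (ha : ∀ i, a i ≠ 0) (t : ℝ) :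
    ∑ i, w i * ∏ s, (a s - t * Pi.single (M := fun _ => ℝ) i 1 s)
      = (∏ s, a s) * (1 - ∑ i, t * w i / a i) := by
  have h1 : ∀ i, ∏ s, (a s - t * Pi.single (M := fun _ => ℝ) i 1 s)
      = (∏ s, a s) * (1 - t / a i) := fun i => by
    rw [← Finset.mul_prod_erase _ _ (Finset.mem_univ i),
      ← Finset.mul_prod_erase _ a (Finset.mem_univ i)]
    have : ∏ x ∈ Finset.univ.erase i, (a x - t * Pi.single (M := fun _ => ℝ) i 1 x)
        = ∏ x ∈ Finset.univ.erase i, a x := Finset.prod_congr rfl fun s hs => by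
      rw [Pi.single_eq_of_ne (Finset.ne_of_mem_erase hs)]; simp
    rw [this]
    have := ha i
    simp only [Pi.single_eq_same, mul_one]
    field_simp
  calc ∑ i, w i * ∏ s, (a s - t * Pi.single (M := fun _ => ℝ) i 1 s)
      = ∑ i, (∏ s, a s) * (w i - t * w i / a i) := Finset.sum_congr rfl fun i _ => by
        rw [h1]; ring
    _ = (∏ s, a s) * (1 - ∑ i, t * w i / a i) := by
        rw [← Finset.mul_sum, Finset.sum_sub_distrib, hw]

/-- Adding `t (I - v v*)`, with `v` a unit vector, to a Hermitian matrix averages the elementary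
symmetric functions of the perturbed eigenvalues. -/
theorem exists_weights_add_compl_rank_one {M : Matrix (Fin n) (Fin n) ℂ} (hM : M.IsHermitian)
    (v : Fin n → ℂ) (hv : star v ⬝ᵥ v = 1) (t : ℝ)
    (hN : (M + (t : ℂ) • (1 - vecMulVec v (star v))).IsHermitian) :
    ∃ w : Fin n → ℝ, (∀ i, 0 ≤ w i) ∧ ∑ i, w i = 1 ∧ ∀ j,
      esym Finset.univ j (hermEigenvalues (M + (t : ℂ) • (1 - vecMulVec v (star v))))
        = ∑ i, w i * esym Finset.univ j (hermEigenvalues M + t • (1 - Pi.single i 1)) := by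
  obtain ⟨U, h1, h2, h3⟩ := exists_unitary_diagonalization hM
  set μ := hermEigenvalues M with hμ
  set p : Fin n → ℂ := Uᴴ *ᵥ v with hp
  have hpv : v = U *ᵥ p := by rw [hp, mulVec_mulVec, h1, one_mulVec]
  have hpp : star p ⬝ᵥ p = 1 := by
    rw [← hv]
    rw [hp, star_mulVec, conjTranspose_conjTranspose, dotProduct_mulVec, vecMul_vecMul, h1,
      vecMul_one]
  have hw1 : ∑ i, Complex.normSq (p i) = 1 := by
    have : ((∑ i, Complex.normSq (p i) : ℝ) : ℂ) = 1 := by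
      rw [← hpp]
      simp [dotProduct, Complex.normSq_eq_conj_mul_self]
    exact_mod_cast this
  -- The weights are the squared moduli of the coordinates of `v` in an eigenbasis of `M`. Beyond
  -- the chosen threshold every `x + μ i + t` is positive.
  refine ⟨fun i => Complex.normSq (p i), fun i => Complex.normSq_nonneg _, hw1,
    esym_hermEigenvalues hN _ _ (∑ i, |μ i + t|) fun x hx => ?_⟩
  have hpos : ∀ i, 0 < x + (μ i + t) := fun i => by
    have h4 := Finset.single_le_sum (fun i _ => abs_nonneg (μ i + t)) (Finset.mem_univ i)
    have h5 := neg_abs_le (μ i + t)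
    linarith
  have e : M + (t : ℂ) • (1 - vecMulVec v (star v))
      = U * (diagonal (fun i => ((μ i + t : ℝ) : ℂ)) - vecMulVec ((t : ℂ) • p) (star p)) * Uᴴ := by
    have e1 : vecMulVec v (star v) = U * vecMulVec p (star p) * Uᴴ := by
      rw [mul_vecMulVec, vecMulVec_mul, ← hpv, ← star_mulVec, ← hpv]
    have e2 : diagonal (fun i => ((μ i + t : ℝ) : ℂ))
        = diagonal (fun i => (μ i : ℂ)) + (t : ℂ) • 1 := by
      rw [← diagonal_one, ← diagonal_smul, diagonal_add]
      congr 1; ext i; simp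
    rw [e1, e2, smul_vecMulVec, mul_sub, sub_mul, mul_add, add_mul, ← h3]
    simp only [mul_smul_comm, smul_mul_assoc, mul_one, h1, smul_sub, add_sub_assoc]
  rw [e, det_conj_unitary h1, ← add_sub_assoc]
  have e3 : (x : ℂ) • (1 : Matrix (Fin n) (Fin n) ℂ) + diagonal (fun i => ((μ i + t : ℝ) : ℂ))
      = diagonal (fun i => ((x + (μ i + t) : ℝ) : ℂ)) := by
    rw [← diagonal_one, ← diagonal_smul, diagonal_add]
    congr 1; ext i; simp
  rw [e3, det_diagonal_sub_vecMulVec _ (fun i => by exact_mod_cast (hpos i).ne')]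
  have h6 := sum_prod_add_single (fun i => Complex.normSq (p i)) (fun i => x + (μ i + t)) hw1
    (fun i => (hpos i).ne') t
  have h7 : ∀ i s, x + (μ + t • (1 - Pi.single i 1) : Fin n → ℝ) s
      = x + (μ s + t) - t * Pi.single (M := fun _ => ℝ) i 1 s := fun i s => by
    simp; ring
  simp only [h7]
  rw [h6]
  push_cast
  congr 2
  refine Finset.sum_congr rfl fun i _ => ?_
  simp [Complex.normSq_eq_conj_mul_self]
  ring

theorem isHermitian_compl_rank_one (v : Fin n → ℂ) (t : ℝ) :
    ((t : ℂ) • (1 - vecMulVec v (star v))).IsHermitian := by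
  have h : (vecMulVec v (star v)).IsHermitian := by
    ext i j; simp [vecMulVec_apply, mul_comm]
  have h1 : (1 - vecMulVec v (star v)).IsHermitian := isHermitian_one.sub h
  unfold IsHermitian at *
  rw [conjTranspose_smul, h1]
  simp

theorem compl_single_nonneg {t : ℝ} (ht : 0 ≤ t) (i s : Fin n) :
    0 ≤ (t • (1 - Pi.single i 1) : Fin n → ℝ) s := by
  refine mul_nonneg ht ?_
  by_cases h : s = i
  · subst h; simp
  · simp [h]

theorem inCone_add_compl_rank_one {k : ℕ} {M : Matrix (Fin n) (Fin n) ℂ} (hM : M.IsHermitian)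
    (hc : InCone Finset.univ k (hermEigenvalues M)) {v : Fin n → ℂ} (hv : star v ⬝ᵥ v = 1)
    {t : ℝ} (ht : 0 ≤ t) :
    InCone Finset.univ k (hermEigenvalues (M + (t : ℂ) • (1 - vecMulVec v (star v)))) := by
  obtain ⟨w, hw0, hw1, hw⟩ := exists_weights_add_compl_rank_one hM v hv t
    (hM.add (isHermitian_compl_rank_one v t))
  intro j hj
  rw [hw]
  have hpos : ∀ i, 0 < esym Finset.univ j (hermEigenvalues M + t • (1 - Pi.single i 1)) :=
    fun i => hc.add_nonneg (compl_single_nonneg ht i) j hj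
  obtain ⟨i, -, hi⟩ : ∃ i ∈ Finset.univ, 0 < w i := by
    by_contra! hcon
    have := Finset.sum_nonpos hcon
    linarith
  exact Finset.sum_pos' (fun i _ => mul_nonneg (hw0 i) (hpos i).le)
    ⟨i, Finset.mem_univ _, mul_pos hi (hpos i)⟩

/-- The condition `κ σ_j ≤ σ_{j+1}` is linear in the elementary symmetric functions, and the weights
do not depend on `j`. It therefore survives averaging, and the noncommuting perturbation reduces to
diagonal ones. -/
theorem ratio_add_compl_rank_one {M : Matrix (Fin n) (Fin n) ℂ} (hM : M.IsHermitian)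
    {v : Fin n → ℂ} (hv : star v ⬝ᵥ v = 1)
    {t : ℝ} {j : ℕ} {κ : ℝ}
    (h : ∀ i, κ * esym Finset.univ j (hermEigenvalues M + t • (1 - Pi.single i 1))
      ≤ esym Finset.univ (j + 1) (hermEigenvalues M + t • (1 - Pi.single i 1))) :
    κ * esym Finset.univ j (hermEigenvalues (M + (t : ℂ) • (1 - vecMulVec v (star v))))
      ≤ esym Finset.univ (j + 1)
        (hermEigenvalues (M + (t : ℂ) • (1 - vecMulVec v (star v)))) := by
  obtain ⟨w, hw0, hw1, hw⟩ := exists_weights_add_compl_rank_one hM v hv t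
    (hM.add (isHermitian_compl_rank_one v t))
  rw [hw, hw, Finset.mul_sum]
  refine Finset.sum_le_sum fun i _ => ?_
  have := mul_le_mul_of_nonneg_left (h i) (hw0 i)
  linarith

/-- Adding `tr(D) I - D`, with `D` positive semidefinite, to a Hermitian matrix with eigenvalues in
the cone makes the quotients `σ_{j+1} / σ_j` at least comparable with the norm of `D`. -/
theorem exists_ratio_bound_matrix {k : ℕ} (hk : k + 1 ≤ n) :
    ∃ c : ℝ, 0 < c ∧ ∀ M D : Matrix (Fin n) (Fin n) ℂ, M.IsHermitian →
      InCone Finset.univ k (hermEigenvalues M) → D.PosSemidef → ∀ (x : Fin n → ℂ) (T : ℝ),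
      star x ⬝ᵥ x = 1 → T ≤ (star x ⬝ᵥ (D *ᵥ x)).re →
      InCone Finset.univ k (hermEigenvalues (M + (D.trace • 1 - D))) ∧ ∀ j < k,
        c * T * esym Finset.univ j (hermEigenvalues (M + (D.trace • 1 - D)))
          ≤ esym Finset.univ (j + 1) (hermEigenvalues (M + (D.trace • 1 - D))) := by
  obtain ⟨c, hc, H⟩ := exists_ratio_bound (ι := Fin n) (k := k) (by simpa using hk)
  refine ⟨c, hc, fun M D hM hcone hD x T hx hT => ?_⟩
  obtain ⟨U, h1, h2, h3⟩ := exists_unitary_diagonalization hD.isHermitian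
  set d := hermEigenvalues D with hd
  have hd0 : ∀ i, 0 ≤ d i := fun i => by
    rw [hd, hermEigenvalues_of_isHermitian hD.isHermitian]
    exact hD.eigenvalues_nonneg i
  set e : Fin n → Fin n → ℂ := fun i => U.col i with he
  have hen : ∀ i, star (e i) ⬝ᵥ e i = 1 := fun i => by
    have := congrFun (congrFun h2 i) i
    rw [one_apply_eq, mul_apply] at this
    rw [← this]; rfl
  have hDsum : D = ∑ i, (d i : ℂ) • vecMulVec (e i) (star (e i)) := by
    conv_lhs => rw [h3]
    clear_value d
    ext a b
    simp only [mul_apply, Matrix.sum_apply, Matrix.smul_apply, vecMulVec_apply, diagonal_apply, mul_ite,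
      mul_zero, Finset.sum_ite_eq', Finset.mem_univ, if_true, conjTranspose_apply, smul_eq_mul,
      Pi.star_apply, he, col_apply]
    exact Finset.sum_congr rfl fun i _ => by ring
  have htr : D.trace = ∑ i, (d i : ℂ) := by
    rw [hDsum, trace_sum]
    refine Finset.sum_congr rfl fun i _ => ?_
    rw [trace_smul, trace_vecMulVec, dotProduct_comm, hen, smul_eq_mul, mul_one]
  have hη : D.trace • (1 : Matrix (Fin n) (Fin n) ℂ) - D
      = ∑ i, (d i : ℂ) • (1 - vecMulVec (e i) (star (e i))) := by
    conv_lhs => rw [htr, hDsum]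
    rw [Finset.sum_smul, ← Finset.sum_sub_distrib]
    simp only [smul_sub]
  -- The quadratic form at a unit vector is an average of the eigenvalues, so one eigenvalue is at
  -- least `T`.
  have hex : ∃ i, T ≤ d i := by
    by_contra! hlt
    set y := Uᴴ *ᵥ x with hy
    have hyy : star y ⬝ᵥ y = 1 := by
      rw [hy, star_mulVec, conjTranspose_conjTranspose, dotProduct_mulVec, vecMul_vecMul, h1,
        vecMul_one, hx]
    have hw1 : ∑ i, Complex.normSq (y i) = 1 := by
      have : ((∑ i, Complex.normSq (y i) : ℝ) : ℂ) = 1 := by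
        rw [← hyy]
        simp [dotProduct, Complex.normSq_eq_conj_mul_self]
      exact_mod_cast this
    have hq : (star x ⬝ᵥ (D *ᵥ x)) = ((∑ i, d i * Complex.normSq (y i) : ℝ) : ℂ) := by
      conv_lhs => rw [h3]
      rw [← mulVec_mulVec, ← mulVec_mulVec, ← hy, dotProduct_mulVec,
        show star x ᵥ* U = star y by rw [hy, star_mulVec, conjTranspose_conjTranspose]]
      simp only [dotProduct, mulVec_diagonal, Pi.star_apply]
      push_cast
      refine Finset.sum_congr rfl fun i _ => ?_
      rw [Complex.normSq_eq_conj_mul_self]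
      simp; ring
    rw [hq, Complex.ofReal_re] at hT
    have h4 : ∑ i, d i * Complex.normSq (y i) < ∑ i, T * Complex.normSq (y i) := by
      obtain ⟨i, -, hi⟩ : ∃ i ∈ Finset.univ, 0 < Complex.normSq (y i) := by
        by_contra! hcon
        have := Finset.sum_nonpos hcon
        linarith
      exact Finset.sum_lt_sum
        (fun i _ => mul_le_mul_of_nonneg_right (hlt i).le (Complex.normSq_nonneg _))
        ⟨i, Finset.mem_univ _, mul_lt_mul_of_pos_right (hlt i) hi⟩
    rw [← Finset.mul_sum, hw1, mul_one] at h4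
    linarith
  -- The projections are added one at a time. Each new one creates growth proportional to its own
  -- eigenvalue, and monotonicity of the quotients preserves the growth already gained.
  have key : ∀ s : Finset (Fin n),
      (M + ∑ i ∈ s, (d i : ℂ) • (1 - vecMulVec (e i) (star (e i)))).IsHermitian ∧
      InCone Finset.univ k (hermEigenvalues
        (M + ∑ i ∈ s, (d i : ℂ) • (1 - vecMulVec (e i) (star (e i))))) ∧
      ∀ i ∈ s, ∀ j < k,
        c * d i * esym Finset.univ j (hermEigenvalues
          (M + ∑ i ∈ s, (d i : ℂ) • (1 - vecMulVec (e i) (star (e i)))))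
        ≤ esym Finset.univ (j + 1) (hermEigenvalues
          (M + ∑ i ∈ s, (d i : ℂ) • (1 - vecMulVec (e i) (star (e i))))) := by
    intro s
    induction s using Finset.induction_on with
    | empty => simpa using ⟨hM, hcone⟩
    | insert a s ha ih =>
      obtain ⟨ih1, ih2, ih3⟩ := ih
      rw [Finset.sum_insert ha, add_comm ((d a : ℂ) • _), ← add_assoc]
      refine ⟨ih1.add (isHermitian_compl_rank_one _ _),
        inCone_add_compl_rank_one ih1 ih2 (hen a) (hd0 a), fun i hi j hj => ?_⟩
      refine ratio_add_compl_rank_one ih1 (hen a) fun b => ?_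
      rcases Finset.mem_insert.1 hi with rfl | hi
      · exact H _ ih2 b _ (hd0 i) j hj
      · exact ratio_add_nonneg ih2 (compl_single_nonneg (hd0 a) b) hj (ih3 i hi j hj)
  obtain ⟨i, hi⟩ := hex
  obtain ⟨k1, k2, k3⟩ := key Finset.univ
  rw [hη]
  refine ⟨k2, fun j hj => le_trans ?_ (k3 i (Finset.mem_univ i) j hj)⟩
  exact mul_le_mul_of_nonneg_right (mul_le_mul_of_nonneg_left hi hc.le) (k2 j hj.le).le

/-- The matrix `tr(A) I - A`. -/
def etaOf (A : Matrix (Fin n) (Fin n) ℂ) : Matrix (Fin n) (Fin n) ℂ :=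
  A.trace • 1 - A

theorem isHermitian_etaOf {A : Matrix (Fin n) (Fin n) ℂ} (hA : A.IsHermitian) :
    (etaOf A).IsHermitian := by
  have h : star A.trace = A.trace := by
    rw [← trace_conjTranspose, hA]
  unfold etaOf IsHermitian
  rw [conjTranspose_sub, conjTranspose_smul, h, conjTranspose_one, hA]

/-- Comparison of `tr(A) I - A` and `tr(B) I - B` when `b B - a A + s I` is positive semidefinite
and large. -/
theorem exists_ratio_bound_etaOf {k : ℕ} (hk : k + 1 ≤ n) :
    ∃ c : ℝ, 0 < c ∧ ∀ A B : Matrix (Fin n) (Fin n) ℂ, A.IsHermitian → B.IsHermitian →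
      InCone Finset.univ k (hermEigenvalues (etaOf A)) →
      InCone Finset.univ k (hermEigenvalues (etaOf B)) →
      ∀ a b s T : ℝ, 0 < a → 0 < b → 0 ≤ s → ((b : ℂ) • B - (a : ℂ) • A + (s : ℂ) • 1).PosSemidef →
      ∀ x : Fin n → ℂ, star x ⬝ᵥ x = 1 →
      T ≤ (star x ⬝ᵥ (((b : ℂ) • B - (a : ℂ) • A + (s : ℂ) • 1) *ᵥ x)).re → ∀ j < k,
      (c * T - n ^ 2 * s) * esym Finset.univ j (hermEigenvalues (etaOf B))
        ≤ b * esym Finset.univ (j + 1) (hermEigenvalues (etaOf B)) := by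
  obtain ⟨c, hc, H⟩ := exists_ratio_bound_matrix hk
  refine ⟨c, hc, fun A B hA hB hcA hcB a b s T ha hb hs hD x hx hT j hj => ?_⟩
  have hsm : ∀ {r : ℝ} {C : Matrix (Fin n) (Fin n) ℂ}, C.IsHermitian → ((r : ℂ) • C).IsHermitian :=
    fun {r C} hC => by
      unfold IsHermitian at *
      rw [conjTranspose_smul, hC]; simp
  have hcone : ∀ {r : ℝ} {C : Matrix (Fin n) (Fin n) ℂ}, C.IsHermitian → 0 < r →
      InCone Finset.univ k (hermEigenvalues (etaOf C)) →
      InCone Finset.univ k (hermEigenvalues ((r : ℂ) • etaOf C)) := fun {r C} hC hr h j hj => by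
    rw [esym_hermEigenvalues_smul (isHermitian_etaOf hC) hr (hsm (isHermitian_etaOf hC))]
    exact mul_pos (pow_pos hr _) (h j hj)
  obtain ⟨-, H2⟩ := H ((a : ℂ) • etaOf A) _ (hsm (isHermitian_etaOf hA)) (hcone hA ha hcA) hD x T
    hx hT
  have H2 := H2 j hj
  have hn1 : (1 : ℝ) ≤ n := by exact_mod_cast (by omega : 1 ≤ n)
  -- The map `A ↦ tr(A) I - A` sends `s I` to `(n - 1) s I`.
  set s' : ℝ := (n - 1) * s with hs'
  have hs'0 : 0 ≤ s' := mul_nonneg (by linarith) hs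
  have e : (a : ℂ) • etaOf A + (((b : ℂ) • B - (a : ℂ) • A + (s : ℂ) • 1).trace • 1
      - ((b : ℂ) • B - (a : ℂ) • A + (s : ℂ) • 1)) = (b : ℂ) • etaOf B + (s' : ℂ) • 1 := by
    simp only [etaOf, trace_add, trace_sub, trace_smul, trace_one, Fintype.card_fin, hs']
    push_cast
    simp only [smul_eq_mul]
    module
  have hBH := hsm (r := b) (isHermitian_etaOf hB)
  rw [e, esym_hermEigenvalues_add_smul_one hBH s' (hBH.add (hsm isHermitian_one)),
    esym_hermEigenvalues_add_smul_one hBH s' (hBH.add (hsm isHermitian_one))] at H2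
  have hcB' := hcone hB hb hcB
  set v := hermEigenvalues ((b : ℂ) • etaOf B) with hv
  have hEj := hcB' j hj.le
  have hEj1 := hcB' (j + 1) hj
  -- Take for `κ` the quotient itself: removing the shift `s' I` costs it at most `n s'`, and `n s'
  -- ≤ n² s`.
  have hκ : 0 ≤ esym Finset.univ (j + 1) v / esym Finset.univ j v := by positivity
  have h3 := ratio_add_const hcB' hs'0 hj hκ (by field_simp; exact le_rfl)
  have hEs : 0 < esym Finset.univ j (v + s' • 1) :=
    hcB'.add_nonneg (fun _ => by simpa using hs'0) j hj.le
  have h4 := le_of_mul_le_mul_right (H2.trans h3) hEs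
  rw [Fintype.card_fin] at h4
  have h5 : (c * T - n ^ 2 * s) * esym Finset.univ j v ≤ esym Finset.univ (j + 1) v := by
    rw [← le_div_iff₀ hEj]
    have : (n : ℝ) * s' ≤ n ^ 2 * s := by
      rw [hs']; nlinarith [mul_nonneg (by linarith : (0 : ℝ) ≤ n) hs]
    linarith
  rw [hv, esym_hermEigenvalues_smul (isHermitian_etaOf hB) hb hBH,
    esym_hermEigenvalues_smul (isHermitian_etaOf hB) hb hBH, pow_succ b j] at h5
  have hbj : 0 < b ^ j := pow_pos hb j
  refine le_of_mul_le_mul_left ?_ hbj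
  linarith

end matrix

end NeumannHessian

end

noncomputable section

namespace NeumannHessian

open Matrix
open scoped ComplexOrder

/-! ### The complex Hessian and the real second derivative -/

section levi

variable {n : ℕ}

/-- The complex Hessian associated with a real bilinear form. -/
def levi (H : Cn n →L[ℝ] Cn n →L[ℝ] ℝ) : Matrix (Fin n) (Fin n) ℂ :=
  Matrix.of fun i j => (1 / 4 : ℂ) *
    (((H (EuclideanSpace.single i (1 : ℂ)) (EuclideanSpace.single j (1 : ℂ)) : ℂ)
        + H (EuclideanSpace.single i Complex.I) (EuclideanSpace.single j Complex.I))
      + Complex.I * (H (EuclideanSpace.single i (1 : ℂ)) (EuclideanSpace.single j Complex.I)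
        - H (EuclideanSpace.single i Complex.I) (EuclideanSpace.single j (1 : ℂ))))

theorem complexHessian_eq_levi {u : Cn n → ℝ} {z : Cn n} (hu : ContDiffAt ℝ 2 u z) :
    complexHessian u z = levi (fderiv ℝ (fderiv ℝ u) z) := by
  have h1 : ∀ᶠ w in nhds z, DifferentiableAt ℝ u w :=
    (hu.eventually (by simp)).mono fun w hw => hw.differentiableAt (by simp)
  have h2 : DifferentiableAt ℝ (fderiv ℝ u) z :=
    (hu.fderiv_right (m := 1) (by norm_num)).differentiableAt (by simp)
  set H := fderiv ℝ (fderiv ℝ u) z with hH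
  have h3 : ∀ j, dzbar j (fun w => (u w : ℂ)) =ᶠ[nhds z] fun w => (1 / 2 : ℂ) *
      ((fderiv ℝ u w (EuclideanSpace.single j (1 : ℂ)) : ℂ)
        + Complex.I * (fderiv ℝ u w (EuclideanSpace.single j Complex.I) : ℂ)) := by
    intro j
    filter_upwards [h1] with w hw
    have : HasFDerivAt (fun w => (u w : ℂ)) (Complex.ofRealCLM.comp (fderiv ℝ u w)) w :=
      Complex.ofRealCLM.hasFDerivAt.comp w hw.hasFDerivAt
    rw [dzbar, this.fderiv]
    simp
  have h4 : ∀ (p q : Cn n), HasFDerivAt (fun w => (fderiv ℝ u w q : ℂ))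
      (Complex.ofRealCLM.comp (H.flip q)) z := fun p q => by
    have e : HasFDerivAt (fun w => fderiv ℝ u w q) (H.flip q) z := by
      have := h2.hasFDerivAt.clm_apply (hasFDerivAt_const q z)
      simpa using this
    exact Complex.ofRealCLM.hasFDerivAt.comp z e
  ext i j
  simp only [complexHessian, levi, of_apply]
  have h5 := ((h4 0 (EuclideanSpace.single j (1 : ℂ))).add
    ((h4 0 (EuclideanSpace.single j Complex.I)).const_mul Complex.I)).const_mul (1 / 2 : ℂ)
  have h6 : fderiv ℝ (fun w => (1 / 2 : ℂ) *
      ((fderiv ℝ u w (EuclideanSpace.single j (1 : ℂ)) : ℂ)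
        + Complex.I * (fderiv ℝ u w (EuclideanSpace.single j Complex.I) : ℂ))) z = _ := h5.fderiv
  rw [dz, (h3 j).fderiv_eq, h6]
  simp
  linear_combination (1 / 4 : ℂ) *
    (-(H (EuclideanSpace.single i Complex.I) (EuclideanSpace.single j Complex.I) : ℂ)) *
      Complex.I_mul_I

theorem isHermitian_levi {H : Cn n →L[ℝ] Cn n →L[ℝ] ℝ} (hH : ∀ p q, H p q = H q p) :
    (levi H).IsHermitian := by
  ext i j
  simp only [levi, conjTranspose_apply, of_apply]
  rw [hH (EuclideanSpace.single j (1 : ℂ)) (EuclideanSpace.single i (1 : ℂ)),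
    hH (EuclideanSpace.single j Complex.I) (EuclideanSpace.single i Complex.I),
    hH (EuclideanSpace.single j Complex.I) (EuclideanSpace.single i (1 : ℂ)),
    hH (EuclideanSpace.single j (1 : ℂ)) (EuclideanSpace.single i Complex.I)]
  simp
  ring

theorem sum_single_re_im (p : Cn n) :
    p = ∑ i, ((p i).re • EuclideanSpace.single i (1 : ℂ)
      + (p i).im • EuclideanSpace.single i Complex.I) := by
  ext j
  rw [WithLp.ofLp_sum, Finset.sum_apply, Finset.sum_eq_single j]
  · simp
  · intro i _ hij
    simp [hij.symm]
  · simp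

/-- The conjugate vector appears because the row index of `u_{i j̄}` is the holomorphic one. Real
second-order information in the directions `ξ` and `iξ` thus controls the complex Hessian. -/
theorem levi_quadratic (H : Cn n →L[ℝ] Cn n →L[ℝ] ℝ) (x : Fin n → ℂ) :
    (star x ⬝ᵥ (levi H *ᵥ x)).re
      = (1 / 4) * (H (WithLp.toLp 2 (star x)) (WithLp.toLp 2 (star x))
        + H (Complex.I • WithLp.toLp 2 (star x)) (Complex.I • WithLp.toLp 2 (star x))) := by
  have hb : ∀ p : Cn n, H p p = ∑ i, ∑ j,
      ((p i).re * (p j).re * H (EuclideanSpace.single i (1 : ℂ)) (EuclideanSpace.single j (1 : ℂ))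
      + (p i).re * (p j).im * H (EuclideanSpace.single i (1 : ℂ)) (EuclideanSpace.single j Complex.I)
      + (p i).im * (p j).re * H (EuclideanSpace.single i Complex.I) (EuclideanSpace.single j (1 : ℂ))
      + (p i).im * (p j).im
        * H (EuclideanSpace.single i Complex.I) (EuclideanSpace.single j Complex.I)) := by
    intro p
    conv_lhs => rw [sum_single_re_im p]
    simp only [map_sum, map_add, map_smul, _root_.sum_apply,
      _root_.add_apply, _root_.smul_apply, smul_eq_mul]
    simp only [Finset.mul_sum, ← Finset.sum_add_distrib]
    rw [Finset.sum_comm]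
    refine Finset.sum_congr rfl fun i _ => Finset.sum_congr rfl fun j _ => ?_
    ring
  rw [hb, hb, ← Finset.sum_add_distrib, Finset.mul_sum]
  simp only [dotProduct, mulVec, Complex.re_sum, Finset.mul_sum]
  refine Finset.sum_congr rfl fun i _ => ?_
  rw [← Finset.sum_add_distrib, Finset.mul_sum]
  refine Finset.sum_congr rfl fun j _ => ?_
  simp [levi]
  ring

theorem eta_eq {u : Cn n → ℝ} {z : Cn n} (hu : ContDiffAt ℝ 2 u z) :
    eta u z = hermEigenvalues (etaOf (levi (fderiv ℝ (fderiv ℝ u) z))) := by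
  rw [eta, etaMatrix, complexHessian_eq_levi hu, etaOf]

theorem fderiv_fderiv_symm {u : Cn n → ℝ} {z : Cn n} (hu : ContDiffAt ℝ 2 u z) (p q : Cn n) :
    fderiv ℝ (fderiv ℝ u) z p q = fderiv ℝ (fderiv ℝ u) z q p :=
  hu.isSymmSndFDerivAt (by simp) p q

theorem inCone_of_mem_gardingCone {k : ℕ} {v : Fin n → ℝ} (h : v ∈ gardingCone n k) :
    InCone Finset.univ k v := by
  intro j hj
  rcases j with _ | j
  · rw [esym_zero]; exact one_pos
  · exact h (j + 1) (by omega) hj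

/-- Two admissible functions: a semidefinite comparison of the real second derivatives with a
large gap in one direction forces the quotients `σ_{j+1} / σ_j` to be large at the second point. -/
theorem exists_ratio_bound_eta {k : ℕ} (hk : k + 1 ≤ n) :
    ∃ c : ℝ, 0 < c ∧ ∀ (u : Cn n → ℝ) (x y : Cn n), ContDiffAt ℝ 2 u x → ContDiffAt ℝ 2 u y →
      eta u x ∈ gardingCone n k → eta u y ∈ gardingCone n k →
      ∀ a b s T : ℝ, 0 < a → 0 < b → 0 ≤ s →
      (∀ ξ : Cn n, 0 ≤ b * fderiv ℝ (fderiv ℝ u) y ξ ξ - a * fderiv ℝ (fderiv ℝ u) x ξ ξ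
        + 2 * s * ‖ξ‖ ^ 2) →
      ∀ e : Cn n, ‖e‖ = 1 →
      4 * T ≤ b * fderiv ℝ (fderiv ℝ u) y e e - a * fderiv ℝ (fderiv ℝ u) x e e + 2 * s →
      ∀ j < k, (c * T - n ^ 2 * s) * sigma j (eta u y) ≤ b * sigma (j + 1) (eta u y) := by
  obtain ⟨c, hc, H⟩ := exists_ratio_bound_etaOf hk
  refine ⟨c, hc, fun u x y hux huy hx hy a b s T ha hb hs hξ e he hT j hj => ?_⟩
  have hA := isHermitian_levi (fderiv_fderiv_symm hux)
  have hB := isHermitian_levi (fderiv_fderiv_symm huy)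
  rw [eta_eq hux] at hx
  rw [eta_eq huy] at hy ⊢
  set A := levi (fderiv ℝ (fderiv ℝ u) x) with hAdef
  set B := levi (fderiv ℝ (fderiv ℝ u) y) with hBdef
  -- The term `2 s ‖ξ‖²` occurs for both `ξ` and `iξ`; with the factor `1/4` it gives exactly `s
  -- ‖ξ‖²`.
  have hq : ∀ v : Fin n → ℂ,
      (star v ⬝ᵥ (((b : ℂ) • B - (a : ℂ) • A + (s : ℂ) • 1) *ᵥ v)).re = (1 / 4) *
        ((b * fderiv ℝ (fderiv ℝ u) y (WithLp.toLp 2 (star v)) (WithLp.toLp 2 (star v))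
          - a * fderiv ℝ (fderiv ℝ u) x (WithLp.toLp 2 (star v)) (WithLp.toLp 2 (star v))
          + 2 * s * ‖(WithLp.toLp 2 (star v) : Cn n)‖ ^ 2)
        + (b * fderiv ℝ (fderiv ℝ u) y (Complex.I • WithLp.toLp 2 (star v))
            (Complex.I • WithLp.toLp 2 (star v))
          - a * fderiv ℝ (fderiv ℝ u) x (Complex.I • WithLp.toLp 2 (star v))
            (Complex.I • WithLp.toLp 2 (star v))
          + 2 * s * ‖(Complex.I • WithLp.toLp 2 (star v) : Cn n)‖ ^ 2)) := by
    intro v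
    have h1 : (star v ⬝ᵥ v).re = ‖(WithLp.toLp 2 (star v) : Cn n)‖ ^ 2 := by
      rw [EuclideanSpace.norm_sq_eq]
      simp [dotProduct, ← Complex.normSq_eq_norm_sq, Complex.normSq_apply]
    rw [add_mulVec, sub_mulVec, smul_mulVec, smul_mulVec, smul_mulVec, one_mulVec, dotProduct_add,
      dotProduct_sub, dotProduct_smul, dotProduct_smul, dotProduct_smul, norm_smul, Complex.norm_I,
      one_mul, ← h1]
    simp only [smul_eq_mul, Complex.add_re, Complex.sub_re, Complex.re_ofReal_mul]
    rw [hAdef, hBdef, levi_quadratic, levi_quadratic]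
    ring
  have hsm : ∀ {r : ℝ} {C : Matrix (Fin n) (Fin n) ℂ}, C.IsHermitian → ((r : ℂ) • C).IsHermitian :=
    fun {r C} hC => by
      unfold IsHermitian at *
      rw [conjTranspose_smul, hC]; simp
  have hDH : ((b : ℂ) • B - (a : ℂ) • A + (s : ℂ) • 1).IsHermitian :=
    ((hsm hB).sub (hsm hA)).add (hsm isHermitian_one)
  have hD : ((b : ℂ) • B - (a : ℂ) • A + (s : ℂ) • 1).PosSemidef := by
    refine PosSemidef.of_dotProduct_mulVec_nonneg hDH fun v => ?_
    rw [Complex.le_def]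
    refine ⟨?_, (hDH.im_star_dotProduct_mulVec_self v).symm⟩
    rw [hq]
    have := hξ (WithLp.toLp 2 (star v))
    have := hξ (Complex.I • WithLp.toLp 2 (star v))
    simp only [Complex.zero_re]
    linarith
  have hee : (WithLp.toLp 2 (star (star e.ofLp)) : Cn n) = e := by simp
  have h1 : star (star e.ofLp) ⬝ᵥ (star e.ofLp) = 1 := by
    have h2 : ∑ i, ‖e i‖ ^ 2 = 1 := by rw [← EuclideanSpace.norm_sq_eq, he]; simp
    have h3 : ((∑ i, ‖e i‖ ^ 2 : ℝ) : ℂ) = 1 := by rw [h2]; simp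
    rw [← h3]
    simp [dotProduct, Complex.mul_conj, Complex.normSq_eq_norm_sq]
  refine H A B hA hB (inCone_of_mem_gardingCone hx) (inCone_of_mem_gardingCone hy) a b s T ha hb hs
    hD (star e.ofLp) h1 ?_ j hj
  -- The gap `4 T` is assumed in the direction `e` only. The direction `i e` contributes a
  -- nonnegative amount, and the factor `1/4` leaves `T`.
  rw [hq, hee, he]
  have := hξ (Complex.I • e)
  linarith

end levi

end NeumannHessian

end

noncomputable section

namespace NeumannHessian

open Filter Topology

/-! ### Second order expansions in one variable -/

/-- `g` is differentiable near `0` and twice differentiable at `0`, with first and second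
derivatives `d₁` and `d₂` there. -/
def Jet2 (g : ℝ → ℝ) (d₁ d₂ : ℝ) : Prop :=
  ∃ g' : ℝ → ℝ, (∀ᶠ t in 𝓝 0, HasDerivAt g (g' t) t) ∧ g' 0 = d₁ ∧ HasDerivAt g' d₂ 0

theorem Jet2.hasDerivAt {g : ℝ → ℝ} {d₁ d₂ : ℝ} (h : Jet2 g d₁ d₂) : HasDerivAt g d₁ 0 := by
  obtain ⟨g', h1, rfl, -⟩ := h
  exact h1.self_of_nhds

theorem Jet2.linear (b c : ℝ) : Jet2 (fun t => b + c * t) c 0 :=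
  ⟨fun _ => c, Eventually.of_forall fun t => by
    simpa using ((hasDerivAt_id t).const_mul c).const_add b, rfl, hasDerivAt_const _ _⟩

theorem Jet2.const (b : ℝ) : Jet2 (fun _ => b) 0 0 :=
  ⟨fun _ => 0, Eventually.of_forall fun _ => hasDerivAt_const _ _, rfl, hasDerivAt_const _ _⟩

theorem Jet2.add {f g : ℝ → ℝ} {a₁ a₂ b₁ b₂ : ℝ} (hf : Jet2 f a₁ a₂) (hg : Jet2 g b₁ b₂) :
    Jet2 (fun t => f t + g t) (a₁ + b₁) (a₂ + b₂) := by
  obtain ⟨f', f1, rfl, f3⟩ := hf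
  obtain ⟨g', g1, rfl, g3⟩ := hg
  refine ⟨fun t => f' t + g' t, ?_, rfl, f3.add g3⟩
  filter_upwards [f1, g1] with t h1 h2 using h1.add h2

theorem Jet2.mul {f g : ℝ → ℝ} {a₁ a₂ b₁ b₂ : ℝ} (hf : Jet2 f a₁ a₂) (hg : Jet2 g b₁ b₂) :
    Jet2 (fun t => f t * g t) (a₁ * g 0 + f 0 * b₁) (a₂ * g 0 + 2 * a₁ * b₁ + f 0 * b₂) := by
  have hf0 := hf.hasDerivAt
  have hg0 := hg.hasDerivAt
  obtain ⟨f', f1, rfl, f3⟩ := hf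
  obtain ⟨g', g1, rfl, g3⟩ := hg
  refine ⟨fun t => f' t * g t + f t * g' t, ?_, rfl, ?_⟩
  · filter_upwards [f1, g1] with t h1 h2 using h1.mul h2
  · convert! (f3.mul hg0).add (hf0.mul g3) using 1
    ring

theorem Jet2.const_mul {f : ℝ → ℝ} {a₁ a₂ : ℝ} (c : ℝ) (hf : Jet2 f a₁ a₂) :
    Jet2 (fun t => c * f t) (c * a₁) (c * a₂) := by
  simpa using (Jet2.const c).mul hf

theorem Jet2.sub {f g : ℝ → ℝ} {a₁ a₂ b₁ b₂ : ℝ} (hf : Jet2 f a₁ a₂) (hg : Jet2 g b₁ b₂) :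
    Jet2 (fun t => f t - g t) (a₁ - b₁) (a₂ - b₂) := by
  simpa [sub_eq_add_neg] using hf.add (hg.const_mul (-1))

theorem Jet2.exp {f : ℝ → ℝ} {a₁ a₂ : ℝ} (hf : Jet2 f a₁ a₂) :
    Jet2 (fun t => Real.exp (f t)) (Real.exp (f 0) * a₁)
      (Real.exp (f 0) * (a₁ ^ 2 + a₂)) := by
  have hf0 := hf.hasDerivAt
  obtain ⟨f', f1, rfl, f3⟩ := hf
  refine ⟨fun t => Real.exp (f t) * f' t, ?_, rfl, ?_⟩
  · filter_upwards [f1] with t h1 using h1.exp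
  · convert! hf0.exp.mul f3 using 1
    ring

theorem Jet2.unique {g : ℝ → ℝ} {a₁ a₂ b₁ b₂ : ℝ} (ha : Jet2 g a₁ a₂) (hb : Jet2 g b₁ b₂) :
    a₁ = b₁ ∧ a₂ = b₂ := by
  refine ⟨ha.hasDerivAt.unique hb.hasDerivAt, ?_⟩
  obtain ⟨f', f1, rfl, f3⟩ := ha
  obtain ⟨g', g1, rfl, g3⟩ := hb
  have : f' =ᶠ[𝓝 0] g' := by
    filter_upwards [f1, g1] with t h1 h2 using h1.unique h2
  exact (f3.congr_of_eventuallyEq this.symm).unique g3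

/-- The second derivative test, necessary condition. -/
theorem Jet2.nonpos_of_isLocalMax {g : ℝ → ℝ} {d₁ d₂ : ℝ} (h : Jet2 g d₁ d₂)
    (hmax : IsLocalMax g 0) : d₂ ≤ 0 := by
  by_contra hpos
  rw [not_le] at hpos
  have hd1 := hmax.hasDerivAt_eq_zero h.hasDerivAt
  have hcont := h.hasDerivAt.continuousAt
  have h' := h
  obtain ⟨g', h1, h2, h3⟩ := h'
  have hder : deriv g =ᶠ[𝓝 0] g' := h1.mono fun t ht => ht.deriv
  -- A positive second derivative would make `0` a local minimum as well, so `g` would be locally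
  -- constant and its second derivative zero.
  have hmin : IsLocalMin g 0 := by
    refine isLocalMin_of_deriv_deriv_pos ?_ ?_ hcont
    · rw [hder.deriv_eq, h3.deriv]; exact hpos
    · rw [hder.self_of_nhds, h2, hd1]
  have hconst : g =ᶠ[𝓝 0] fun _ => g 0 := by
    filter_upwards [hmax, hmin] with t ht1 ht2 using le_antisymm ht1 ht2
  have hj : Jet2 g 0 0 := by
    refine ⟨fun _ => 0, ?_, rfl, hasDerivAt_const _ _⟩
    filter_upwards [hconst.eventually_nhds] with t ht
    exact (hasDerivAt_const t (g 0)).congr_of_eventuallyEq ht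
  have := (h.unique hj).2
  linarith

theorem nonpos_of_hasDerivWithinAt_right {F : ℝ → ℝ} {d : ℝ}
    (h : HasDerivWithinAt F d (Set.Ici 0) 0) (hle : ∀ᶠ t in 𝓝[>] (0 : ℝ), F t ≤ F 0) : d ≤ 0 := by
  have h1 := hasDerivWithinAt_iff_tendsto_slope.1 h
  rw [Set.Ici_sdiff_left] at h1
  refine le_of_tendsto h1 ?_
  filter_upwards [hle, self_mem_nhdsWithin] with t ht ht0
  rw [slope_def_field]
  have ht0 : (0 : ℝ) < t := ht0
  exact div_nonpos_of_nonpos_of_nonneg (by linarith) (by linarith)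

section space

variable {E : Type*} [NormedAddCommGroup E] [NormedSpace ℝ E]

/-- Reduces second-order calculus in `E` to one variable: product and exponential rules for second
derivatives follow from `Jet2.unique`. -/
theorem Jet2.of_contDiffAt {f : E → ℝ} {x : E} (hf : ContDiffAt ℝ 2 f x) (p : E) :
    Jet2 (fun t => f (x + t • p)) (fderiv ℝ f x p) (fderiv ℝ (fderiv ℝ f) x p p) := by
  have hl : ∀ t : ℝ, HasDerivAt (fun t : ℝ => x + t • p) p t := fun t => by
    simpa using ((hasDerivAt_id t).smul_const p).const_add x
  have hcont : Tendsto (fun t : ℝ => x + t • p) (𝓝 0) (𝓝 x) := by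
    have := (hl 0).continuousAt.tendsto
    simpa using this
  have h1 : ∀ᶠ z in 𝓝 x, DifferentiableAt ℝ f z :=
    (hf.eventually (by simp)).mono fun w hw => hw.differentiableAt (by simp)
  have h2 : DifferentiableAt ℝ (fderiv ℝ f) x :=
    (hf.fderiv_right (m := 1) (by norm_num)).differentiableAt (by simp)
  refine ⟨fun t => fderiv ℝ f (x + t • p) p, ?_, by simp, ?_⟩
  · filter_upwards [hcont.eventually h1] with t ht
    exact ht.hasFDerivAt.comp_hasDerivAt t (hl t)
  · have h3 : HasFDerivAt (fderiv ℝ f) (fderiv ℝ (fderiv ℝ f) x) (x + (0 : ℝ) • p) := by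
      simpa using h2.hasFDerivAt
    have h4 := h3.comp_hasDerivAt (0 : ℝ) (hl 0)
    have h5 := h4.clm_apply (hasDerivAt_const (0 : ℝ) p)
    simpa using h5

/-- `f` is `C²` at `x`, with value, first and second derivatives bounded by `G`. -/
structure Bounded2 (f : E → ℝ) (x : E) (G : ℝ) : Prop where
  contDiffAt : ContDiffAt ℝ 2 f x
  abs_le : |f x| ≤ G
  abs_fderiv_le : ∀ p, |fderiv ℝ f x p| ≤ G * ‖p‖
  abs_fderiv_fderiv_le : ∀ p, |fderiv ℝ (fderiv ℝ f) x p p| ≤ G * ‖p‖ ^ 2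

theorem Bounded2.nonneg {f : E → ℝ} {x : E} {G : ℝ} (h : Bounded2 f x G) : 0 ≤ G :=
  (abs_nonneg _).trans h.abs_le

theorem Bounded2.mono {f : E → ℝ} {x : E} {G G' : ℝ} (h : Bounded2 f x G) (hG : G ≤ G') :
    Bounded2 f x G' :=
  ⟨h.contDiffAt, h.abs_le.trans hG,
    fun p => (h.abs_fderiv_le p).trans (mul_le_mul_of_nonneg_right hG (norm_nonneg _)),
    fun p => (h.abs_fderiv_fderiv_le p).trans (mul_le_mul_of_nonneg_right hG (by positivity))⟩

theorem abs_mul_le {a b A B : ℝ} (ha : |a| ≤ A) (hb : |b| ≤ B) : |a * b| ≤ A * B := by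
  rw [abs_mul]
  exact mul_le_mul ha hb (abs_nonneg _) ((abs_nonneg _).trans ha)

theorem Bounded2.mul {f g : E → ℝ} {x : E} {F G : ℝ} (hf : Bounded2 f x F)
    (hg : Bounded2 g x G) : Bounded2 (fun z => f z * g z) x (4 * F * G) := by
  have hc := hf.contDiffAt.mul hg.contDiffAt
  have hF := hf.nonneg
  have hG := hg.nonneg
  have key := fun p => (Jet2.of_contDiffAt hc p).unique
    ((Jet2.of_contDiffAt hf.contDiffAt p).mul (Jet2.of_contDiffAt hg.contDiffAt p))
  simp only [zero_smul, add_zero] at key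
  have hFG : 0 ≤ F * G := by positivity
  refine ⟨hc, ?_, fun p => ?_, fun p => ?_⟩
  · have := abs_mul_le hf.abs_le hg.abs_le
    linarith
  · rw [(key p).1]
    have h1 := abs_mul_le (hf.abs_fderiv_le p) hg.abs_le
    have h2 := abs_mul_le hf.abs_le (hg.abs_fderiv_le p)
    have h3 := abs_add_le (fderiv ℝ f x p * g x) (f x * fderiv ℝ g x p)
    have h4 : 0 ≤ F * G * ‖p‖ := by positivity
    linarith
  · rw [(key p).2]
    have h1 := abs_mul_le (hf.abs_fderiv_fderiv_le p) hg.abs_le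
    have h2 := abs_mul_le hf.abs_le (hg.abs_fderiv_fderiv_le p)
    have h3 := abs_mul_le (hf.abs_fderiv_le p) (hg.abs_fderiv_le p)
    rw [_root_.abs_le] at h1 h2 h3 ⊢
    constructor <;> nlinarith

theorem bounded2_exp {w : E → ℝ} {x : E} {W γ : ℝ} (hw : Bounded2 w x W) (hγ : 0 ≤ γ)
    (hw0 : 0 ≤ w x) :
    Bounded2 (fun z => Real.exp (-γ * w z)) x (1 + γ * W + (γ * W) ^ 2) := by
  have hc : ContDiffAt ℝ 2 (fun z => Real.exp (-γ * w z)) x :=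
    (contDiffAt_const.mul hw.contDiffAt).exp
  have key := fun p => (Jet2.of_contDiffAt hc p).unique
    ((Jet2.of_contDiffAt hw.contDiffAt p).const_mul (-γ)).exp
  simp only [zero_smul, add_zero] at key
  have hW := hw.nonneg
  have he0 := Real.exp_pos (-γ * w x)
  have he1 : Real.exp (-γ * w x) ≤ 1 := by
    rw [Real.exp_le_one_iff]; nlinarith
  have hγW : 0 ≤ γ * W := by positivity
  refine ⟨hc, ?_, fun p => ?_, fun p => ?_⟩
  · rw [abs_of_pos he0]
    have := sq_nonneg (γ * W)
    linarith
  · rw [(key p).1]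
    have h1 : |-γ * fderiv ℝ w x p| ≤ γ * (W * ‖p‖) :=
      abs_mul_le (by rw [abs_neg, abs_of_nonneg hγ]) (hw.abs_fderiv_le p)
    have h2 := abs_mul_le (by rwa [abs_of_pos he0] : |Real.exp (-γ * w x)| ≤ 1) h1
    have h3 : 0 ≤ (1 + (γ * W) ^ 2) * ‖p‖ := by positivity
    linarith
  · rw [(key p).2]
    have h1 : |-γ * fderiv ℝ w x p| ≤ γ * (W * ‖p‖) :=
      abs_mul_le (by rw [abs_neg, abs_of_nonneg hγ]) (hw.abs_fderiv_le p)
    have h1' : |-γ * fderiv ℝ (fderiv ℝ w) x p p| ≤ γ * (W * ‖p‖ ^ 2) :=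
      abs_mul_le (by rw [abs_neg, abs_of_nonneg hγ]) (hw.abs_fderiv_fderiv_le p)
    have h2 : |(-γ * fderiv ℝ w x p) ^ 2 + -γ * fderiv ℝ (fderiv ℝ w) x p p|
        ≤ (γ * (W * ‖p‖)) ^ 2 + γ * (W * ‖p‖ ^ 2) := by
      refine (abs_add_le _ _).trans (add_le_add ?_ h1')
      rw [abs_pow]
      exact pow_le_pow_left₀ (abs_nonneg _) h1 2
    have h3 := abs_mul_le (by rwa [abs_of_pos he0] : |Real.exp (-γ * w x)| ≤ 1) h2
    have h4 : 0 ≤ ‖p‖ ^ 2 := by positivity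
    nlinarith

/-! ### The doubling of variables -/

/-- The concave modulus `r - B r² / 2`. -/
def modulus (B r : ℝ) : ℝ := r - B / 2 * r ^ 2

theorem hasDerivAt_modulus (B r : ℝ) : HasDerivAt (modulus B) (1 - B * r) r := by
  have := (hasDerivAt_id r).sub (((hasDerivAt_id r).pow 2).const_mul (B / 2))
  convert! this using 1
  simp; ring

theorem modulus_le_modulus {B r s : ℝ} (hB : 0 ≤ B) (hrs : r ≤ s) (hs : B * s ≤ 1) :
    modulus B r ≤ modulus B s := by
  unfold modulus
  have h1 : B * r ≤ B * s := mul_le_mul_of_nonneg_left hrs hB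
  nlinarith [mul_nonneg (sub_nonneg.2 hrs) (by linarith : 0 ≤ 2 - B * r - B * s)]

theorem half_le_modulus {B r : ℝ} (hr : 0 ≤ r) (hs : B * r ≤ 1) : r / 2 ≤ modulus B r := by
  unfold modulus; nlinarith

theorem modulus_le {B r : ℝ} (hB : 0 ≤ B) : modulus B r ≤ r := by
  unfold modulus; nlinarith [mul_nonneg hB (sq_nonneg r)]

/-- The penalisation in the doubling of variables. -/
def penalty (L B : ℝ) (m : E → ℝ) (x y : E) : ℝ := L * modulus B ‖x - y‖ * (m x * m y)

theorem penalty_comm (L B : ℝ) (m : E → ℝ) (x y : E) :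
    penalty L B m x y = penalty L B m y x := by
  unfold penalty; rw [norm_sub_rev, mul_comm (m x)]

/-- First order bound at a one-sided maximum of the doubled function. -/
theorem deriv_le_of_doubling {v m : E → ℝ} {x y p : E} {L B G d m₁ : ℝ} (hL : 0 ≤ L) (hB : 0 ≤ B)
    (hr1 : ‖x - y‖ ≤ 1) (hBr : B * ‖x - y‖ < 1)
    (hv : HasDerivAt (fun t : ℝ => v (x + t • p)) d 0)
    (hm : HasDerivAt (fun t : ℝ => m (x + t • p)) m₁ 0) (hm1 : |m₁| ≤ G * ‖p‖)
    (hmnn : ∀ z, 0 ≤ m z) (hmx : m x ≤ 1) (hmy : m y ≤ 1)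
    (hmax : ∀ᶠ t in 𝓝[>] (0 : ℝ),
      v (x + t • p) - penalty L B m (x + t • p) y ≤ v x - penalty L B m x y) :
    d ≤ L * (1 + G) * ‖p‖ := by
  set r := ‖x - y‖ with hr
  have hr0 : 0 ≤ r := norm_nonneg _
  -- The distance is replaced by its triangle-inequality bound `r + t ‖p‖`. This keeps the one-sided
  -- maximum inequality and avoids differentiating the norm.
  have hlin : HasDerivAt (fun t : ℝ => r + t * ‖p‖) ‖p‖ 0 := by
    simpa using ((hasDerivAt_id (0 : ℝ)).mul_const ‖p‖).const_add r
  have hθ : HasDerivAt (fun t : ℝ => modulus B (r + t * ‖p‖)) ((1 - B * r) * ‖p‖) 0 := by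
    have h := hasDerivAt_modulus B (r + 0 * ‖p‖)
    have h' := h.comp (0 : ℝ) hlin
    simpa [Function.comp_def] using h'
  have hF := hv.sub ((hθ.const_mul L).mul (hm.mul_const (m y)))
  have hnear : ∀ᶠ t in 𝓝[>] (0 : ℝ), B * (r + t * ‖p‖) ≤ 1 := by
    have hc : ContinuousAt (fun t : ℝ => B * (r + t * ‖p‖)) 0 := by fun_prop
    have : ∀ᶠ t in 𝓝 (0 : ℝ), B * (r + t * ‖p‖) < 1 :=
      hc.eventually_lt continuousAt_const (by simpa using hBr)
    exact (this.filter_mono nhdsWithin_le_nhds).mono fun _ h => h.le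
  have hle := nonpos_of_hasDerivWithinAt_right (F := fun t : ℝ => v (x + t • p)
      - L * modulus B (r + t * ‖p‖) * (m (x + t • p) * m y)) hF.hasDerivWithinAt (by
    filter_upwards [hmax, hnear, self_mem_nhdsWithin] with t h1 h2 h3
    have h3 : (0 : ℝ) < t := h3
    have h4 : ‖x + t • p - y‖ ≤ r + t * ‖p‖ := by
      rw [add_sub_right_comm]
      refine (norm_add_le _ _).trans ?_
      rw [norm_smul, Real.norm_of_nonneg h3.le]
    have h5 := modulus_le_modulus hB h4 h2
    have h6 : penalty L B m (x + t • p) y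
        ≤ L * modulus B (r + t * ‖p‖) * (m (x + t • p) * m y) :=
      mul_le_mul_of_nonneg_right (mul_le_mul_of_nonneg_left h5 hL) (mul_nonneg (hmnn _) (hmnn _))
    have h7 : penalty L B m x y = L * modulus B r * (m x * m y) := rfl
    simp only [zero_smul, zero_mul, add_zero]
    linarith)
  simp only [zero_smul, zero_mul, add_zero] at hle
  have hmm : m x * m y ≤ 1 := mul_le_one₀ hmx (hmnn y) hmy
  have hmm0 : 0 ≤ m x * m y := mul_nonneg (hmnn _) (hmnn _)
  have hBr0 : 0 ≤ B * r := by positivity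
  have e1 : (1 - B * r) * ‖p‖ * (m x * m y) ≤ ‖p‖ := by
    have : (1 - B * r) * (m x * m y) ≤ 1 :=
      mul_le_one₀ (by linarith) hmm0 hmm
    nlinarith [norm_nonneg p]
  have hmod0 : 0 ≤ modulus B r := le_trans (by positivity) (half_le_modulus hr0 hBr.le)
  have hmod1 : modulus B r ≤ 1 := (modulus_le hB).trans hr1
  have e2 : modulus B r * (m₁ * m y) ≤ G * ‖p‖ := by
    have h1 : |m₁ * m y| ≤ G * ‖p‖ * 1 := abs_mul_le hm1 (by rwa [abs_of_nonneg (hmnn y)])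
    have h2 : |modulus B r * (m₁ * m y)| ≤ 1 * (G * ‖p‖ * 1) :=
      abs_mul_le (by rwa [abs_of_nonneg hmod0]) h1
    linarith [le_abs_self (modulus B r * (m₁ * m y))]
  nlinarith [mul_le_mul_of_nonneg_left (add_le_add e1 e2) hL]

/-- Second order information at an interior maximum of the doubled function, along lines that
change the distance of the two points linearly. -/
theorem second_order_of_doubling {u a b m : E → ℝ} {x y p q : E} {L B c : ℝ}
    (hux : ContDiffAt ℝ 2 u x) (huy : ContDiffAt ℝ 2 u y)
    (hax : ContDiffAt ℝ 2 a x) (hay : ContDiffAt ℝ 2 a y)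
    (hbx : ContDiffAt ℝ 2 b x) (hby : ContDiffAt ℝ 2 b y)
    (hmx : ContDiffAt ℝ 2 m x) (hmy : ContDiffAt ℝ 2 m y)
    (hdist : ∀ᶠ t in 𝓝 (0 : ℝ), ‖x + t • p - (y + t • q)‖ = ‖x - y‖ + c * t)
    (hmax : ∀ᶠ z : E × E in 𝓝 (x, y),
      (a z.1 * u z.1 + b z.1) - (a z.2 * u z.2 + b z.2) - penalty L B m z.1 z.2
        ≤ (a x * u x + b x) - (a y * u y + b y) - penalty L B m x y) :
    (fderiv ℝ (fderiv ℝ a) x p p * u x + 2 * fderiv ℝ a x p * fderiv ℝ u x p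
        + a x * fderiv ℝ (fderiv ℝ u) x p p + fderiv ℝ (fderiv ℝ b) x p p)
      - (fderiv ℝ (fderiv ℝ a) y q q * u y + 2 * fderiv ℝ a y q * fderiv ℝ u y q
        + a y * fderiv ℝ (fderiv ℝ u) y q q + fderiv ℝ (fderiv ℝ b) y q q)
      ≤ L * (-B * c ^ 2 * (m x * m y)
        + 2 * ((1 - B * ‖x - y‖) * c) * (fderiv ℝ m x p * m y + m x * fderiv ℝ m y q)
        + modulus B ‖x - y‖ * (fderiv ℝ (fderiv ℝ m) x p p * m y
          + 2 * fderiv ℝ m x p * fderiv ℝ m y q + m x * fderiv ℝ (fderiv ℝ m) y q q)) := by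
  set r := ‖x - y‖ with hr
  have J := fun (f : E → ℝ) (z : E) (h : ContDiffAt ℝ 2 f z) (p : E) => Jet2.of_contDiffAt h p
  have hlin := Jet2.linear r c
  have hmod : Jet2 (fun t => modulus B (r + c * t)) ((1 - B * r) * c) (-B * c ^ 2) := by
    have := hlin.sub ((hlin.mul hlin).const_mul (B / 2))
    convert! this using 1
    · ext t; simp only [modulus]; ring
    · ring
    · ring
  have hjet := (((J a x hax p).mul (J u x hux p)).add (J b x hbx p)).sub
    (((J a y hay q).mul (J u y huy q)).add (J b y hby q)) |>.sub
    ((hmod.const_mul L).mul ((J m x hmx p).mul (J m y hmy q)))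
  have hloc := hjet.nonpos_of_isLocalMax (by
    have hcont : Tendsto (fun t : ℝ => (x + t • p, y + t • q)) (𝓝 0) (𝓝 (x, y)) := by
      have : ContinuousAt (fun t : ℝ => (x + t • p, y + t • q)) 0 := by fun_prop
      simpa [ContinuousAt] using this
    filter_upwards [hcont.eventually hmax, hdist] with t h1 h2
    simp only [zero_smul, add_zero, mul_zero]
    simp only [penalty, h2] at h1
    exact h1)
  simp only [zero_smul, add_zero, mul_zero] at hloc
  linarith

end space

/-- Moving `x` along `-ν` leaves `v` stationary. The modulus grows at rate at most `c r`, while the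
weight decays at rate `γ`, and `γ θ(r) ≥ γ r / 2 > c r`. The penalty strictly decreases, which is
impossible at a maximum. -/
theorem normal_doubling_false {E : Type*} [NormedAddCommGroup E] [InnerProductSpace ℝ E]
    {v w : E → ℝ} {x y ν : E} {L B c γ : ℝ} (hL : 0 < L) (hB : 0 ≤ B) (hc : 0 ≤ c)
    (hγ : 2 * c < γ) (hr : 0 < ‖x - y‖) (hBr : B * ‖x - y‖ < 1) (hν : ‖ν‖ = 1)
    (hin : -(c * ‖x - y‖ ^ 2) ≤ inner ℝ (x - y) ν)
    (hv : HasDerivWithinAt (fun t : ℝ => v (x + t • (-ν))) 0 (Set.Ici 0) 0)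
    (hw : HasDerivAt (fun t : ℝ => w (x + t • (-ν))) 1 0)
    (hmax : ∀ᶠ t in 𝓝[>] (0 : ℝ),
      v (x + t • (-ν)) - penalty L B (fun z => Real.exp (-γ * w z)) (x + t • (-ν)) y
        ≤ v x - penalty L B (fun z => Real.exp (-γ * w z)) x y) : False := by
  set r := ‖x - y‖ with hrdef
  set m : E → ℝ := fun z => Real.exp (-γ * w z) with hm
  have hmpos : ∀ z, 0 < m z := fun z => Real.exp_pos _
  -- The square of this majorant dominates `r² + 2 t c r² + t²`, hence `|x - tν - y|²`, and its
  -- slope at `0` is `c r`.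
  have hlin : HasDerivAt (fun t : ℝ => r + t * (c * r) + t ^ 2 / (2 * r)) (c * r) 0 := by
    have h1 := ((hasDerivAt_id (0 : ℝ)).mul_const (c * r)).const_add r
    have h2 := ((hasDerivAt_id (0 : ℝ)).pow 2).div_const (2 * r)
    have h3 := h1.add h2
    simpa [Pi.add_def] using h3
  have hθ : HasDerivAt (fun t : ℝ => modulus B (r + t * (c * r) + t ^ 2 / (2 * r)))
      ((1 - B * r) * (c * r)) 0 := by
    have h' := (hasDerivAt_modulus B (r + 0 * (c * r) + 0 ^ 2 / (2 * r))).comp (0 : ℝ) hlin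
    simpa [Function.comp_def] using h'
  have hm1 : HasDerivAt (fun t : ℝ => m (x + t • (-ν))) (m x * -γ) 0 := by
    have := (hw.const_mul (-γ)).exp
    simpa [hm] using this
  have hF := hv.sub ((hθ.const_mul L).mul (hm1.mul_const (m y))).hasDerivWithinAt
  have hnear : ∀ᶠ t in 𝓝[>] (0 : ℝ), B * (r + t * (c * r) + t ^ 2 / (2 * r)) ≤ 1 := by
    have hcn : ContinuousAt (fun t : ℝ => B * (r + t * (c * r) + t ^ 2 / (2 * r))) 0 := by
      fun_prop
    have : ∀ᶠ t in 𝓝 (0 : ℝ), B * (r + t * (c * r) + t ^ 2 / (2 * r)) < 1 :=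
      hcn.eventually_lt continuousAt_const (by simpa using hBr)
    exact (this.filter_mono nhdsWithin_le_nhds).mono fun _ h => h.le
  have hle := nonpos_of_hasDerivWithinAt_right (F := fun t : ℝ => v (x + t • (-ν))
      - L * modulus B (r + t * (c * r) + t ^ 2 / (2 * r)) * (m (x + t • (-ν)) * m y)) hF (by
    filter_upwards [hmax, hnear, self_mem_nhdsWithin] with t h1 h2 h3
    have h3 : (0 : ℝ) < t := h3
    have h4 : ‖x + t • (-ν) - y‖ ≤ r + t * (c * r) + t ^ 2 / (2 * r) := by
      refine abs_le_of_sq_le_sq' ?_ (by positivity) |>.2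
      rw [add_sub_right_comm, norm_add_sq_real, inner_smul_right, inner_neg_right, norm_smul,
        norm_neg, hν, mul_one, Real.norm_of_nonneg h3.le, ← hrdef]
      have h5 : (r + t * (c * r) + t ^ 2 / (2 * r)) ^ 2
          = r ^ 2 + 2 * (t * (c * r ^ 2)) + t ^ 2
            + (t * (c * r) + t ^ 2 / (2 * r)) ^ 2 := by
        field_simp; ring
      rw [h5]
      nlinarith [sq_nonneg (t * (c * r) + t ^ 2 / (2 * r)), mul_le_mul_of_nonneg_left hin h3.le]
    have h5 := modulus_le_modulus hB h4 h2
    have h6 : penalty L B m (x + t • (-ν)) y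
        ≤ L * modulus B (r + t * (c * r) + t ^ 2 / (2 * r)) * (m (x + t • (-ν)) * m y) :=
      mul_le_mul_of_nonneg_right (mul_le_mul_of_nonneg_left h5 hL.le)
        (mul_pos (hmpos _) (hmpos _)).le
    have h7 : penalty L B m x y = L * modulus B r * (m x * m y) := rfl
    have h8 : (0 : ℝ) ^ 2 / (2 * r) = 0 := by simp
    simp only [zero_smul, zero_mul, add_zero, h8]
    linarith)
  have h8 : (0 : ℝ) ^ 2 / (2 * r) = 0 := by simp
  simp only [zero_smul, zero_mul, add_zero, h8, zero_sub] at hle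
  have h9 := half_le_modulus hr.le hBr.le
  have h10 : (1 - B * r) * (c * r) ≤ c * r := by
    have : 0 ≤ B * r * (c * r) := by positivity
    linarith
  have h11 : 0 < γ * modulus B r - (1 - B * r) * (c * r) := by nlinarith
  have h12 : 0 < L * (m x * m y) := mul_pos hL (mul_pos (hmpos _) (hmpos _))
  nlinarith [mul_pos h12 h11]

end NeumannHessian

end

noncomputable section

namespace NeumannHessian

open Filter Topology
open scoped Manifold ContDiff

/-! ### Boundary defining functions -/

section boundary

variable {n : ℕ} {Ω : Set (Cn n)}

theorem inner_real_eq (x y : Cn n) : inner ℝ x y = (inner ℂ x y).re := by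
  simp [PiLp.inner_apply]

theorem IsLocalDefiningFunction.contDiffAt {x y : Cn n} {U : Set (Cn n)} {ρ : Cn n → ℝ}
    (h : IsLocalDefiningFunction Ω x U ρ) (hy : y ∈ U) : ContDiffAt ℝ 4 ρ y :=
  h.contDiffOn.contDiffAt (h.isOpen.mem_nhds hy)

theorem IsLocalDefiningFunction.eq_zero (hΩ : IsOpen Ω) {x y : Cn n} {U : Set (Cn n)}
    {ρ : Cn n → ℝ} (h : IsLocalDefiningFunction Ω x U ρ) (hy : y ∈ U) (hyf : y ∈ frontier Ω) :
    ρ y = 0 := by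
  rw [hΩ.frontier_eq] at hyf
  apply le_antisymm
  · have hc : ContinuousWithinAt ρ (Ω ∩ U) y := (h.contDiffAt hy).continuousAt.continuousWithinAt
    have hcl : y ∈ closure (Ω ∩ U) := by
      rw [Set.inter_comm]
      exact h.isOpen.inter_closure ⟨hy, hyf.1⟩
    have : (𝓝[Ω ∩ U] y).NeBot := mem_closure_iff_nhdsWithin_neBot.1 hcl
    refine le_of_tendsto hc ?_
    filter_upwards [self_mem_nhdsWithin] with z hz
    exact ((h.mem_iff z hz.2).1 hz.1).le
  · exact not_lt.1 fun hlt => hyf.2 ((h.mem_iff y hy).2 hlt)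

theorem IsLocalDefiningFunction.of_mem {x y : Cn n} {U : Set (Cn n)} {ρ : Cn n → ℝ}
    (h : IsLocalDefiningFunction Ω x U ρ) (hy : y ∈ U) (hd : fderiv ℝ ρ y ≠ 0) :
    IsLocalDefiningFunction Ω y U ρ :=
  ⟨h.isOpen, hy, h.contDiffOn, hd, h.mem_iff⟩

theorem hasDerivAt_line {E : Type*} [NormedAddCommGroup E] [NormedSpace ℝ E] {f : E → ℝ} {x : E}
    (hf : DifferentiableAt ℝ f x) (p : E) :
    HasDerivAt (fun t : ℝ => f (x + t • p)) (fderiv ℝ f x p) 0 := by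
  have hl : HasDerivAt (fun t : ℝ => x + t • p) p 0 := by
    simpa using ((hasDerivAt_id (0 : ℝ)).smul_const p).const_add x
  have h3 : HasFDerivAt f (fderiv ℝ f x) (x + (0 : ℝ) • p) := by
    simpa using hf.hasFDerivAt
  exact h3.comp_hasDerivAt (0 : ℝ) hl

theorem eventually_line_mem {E : Type*} [NormedAddCommGroup E] [NormedSpace ℝ E] {x : E}
    {U : Set E} (hU : U ∈ 𝓝 x) (p : E) : ∀ᶠ t in 𝓝 (0 : ℝ), x + t • p ∈ U := by
  have : ContinuousAt (fun t : ℝ => x + t • p) 0 := by fun_prop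
  exact this.eventually_mem (by simpa using hU)

/-- Directions along which a defining function decreases point into the domain. -/
theorem IsLocalDefiningFunction.eventually_mem (hΩ : IsOpen Ω) {x p : Cn n} {U : Set (Cn n)}
    {ρ : Cn n → ℝ} (h : IsLocalDefiningFunction Ω x U ρ) (hx : x ∈ frontier Ω)
    (hp : fderiv ℝ ρ x p < 0) : ∀ᶠ t in 𝓝[>] (0 : ℝ), x + t • p ∈ Ω := by
  have h0 := h.eq_zero hΩ h.mem hx
  have h1 := hasDerivAt_line ((h.contDiffAt h.mem).differentiableAt (by simp)) p
  have h2 := (hasDerivAt_iff_tendsto_slope.1 h1).mono_left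
    (nhdsWithin_mono (0 : ℝ) (fun t (ht : (0 : ℝ) < t) => ht.ne'))
  have h3 := (eventually_line_mem (h.isOpen.mem_nhds h.mem) p).filter_mono
    (nhdsWithin_le_nhds (s := Set.Ioi 0))
  filter_upwards [h2.eventually_lt_const hp, h3, self_mem_nhdsWithin] with t ht1 ht2 ht3
  have ht3 : (0 : ℝ) < t := ht3
  rw [h.mem_iff _ ht2]
  rw [slope_def_field, sub_zero, zero_smul, add_zero, h0, sub_zero, div_lt_iff₀ ht3,
    zero_mul] at ht1
  exact ht1

/-- If the normals differed, `ν₂ - ν₁` would point into the domain according to the first defining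
function and out of it according to the second. -/
theorem IsOuterUnitNormal.unique (hΩ : IsOpen Ω) {x ν₁ ν₂ : Cn n} (hx : x ∈ frontier Ω)
    (h₁ : IsOuterUnitNormal Ω x ν₁) (h₂ : IsOuterUnitNormal Ω x ν₂) : ν₁ = ν₂ := by
  obtain ⟨hn1, U₁, ρ₁, hd1, c₁, hc1, hf1⟩ := h₁
  obtain ⟨hn2, U₂, ρ₂, hd2, c₂, hc2, hf2⟩ := h₂
  by_contra hne
  have hlt : inner ℝ ν₁ ν₂ < 1 := inner_lt_one_iff_real_of_norm_eq_one hn1 hn2 |>.2 hne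
  have e1 : inner ℝ ν₁ (ν₂ - ν₁) < 0 := by
    rw [inner_sub_right, real_inner_self_eq_norm_sq, hn1]; linarith
  have e2 : 0 < inner ℝ ν₂ (ν₂ - ν₁) := by
    rw [inner_sub_right, real_inner_self_eq_norm_sq, hn2, real_inner_comm]; linarith
  have hp1 : fderiv ℝ ρ₁ x (ν₂ - ν₁) < 0 := by
    rw [hf1, ← inner_real_eq]; exact mul_neg_of_pos_of_neg hc1 e1
  have hp2 : 0 < fderiv ℝ ρ₂ x (ν₂ - ν₁) := by
    rw [hf2, ← inner_real_eq]; exact mul_pos hc2 e2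
  have hin := hd1.eventually_mem hΩ hx hp1
  have h3 := (eventually_line_mem (hd2.isOpen.mem_nhds hd2.mem) (ν₂ - ν₁)).filter_mono
    (nhdsWithin_le_nhds (s := Set.Ioi 0))
  have := nonpos_of_hasDerivWithinAt_right (hasDerivAt_line
    ((hd2.contDiffAt hd2.mem).differentiableAt (by simp)) (ν₂ - ν₁)).hasDerivWithinAt (by
    filter_upwards [hin, h3] with t h1 h2
    rw [zero_smul, add_zero, hd2.eq_zero hΩ hd2.mem hx]
    exact ((hd2.mem_iff _ h2).1 h1).le)
  linarith

theorem IsLocalDefiningFunction.exists_normal {x : Cn n} {U : Set (Cn n)} {ρ : Cn n → ℝ}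
    (h : IsLocalDefiningFunction Ω x U ρ) : ∃ ν : Cn n, IsOuterUnitNormal Ω x ν ∧
      ∀ p, fderiv ℝ ρ x p = ‖fderiv ℝ ρ x‖ * inner ℝ ν p := by
  set D := fderiv ℝ ρ x with hD
  have hD0 : 0 < ‖D‖ := norm_pos_iff.2 h.fderiv_ne_zero
  set g := (InnerProductSpace.toDual ℝ (Cn n)).symm D with hg
  have hgn : ‖g‖ = ‖D‖ := LinearIsometryEquiv.norm_map _ _
  have hgp : ∀ p, D p = inner ℝ g p := fun p => by
    rw [hg, InnerProductSpace.toDual_symm_apply]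
  have key : ∀ p, D p = ‖D‖ * inner ℝ (‖D‖⁻¹ • g) p := fun p => by
    rw [real_inner_smul_left, hgp]; field_simp
  refine ⟨‖D‖⁻¹ • g, ⟨?_, U, ρ, h, ‖D‖, hD0, fun p => ?_⟩, key⟩
  · rw [norm_smul, hgn, norm_inv, norm_norm]; field_simp
  · rw [← inner_real_eq]; exact key p

/-- Locally, the boundary has a normalised `C²` defining function. -/
theorem exists_local_normalized (hΩ : IsC4Domain Ω) {x : Cn n} (hx : x ∈ frontier Ω) :
    ∃ (V : Set (Cn n)) (h : Cn n → ℝ), IsOpen V ∧ x ∈ V ∧ V ⊆ Metric.ball x 1 ∧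
      (∀ y ∈ V, ContDiffAt ℝ 2 h y) ∧ (∀ y ∈ V, y ∈ frontier Ω → h y = 0) ∧
      (∀ y ∈ V, y ∈ Ω → 0 ≤ h y) ∧
      ∀ y ∈ V, y ∈ frontier Ω → ∀ ν, IsOuterUnitNormal Ω y ν →
        HasFDerivAt h (-(innerSL ℝ ν)) y := by
  obtain ⟨U, ρ, hd⟩ := hΩ.boundary x hx
  have hcont : ContinuousOn (fderiv ℝ ρ) U :=
    hd.contDiffOn.continuousOn_fderiv_of_isOpen hd.isOpen (by norm_num)
  have hVo : IsOpen (U ∩ {y | fderiv ℝ ρ y ≠ 0}) :=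
    hcont.isOpen_inter_preimage hd.isOpen isOpen_compl_singleton
  -- The function is `-ρ / |Dρ|`. The unit ball serves the compact support of the glued function.
  refine ⟨(U ∩ {y | fderiv ℝ ρ y ≠ 0}) ∩ Metric.ball x 1, fun y => -ρ y * ‖fderiv ℝ ρ y‖⁻¹,
    hVo.inter Metric.isOpen_ball, ⟨⟨hd.mem, hd.fderiv_ne_zero⟩, by simp⟩, Set.inter_subset_right,
    ?_, ?_, ?_, ?_⟩
  · rintro y ⟨⟨hyU, hy0⟩, -⟩
    have h4 := hd.contDiffAt hyU
    have h2 : ContDiffAt ℝ 2 (fderiv ℝ ρ) y := h4.fderiv_right (by norm_num)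
    -- The Riesz isometry turns the dual norm into an inner product norm, which is smooth away from
    -- zero.
    have hg : ContDiffAt ℝ 2 (fun y => (InnerProductSpace.toDual ℝ (Cn n)).symm (fderiv ℝ ρ y)) y :=
      (InnerProductSpace.toDual ℝ (Cn n)).symm.contDiff.contDiffAt.comp y h2
    have hn := hg.norm ℝ (by simpa using hy0)
    simp only [LinearIsometryEquiv.norm_map] at hn
    exact (h4.of_le (by norm_num)).neg.mul (hn.inv (norm_ne_zero_iff.2 hy0))
  · rintro y ⟨⟨hyU, hy0⟩, -⟩ hyf
    simp [hd.eq_zero hΩ.isOpen hyU hyf]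
  · rintro y ⟨⟨hyU, hy0⟩, -⟩ hyΩ
    have := (hd.mem_iff y hyU).1 hyΩ
    exact mul_nonneg (by linarith) (by positivity)
  · rintro y ⟨⟨hyU, hy0⟩, -⟩ hyf ν hν
    obtain ⟨ν', hν', hder⟩ := (hd.of_mem hyU hy0).exists_normal
    obtain rfl := hν.unique hΩ.isOpen hyf hν'
    have h4 := hd.contDiffAt hyU
    have h1 := (h4.differentiableAt (by simp)).hasFDerivAt
    have hN : DifferentiableAt ℝ (fun y => ‖fderiv ℝ ρ y‖⁻¹) y := by
      have h2 : ContDiffAt ℝ 2 (fderiv ℝ ρ) y := h4.fderiv_right (by norm_num)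
      have hg : ContDiffAt ℝ 2
          (fun y => (InnerProductSpace.toDual ℝ (Cn n)).symm (fderiv ℝ ρ y)) y :=
        (InnerProductSpace.toDual ℝ (Cn n)).symm.contDiff.contDiffAt.comp y h2
      have hn := hg.norm ℝ (by simpa using hy0)
      simp only [LinearIsometryEquiv.norm_map] at hn
      exact (hn.inv (norm_ne_zero_iff.2 hy0)).differentiableAt (by simp)
    have h5 := h1.neg.mul hN.hasFDerivAt
    convert! h5 using 1
    ext p
    have hpos : ‖fderiv ℝ ρ y‖ ≠ 0 := norm_ne_zero_iff.2 hy0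
    have h0 := hd.eq_zero hΩ.isOpen hyU hyf
    simp [h0, hder p]
    field_simp

/-- A compactly supported `C²` function which behaves like the distance to the boundary to first
order at the boundary, and is nonnegative on the closure of the domain. -/
theorem exists_boundary_function (hΩ : IsC4Domain Ω) : ∃ w : Cn n → ℝ, ContDiff ℝ 2 w ∧
    HasCompactSupport w ∧ (∀ x ∈ frontier Ω, w x = 0) ∧ (∀ x ∈ closure Ω, 0 ≤ w x) ∧
    ∀ x ∈ frontier Ω, ∃ ν, IsOuterUnitNormal Ω x ν ∧ (∀ p, fderiv ℝ w x p = -inner ℝ ν p) ∧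
      ∀ᶠ t in 𝓝[>] (0 : ℝ), x + t • (-ν) ∈ Ω := by
  have hcpt : IsCompact (frontier Ω) :=
    (hΩ.isBounded.closure.isCompact_closure.of_isClosed_subset isClosed_frontier
      (frontier_subset_closure.trans subset_closure))
  choose! V h hVo hxV hVb hsm hz hnn hder using fun (x : Cn n) (hx : x ∈ frontier Ω) =>
    exists_local_normalized hΩ hx
  obtain ⟨t, ht, hcov⟩ := hcpt.elim_nhds_subcover V fun x hx => (hVo x hx).mem_nhds (hxV x hx)
  obtain ⟨f, hf⟩ := SmoothPartitionOfUnity.exists_isSubordinate (𝓘(ℝ, Cn n)) isClosed_frontier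
    (fun i : t => V i) (fun i => hVo i (ht i i.2)) (by
      intro x hx
      obtain ⟨i, hi, hxi⟩ := Set.mem_iUnion₂.1 (hcov hx)
      exact Set.mem_iUnion.2 ⟨⟨i, hi⟩, hxi⟩)
  have hfV : ∀ (i : t) x, f i x ≠ 0 → x ∈ V i := fun i x hx =>
    hf i (subset_tsupport _ hx)
  have hsum : ∀ x ∈ frontier Ω, ∑ i, f i x = 1 := fun x hx => by
    rw [← finsum_eq_sum_of_fintype]; exact f.sum_eq_one hx
  have hC : ∀ i : t, ContDiff ℝ 2 (fun x => f i x * h i x) := fun i => by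
    have := f.contMDiff_smul (n := 2) (i := i) (g := h i) (fun x hx =>
      (hsm i (ht i i.2) x (hf i hx)).contMDiffAt)
    exact this.contDiff
  refine ⟨fun x => ∑ i, f i x * h i x, ContDiff.sum fun i _ => hC i, ?_, ?_, ?_, ?_⟩
  · refine HasCompactSupport.intro
      (K := ⋃ i : t, Metric.closedBall (i : Cn n) 1)
      (isCompact_iUnion fun i => isCompact_closedBall _ _) fun x hx => ?_
    refine Finset.sum_eq_zero fun i _ => ?_
    rw [mul_eq_zero]
    left
    by_contra hne
    exact hx (Set.mem_iUnion.2 ⟨i, Metric.ball_subset_closedBall (hVb i (ht i i.2) (hfV i x hne))⟩)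
  · intro x hx
    refine Finset.sum_eq_zero fun i _ => ?_
    by_cases hne : f i x = 0
    · simp [hne]
    · rw [hz i (ht i i.2) x (hfV i x hne) hx, mul_zero]
  · intro x hx
    refine Finset.sum_nonneg fun i _ => ?_
    by_cases hne : f i x = 0
    · simp [hne]
    · refine mul_nonneg (f.nonneg i x) ?_
      by_cases hxΩ : x ∈ Ω
      · exact hnn i (ht i i.2) x (hfV i x hne) hxΩ
      · exact (hz i (ht i i.2) x (hfV i x hne) (by
          rw [hΩ.isOpen.frontier_eq]; exact ⟨hx, hxΩ⟩)).ge
  · intro x hx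
    obtain ⟨U, ρ, hd⟩ := hΩ.boundary x hx
    obtain ⟨ν, hν, hρ⟩ := hd.exists_normal
    refine ⟨ν, hν, fun p => ?_, ?_⟩
    · have hi : ∀ i ∈ (Finset.univ : Finset t), HasFDerivAt (fun x => f i x * h i x)
          (f i x • -(innerSL ℝ ν)) x := by
        intro i _
        by_cases hxt : x ∈ tsupport (f i)
        · have hxV := hf i hxt
          have h1 : DifferentiableAt ℝ (f i) x :=
            (f i).contMDiff.contDiff.contDiffAt.differentiableAt (by simp)
          have h2 := h1.hasFDerivAt.mul (hder i (ht i i.2) x hxV hx ν hν)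
          rw [hz i (ht i i.2) x hxV hx, zero_smul, add_zero] at h2
          exact h2
        · have h1 : f i =ᶠ[𝓝 x] 0 := notMem_tsupport_iff_eventuallyEq.1 hxt
          have h2 : f i x = 0 := h1.self_of_nhds
          rw [h2, zero_smul]
          refine (hasFDerivAt_const (0 : ℝ) x).congr_of_eventuallyEq ?_
          filter_upwards [h1] with z hz
          simp [hz]
      have h3 := HasFDerivAt.fun_sum hi
      rw [h3.fderiv, ← Finset.sum_smul, hsum x hx]
      simp
    · refine hd.eventually_mem hΩ.isOpen hx ?_
      rw [hρ, inner_neg_right, real_inner_self_eq_norm_sq, hν.1]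
      have : 0 < ‖fderiv ℝ ρ x‖ := norm_pos_iff.2 hd.fderiv_ne_zero
      linarith

end boundary

end NeumannHessian

end

/-! ### Derivative bounds and interior maxima of the doubled function -/

noncomputable section

namespace NeumannHessian

open Filter Topology

section bounds

variable {E : Type*} [NormedAddCommGroup E] [NormedSpace ℝ E]

theorem bounded2_of_norm_le {f : E → ℝ} {x : E} {G : ℝ} (hf : ContDiffAt ℝ 2 f x)
    (h0 : ‖f x‖ ≤ G) (h1 : ‖fderiv ℝ f x‖ ≤ G) (h2 : ‖fderiv ℝ (fderiv ℝ f) x‖ ≤ G) :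
    Bounded2 f x G :=
  ⟨hf, h0, fun p => (fderiv ℝ f x).le_of_opNorm_le h1 p, fun p => by
    have := (fderiv ℝ (fderiv ℝ f) x).le_of_opNorm₂_le_of_le h2 (le_refl ‖p‖) (le_refl ‖p‖)
    rw [Real.norm_eq_abs] at this
    linarith [this]⟩

theorem exists_bounded2_of_hasCompactSupport {w : E → ℝ} (hw : ContDiff ℝ 2 w)
    (hc : HasCompactSupport w) : ∃ W : ℝ, 0 ≤ W ∧ ∀ x, Bounded2 w x W := by
  have hd : ContDiff ℝ 1 (fderiv ℝ w) := hw.fderiv_right (by norm_num)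
  have hd' : Continuous (fderiv ℝ (fderiv ℝ w)) := hd.continuous_fderiv one_ne_zero
  have c1 : HasCompactSupport (fderiv ℝ w) := hc.fderiv ℝ
  have c2 : HasCompactSupport (fderiv ℝ (fderiv ℝ w)) := c1.fderiv ℝ
  obtain ⟨W₀, h0⟩ : ∃ C, ∀ x, ‖w x‖ ≤ C := hc.exists_bound_of_continuous hw.continuous
  obtain ⟨W₁, h1⟩ : ∃ C, ∀ x, ‖fderiv ℝ w x‖ ≤ C :=
    HasCompactSupport.exists_bound_of_continuous (f := fderiv ℝ w) c1 hd.continuous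
  obtain ⟨W₂, h2⟩ : ∃ C, ∀ x, ‖fderiv ℝ (fderiv ℝ w) x‖ ≤ C :=
    HasCompactSupport.exists_bound_of_continuous (f := fderiv ℝ (fderiv ℝ w)) c2 hd'
  refine ⟨max 0 (max W₀ (max W₁ W₂)), le_max_left _ _, fun x =>
    bounded2_of_norm_le hw.contDiffAt ((h0 x).trans ?_) ((h1 x).trans ?_) ((h2 x).trans ?_)⟩
  · exact (le_max_left _ _).trans (le_max_right _ _)
  · exact (le_max_left _ _).trans ((le_max_right _ _).trans (le_max_right _ _))
  · exact (le_max_right _ _).trans ((le_max_right _ _).trans (le_max_right _ _))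

theorem bounded2_of_iteratedFDeriv {f : E → ℝ} {K : ℝ} (hf : ContDiff ℝ 3 f)
    (h : ∀ j : ℕ, j ≤ 3 → ∀ x, ‖iteratedFDeriv ℝ j f x‖ ≤ K) (x : E) : Bounded2 f x K := by
  refine bounded2_of_norm_le (hf.of_le (by norm_num)).contDiffAt ?_ ?_ ?_
  · simpa using h 0 (by norm_num) x
  · rw [← norm_iteratedFDeriv_one]; exact h 1 (by norm_num) x
  · rw [← norm_iteratedFDeriv_one, norm_iteratedFDeriv_fderiv]
    exact h 2 (by norm_num) x

/-- A first order Taylor estimate. -/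
theorem le_taylor_of_bounded2 {w : E → ℝ} {W : ℝ} (hW : ∀ z, Bounded2 w z W) (x p : E) :
    w (x + p) ≤ w x + fderiv ℝ w x p + W * ‖p‖ ^ 2 := by
  have hl : ∀ t : ℝ, HasDerivAt (fun t : ℝ => x + t • p) p t := fun t => by
    simpa using ((hasDerivAt_id t).smul_const p).const_add x
  have h1 : ∀ t : ℝ, HasDerivAt (fun t : ℝ => w (x + t • p)) (fderiv ℝ w (x + t • p) p) t :=
    fun t => ((hW _).contDiffAt.differentiableAt (by simp)).hasFDerivAt.comp_hasDerivAt t (hl t)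
  have h2 : ∀ t : ℝ, HasDerivAt (fun t : ℝ => fderiv ℝ w (x + t • p) p)
      (fderiv ℝ (fderiv ℝ w) (x + t • p) p p) t := fun t => by
    have h3 := (((hW (x + t • p)).contDiffAt.fderiv_right (m := 1)
      (by norm_num)).differentiableAt (by simp)).hasFDerivAt.comp_hasDerivAt t (hl t)
    simpa using h3.clm_apply (hasDerivAt_const t p)
  obtain ⟨s, hs, e1⟩ := exists_hasDerivAt_eq_slope _ _ (zero_lt_one' ℝ)
    (fun t _ => (h1 t).continuousAt.continuousWithinAt) (fun t _ => h1 t)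
  obtain ⟨r, -, e2⟩ := exists_hasDerivAt_eq_slope _ _ hs.1
    (fun t _ => (h2 t).continuousAt.continuousWithinAt) (fun t _ => h2 t)
  simp only [zero_smul, add_zero, one_smul, sub_zero, div_one] at e1 e2
  have hb := (le_abs_self _).trans ((hW (x + r • p)).abs_fderiv_fderiv_le p)
  rw [e2, div_le_iff₀ hs.1] at hb
  have : W * ‖p‖ ^ 2 * s ≤ W * ‖p‖ ^ 2 :=
    mul_le_of_le_one_right (mul_nonneg (hW x).nonneg (by positivity)) hs.2.le
  linarith

end bounds

/-- A one-sided directional derivative along a segment that enters a set. -/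
theorem hasDerivWithinAt_line {E : Type*} [NormedAddCommGroup E] [NormedSpace ℝ E] {f : E → ℝ}
    {s : Set E} {x p : E} (hf : DifferentiableWithinAt ℝ f s x) (hx : x ∈ s)
    (hin : ∀ᶠ t in 𝓝[>] (0 : ℝ), x + t • p ∈ s) :
    HasDerivWithinAt (fun t : ℝ => f (x + t • p)) (fderivWithin ℝ f s x p) (Set.Ici 0) 0 := by
  have hl : HasDerivAt (fun t : ℝ => x + t • p) p 0 := by
    simpa using ((hasDerivAt_id (0 : ℝ)).smul_const p).const_add x
  have h3 : HasFDerivWithinAt f (fderivWithin ℝ f s x) s (x + (0 : ℝ) • p) := by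
    simpa using hf.hasFDerivWithinAt
  have h4 := h3.comp_hasDerivWithinAt (s := {t : ℝ | x + t • p ∈ s}) (0 : ℝ) hl.hasDerivWithinAt
    (fun t ht => ht)
  refine h4.mono_of_mem_nhdsWithin ?_
  have h5 : ∀ᶠ t in 𝓝[≥] (0 : ℝ), x + t • p ∈ s := by
    rw [← Set.Ioi_insert, nhdsWithin_insert, eventually_sup]
    exact ⟨by simpa using hx, hin⟩
  exact h5

section main

variable {n : ℕ}

/-- Bound on the derivative of `u` at a maximum point of the doubled function. -/
theorem abs_fderiv_le_of_doubling {E : Type*} [NormedAddCommGroup E] [NormedSpace ℝ E]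
    {u a b m : E → ℝ} {x y : E} {L B G M a₀ : ℝ}
    (hL : 1 ≤ L) (hB : 0 ≤ B) (hr1 : ‖x - y‖ ≤ 1) (hBr : B * ‖x - y‖ < 1)
    (hu : ContDiffAt ℝ 2 u x) (huM : |u x| ≤ M) (ha : Bounded2 a x G) (hb : Bounded2 b x G)
    (hm : Bounded2 m x G) (ha0 : 0 < a₀) (hax : a₀ ≤ a x)
    (hmnn : ∀ z, 0 ≤ m z) (hmx : m x ≤ 1) (hmy : m y ≤ 1)
    (hmax : ∀ᶠ z in 𝓝 x, (a z * u z + b z) - penalty L B m z y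
      ≤ (a x * u x + b x) - penalty L B m x y) (p : E) :
    |fderiv ℝ u x p| ≤ L * ((1 + 2 * G + G * M) / a₀) * ‖p‖ := by
  have hD : ∀ {f : E → ℝ} (_ : ContDiffAt ℝ 2 f x) (p : E),
      HasDerivAt (fun t : ℝ => f (x + t • p)) (fderiv ℝ f x p) 0 := fun hf p =>
    hasDerivAt_line (hf.differentiableAt (by simp)) p
  have key : ∀ p, a x * fderiv ℝ u x p ≤ L * (1 + 2 * G + G * M) * ‖p‖ := by
    intro p
    have hv := ((hD ha.contDiffAt p).mul (hD hu p)).add (hD hb.contDiffAt p)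
    have h := deriv_le_of_doubling (v := fun z => a z * u z + b z) (L := L) (by linarith) hB hr1 hBr hv
      (hD hm.contDiffAt p) (hm.abs_fderiv_le p) hmnn hmx hmy (by
        have : ContinuousAt (fun t : ℝ => x + t • p) 0 := by fun_prop
        have h2 : Tendsto (fun t : ℝ => x + t • p) (𝓝[>] 0) (𝓝 x) := by
          have h3 : Tendsto (fun t : ℝ => x + t • p) (𝓝 0) (𝓝 x) := by
            simpa [ContinuousAt] using this
          exact h3.mono_left nhdsWithin_le_nhds
        exact h2.eventually hmax)
    simp only [zero_smul, add_zero] at h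
    have h1 := neg_le_of_abs_le (abs_mul_le (ha.abs_fderiv_le p) huM)
    have h2 := neg_le_of_abs_le (hb.abs_fderiv_le p)
    have hM := (abs_nonneg _).trans huM
    have hG := ha.nonneg
    -- Since `L ≥ 1`, lower-order terms are absorbed into multiples of `L`; the resulting constant
    -- does not involve `B`.
    have h3 : (L - 1) * ((G + G * M) * ‖p‖) ≥ 0 := by
      have : 0 ≤ L - 1 := by linarith
      positivity
    linarith
  have hapos : 0 < a x := ha0.trans_le hax
  have hM := (abs_nonneg _).trans huM
  have hG := ha.nonneg
  have hrhs : 0 ≤ L * ((1 + 2 * G + G * M) / a₀) * ‖p‖ := by positivity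
  have hkey : ∀ p, fderiv ℝ u x p ≤ L * ((1 + 2 * G + G * M) / a₀) * ‖p‖ := by
    intro p
    have hrhs : 0 ≤ L * ((1 + 2 * G + G * M) / a₀) * ‖p‖ := by positivity
    refine le_of_mul_le_mul_left ((key p).trans ?_) hapos
    have h1 := mul_le_mul_of_nonneg_right hax hrhs
    refine le_trans (le_of_eq ?_) h1
    field_simp
  refine abs_le.2 ⟨?_, hkey p⟩
  have := hkey (-p)
  rw [map_neg, norm_neg] at this
  linarith

/-- The doubled function has no interior maximum at distinct nearby points, unless the quotients
`σ_{j+1} / σ_j` are large. -/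
theorem ratio_of_interior_doubling {k : ℕ} (hk : k + 1 ≤ n) : ∃ c : ℝ, 0 < c ∧
    ∀ (u a b m : Cn n → ℝ) (x y : Cn n) (L B G M a₀ m₀ : ℝ),
      1 ≤ L → 1 ≤ B → x ≠ y → ‖x - y‖ ≤ 1 → B * ‖x - y‖ < 1 → 0 < a₀ → 0 < m₀ → 0 ≤ G → 0 ≤ M →
      (n ^ 2 * (6 * G ^ 2 + (2 * G * ((1 + 2 * G + G * M) / a₀) + G * M + G)) + 1
        ≤ c * (B * m₀ ^ 2)) →
      (∀ z, 0 ≤ m z) →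
      (∀ z, z = x ∨ z = y → ContDiffAt ℝ 2 u z ∧ |u z| ≤ M ∧ Bounded2 a z G ∧ Bounded2 b z G ∧
        Bounded2 m z G ∧ a₀ ≤ a z ∧ a z ≤ 1 ∧ m₀ ≤ m z ∧ m z ≤ 1 ∧ eta u z ∈ gardingCone n k) →
      (∀ᶠ z : Cn n × Cn n in 𝓝 (x, y),
        (a z.1 * u z.1 + b z.1) - (a z.2 * u z.2 + b z.2) - penalty L B m z.1 z.2
          ≤ (a x * u x + b x) - (a y * u y + b y) - penalty L B m x y) →
      ∀ j < k, L * sigma j (eta u y) ≤ sigma (j + 1) (eta u y) := by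
  obtain ⟨c, hc, H⟩ := exists_ratio_bound_eta hk
  refine ⟨c, hc, ?_⟩
  intro u a b m x y L B G M a₀ m₀ hL hB hxy hr1 hBr ha0 hm0 hG hM hcB hmnn hdata hmax j hj
  obtain ⟨hux, huMx, hax, hbx, hmx, ha0x, ha1x, hm0x, hm1x, hηx⟩ := hdata x (Or.inl rfl)
  obtain ⟨huy, huMy, hay, hby, hmy, ha0y, ha1y, hm0y, hm1y, hηy⟩ := hdata y (Or.inr rfl)
  set r := ‖x - y‖ with hr
  have hr0 : 0 < r := norm_pos_iff.2 (sub_ne_zero.2 hxy)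
  set Q := (1 + 2 * G + G * M) / a₀ with hQ
  have hQ0 : 0 ≤ Q := by positivity
  set S := 2 * G * Q + G * M + G with hS
  have hS0 : 0 ≤ S := by positivity
  have hPx : ∀ p, |fderiv ℝ u x p| ≤ L * Q * ‖p‖ := by
    refine abs_fderiv_le_of_doubling (y := y) hL (by linarith) hr1 hBr hux huMx hax hbx hmx ha0 ha0x
      hmnn hm1x hm1y ?_
    have hcont : Tendsto (fun z : Cn n => (z, y)) (𝓝 x) (𝓝 (x, y)) :=
      (Continuous.prodMk_left y).tendsto x
    filter_upwards [hcont.eventually hmax] with z hz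
    linarith
  -- The same bound with the two points exchanged and `u`, `b` replaced by their negatives.
  have hPy : ∀ p, |fderiv ℝ u y p| ≤ L * Q * ‖p‖ := by
    have hneg : ∀ {f : Cn n → ℝ} {z : Cn n}, Bounded2 f z G → Bounded2 (fun z => -f z) z G := by
      intro f z hf
      have e1 : fderiv ℝ (fun z => -f z) = fun z => -fderiv ℝ f z := by
        ext z; rw [fderiv_fun_neg]
      refine ⟨hf.contDiffAt.neg, by simpa using hf.abs_le, fun p => ?_, fun p => ?_⟩
      · rw [e1]; simpa using hf.abs_fderiv_le p
      · rw [e1, fderiv_fun_neg]; simpa using hf.abs_fderiv_fderiv_le p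
    intro p
    have := abs_fderiv_le_of_doubling (u := fun z => -u z) (b := fun z => -b z) (y := x) (B := B) hL
      (by linarith) (by rwa [norm_sub_rev]) (by rwa [norm_sub_rev]) huy.neg (by simpa using huMy)
      hay (hneg hby) hmy ha0 ha0y hmnn hm1y hm1x (by
        have hcont : Tendsto (fun z : Cn n => (x, z)) (𝓝 y) (𝓝 (x, y)) :=
          (Continuous.prodMk_right x).tendsto y
        filter_upwards [hcont.eventually hmax] with z hz
        rw [penalty_comm L B m z x, penalty_comm L B m y x]
        linarith) p
    rw [fderiv_fun_neg] at this
    simpa using this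
  have hlow : ∀ (z ξ : Cn n), |u z| ≤ M → Bounded2 a z G → Bounded2 b z G →
      (∀ p, |fderiv ℝ u z p| ≤ L * Q * ‖p‖) →
      |fderiv ℝ (fderiv ℝ a) z ξ ξ * u z + 2 * fderiv ℝ a z ξ * fderiv ℝ u z ξ
        + fderiv ℝ (fderiv ℝ b) z ξ ξ| ≤ L * S * ‖ξ‖ ^ 2 := by
    intro z ξ huz haz hbz hP
    have h1 := abs_mul_le (haz.abs_fderiv_fderiv_le ξ) huz
    have h2 := abs_mul_le (haz.abs_fderiv_le ξ) (hP ξ)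
    have h3 := hbz.abs_fderiv_fderiv_le ξ
    have h4 : 0 ≤ (L - 1) * ((G * M + G) * ‖ξ‖ ^ 2) := by
      have : 0 ≤ L - 1 := by linarith
      positivity
    rw [hS]
    rw [abs_le] at h1 h2 h3 ⊢
    constructor <;> linarith
  have hmod0 : 0 ≤ modulus B r := le_trans (by positivity) (half_le_modulus hr0.le hBr.le)
  have hmod1 : modulus B r ≤ 1 := (modulus_le (by linarith)).trans hr1
  have hmm2 : ∀ p q : Cn n, ‖p‖ = ‖q‖ → modulus B r * (fderiv ℝ (fderiv ℝ m) x p p * m y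
      + 2 * fderiv ℝ m x p * fderiv ℝ m y q + m x * fderiv ℝ (fderiv ℝ m) y q q)
      ≤ 4 * G ^ 2 * ‖p‖ ^ 2 := by
    intro p q hpq
    have h1 := abs_mul_le (hmx.abs_fderiv_fderiv_le p) hmy.abs_le
    have h2 := abs_mul_le (hmx.abs_fderiv_le p) (hmy.abs_fderiv_le q)
    have h3 := abs_mul_le hmx.abs_le (hmy.abs_fderiv_fderiv_le q)
    rw [← hpq] at h2 h3
    have h4 : |fderiv ℝ (fderiv ℝ m) x p p * m y
      + 2 * fderiv ℝ m x p * fderiv ℝ m y q + m x * fderiv ℝ (fderiv ℝ m) y q q|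
        ≤ 4 * G ^ 2 * ‖p‖ ^ 2 := by
      rw [abs_le] at h1 h2 h3 ⊢
      constructor <;> linarith
    have h5 := abs_mul_le (by rwa [abs_of_nonneg hmod0] : |modulus B r| ≤ 1) h4
    rw [one_mul] at h5
    exact (le_abs_self _).trans h5
  have hL0 : 0 ≤ L := by linarith
  -- Parallel displacement keeps the distance fixed, so neither derivative of the modulus appears.
  -- The constant `4 G²` is enlarged to `12 G²` to share the shift `s` with the next estimate.
  have hsame : ∀ ξ : Cn n, a x * fderiv ℝ (fderiv ℝ u) x ξ ξ - a y * fderiv ℝ (fderiv ℝ u) y ξ ξ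
      ≤ L * (12 * G ^ 2 + 2 * S) * ‖ξ‖ ^ 2 := by
    intro ξ
    have h := second_order_of_doubling (p := ξ) (q := ξ) (c := 0) hux huy hax.contDiffAt
      hay.contDiffAt hbx.contDiffAt hby.contDiffAt hmx.contDiffAt hmy.contDiffAt
      (Eventually.of_forall fun t => by simp) hmax
    have h1 := neg_le_of_abs_le (hlow x ξ huMx hax hbx hPx)
    have h2 := le_of_abs_le (hlow y ξ huMy hay hby hPy)
    have h3 := mul_le_mul_of_nonneg_left (hmm2 ξ ξ rfl) hL0
    have h4 : 0 ≤ L * (8 * G ^ 2) * ‖ξ‖ ^ 2 := by positivity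
    linarith
  set e : Cn n := r⁻¹ • (x - y) with he
  have hen : ‖e‖ = 1 := by
    rw [he, norm_smul, norm_inv, Real.norm_of_nonneg hr0.le, ← hr]; field_simp
  have hxe : x - y = r • e := by rw [he, smul_smul]; field_simp; simp
  -- Opposite displacement changes the distance at rate `2`, so the second derivative `-B` of the
  -- modulus yields the gain `-4 B m₀²`. The cross terms between modulus and weight cost another `8
  -- G²`.
  have hopp : a x * fderiv ℝ (fderiv ℝ u) x e e - a y * fderiv ℝ (fderiv ℝ u) y e e
      ≤ L * (12 * G ^ 2 + 2 * S - 4 * B * m₀ ^ 2) := by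
    have h := second_order_of_doubling (p := e) (q := -e) (c := 2) hux huy hax.contDiffAt
      hay.contDiffAt hbx.contDiffAt hby.contDiffAt hmx.contDiffAt hmy.contDiffAt (by
        have : ∀ᶠ t in 𝓝 (0 : ℝ), 0 < r + 2 * t := by
          have hcn : ContinuousAt (fun t : ℝ => r + 2 * t) 0 := by fun_prop
          exact continuousAt_const.eventually_lt hcn (by simpa using hr0)
        filter_upwards [this] with t ht
        rw [show x + t • e - (y + t • -e) = (r + 2 * t) • e by
          rw [add_sub_add_comm, hxe]; module, norm_smul, hen, mul_one, Real.norm_of_nonneg ht.le])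
      hmax
    have h1 := neg_le_of_abs_le (hlow x e huMx hax hbx hPx)
    have h2 := le_of_abs_le (hlow y e huMy hay hby hPy)
    have h3 := mul_le_mul_of_nonneg_left (hmm2 e (-e) (norm_neg e).symm) hL0
    have h4 : (1 - B * r) * 2 * (fderiv ℝ m x e * m y + m x * fderiv ℝ m y (-e))
        ≤ 4 * G ^ 2 := by
      have g1 := abs_mul_le (hmx.abs_fderiv_le e) hmy.abs_le
      have g2 := abs_mul_le hmx.abs_le (hmy.abs_fderiv_le (-e))
      rw [norm_neg, hen] at g2
      rw [hen] at g1
      have g3 := (abs_add_le (fderiv ℝ m x e * m y) (m x * fderiv ℝ m y (-e))).trans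
        (add_le_add g1 g2)
      have hBr0 : 0 ≤ B * r := by positivity
      have g4 : |(1 - B * r) * 2| ≤ 2 := by rw [abs_le]; constructor <;> linarith
      have g5 := (le_abs_self _).trans (abs_mul_le g4 g3)
      linarith
    have h5 := mul_le_mul_of_nonneg_left h4 hL0
    have h6 : m₀ ^ 2 ≤ m x * m y := by
      rw [sq]; exact mul_le_mul hm0x hm0y hm0.le (hm0.le.trans hm0x)
    have h7 : L * B * m₀ ^ 2 ≤ L * B * (m x * m y) :=
      mul_le_mul_of_nonneg_left h6 (by positivity)
    simp only [map_neg, _root_.neg_apply, neg_neg, hen, one_pow, mul_one, mul_neg,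
      neg_mul] at h h1 h2 h3 h5
    linarith
  have hfin := H u x y hux huy hηx hηy (a x) (a y) (L * (6 * G ^ 2 + S)) (B * L * m₀ ^ 2)
    (ha0.trans_le ha0x) (ha0.trans_le ha0y) (by positivity)
    (fun ξ => by linarith [hsame ξ]) e hen (by linarith) j hj
  have hσj : 0 < sigma j (eta u y) := inCone_of_mem_gardingCone hηy j hj.le
  have hσj1 : 0 < sigma (j + 1) (eta u y) := inCone_of_mem_gardingCone hηy (j + 1) hj
  have h1 : L ≤ c * (B * L * m₀ ^ 2) - n ^ 2 * (L * (6 * G ^ 2 + S)) := by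
    have := mul_le_mul_of_nonneg_left hcB hL0
    linarith
  calc L * sigma j (eta u y)
      ≤ (c * (B * L * m₀ ^ 2) - n ^ 2 * (L * (6 * G ^ 2 + S))) * sigma j (eta u y) :=
        mul_le_mul_of_nonneg_right h1 hσj.le
    _ ≤ a y * sigma (j + 1) (eta u y) := hfin
    _ ≤ sigma (j + 1) (eta u y) := mul_le_of_le_one_left hσj1.le ha1y

/-- Iterating the lower bound of the quotients `σ_{j+1} / σ_j`. -/
theorem pow_mul_sigma_le {k l : ℕ} {v : Fin n → ℝ} {L : ℝ} (hL : 0 ≤ L)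
    (h : ∀ j < k, L * sigma j v ≤ sigma (j + 1) v) :
    ∀ d, l + d ≤ k → L ^ d * sigma l v ≤ sigma (l + d) v := by
  intro d
  induction d with
  | zero => simp
  | succ d ih =>
    intro hd
    refine le_trans ?_ (h (l + d) (by omega))
    rw [pow_succ', mul_assoc]
    exact mul_le_mul_of_nonneg_left (ih (by omega)) hL

/-- A bound for the quotients `σ_k / σ_l` is incompatible with large consecutive quotients. -/
theorem not_large_ratio {k : ℕ} (hk : 1 ≤ k) {Ω : Set (Cn n)} {β K L : ℝ} {φ ψ u : Cn n → ℝ}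
    (hL : 1 ≤ L) (hKL : K < L) {z : Cn n} (hz : z ∈ Ω) (hη : eta u z ∈ gardingCone n k)
    (hψ : ψ z ≤ K)
    (hsol : SolvesHessian k Ω β φ ψ u ∨ ∃ l : ℕ, 1 ≤ l ∧ l < k ∧ SolvesQuotient k l Ω β φ ψ u)
    (h : ∀ j < k, L * sigma j (eta u z) ≤ sigma (j + 1) (eta u z)) : False := by
  -- Multiplying the consecutive quotients gives `L^(k-l)`, which is at least `L` because `L ≥ 1`
  -- and `l < k`.
  have key : ∀ l, l < k → L * sigma l (eta u z) ≤ sigma k (eta u z) := fun l hl => by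
    have h1 := pow_mul_sigma_le (l := l) (by linarith) h (k - l) (by omega)
    rw [Nat.add_sub_cancel' hl.le] at h1
    refine le_trans (mul_le_mul_of_nonneg_right ?_
      (inCone_of_mem_gardingCone hη l hl.le).le) h1
    exact le_self_pow₀ hL (by omega)
  rcases hsol with hs | ⟨l, -, hlk, hs⟩
  · have h1 := key 0 (by omega)
    rw [hs.1 z hz, sigma_eq_esym, esym_zero] at h1
    linarith
  · have h1 := key l hlk
    have hσ : 0 < sigma l (eta u z) := inCone_of_mem_gardingCone hη l hlk.le
    rw [← le_div_iff₀ hσ, hs.1 z hz] at h1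
    linarith

end main

end NeumannHessian

end

/-! ### Boundary maxima, choice of constants and conclusion -/

noncomputable section

namespace NeumannHessian

open Filter Topology

section main

variable {n : ℕ} {Ω : Set (Cn n)}

/-- The substitution `v = exp(-β w) u + Φ w` turns the Robin condition into a homogeneous Neumann
condition. -/
theorem hasDerivWithinAt_normal {β : ℝ} {φ Φ u w : Cn n → ℝ} {x ν : Cn n}
    (hx : x ∈ frontier Ω) (hu : DifferentiableWithinAt ℝ u (closure Ω) x)
    (hw : DifferentiableAt ℝ w x) (hΦ : DifferentiableAt ℝ Φ x) (hΦφ : Φ x = φ x)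
    (hN : NeumannCondition Ω β φ u) (hν : IsOuterUnitNormal Ω x ν) (hw0 : w x = 0)
    (hwν : fderiv ℝ w x ν = -1) (hin : ∀ᶠ t in 𝓝[>] (0 : ℝ), x + t • (-ν) ∈ Ω) :
    HasDerivWithinAt (fun t : ℝ => Real.exp (-β * w (x + t • (-ν))) * u (x + t • (-ν))
      + Φ (x + t • (-ν)) * w (x + t • (-ν))) 0 (Set.Ici 0) 0 := by
  have h1 := hasDerivWithinAt_line (p := -ν) hu (frontier_subset_closure hx)
    (hin.mono fun t ht => subset_closure ht)
  have h2 := hasDerivAt_line hw (-ν)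
  have h3 := hasDerivAt_line hΦ (-ν)
  have h4 := (((h2.const_mul (-β)).exp.hasDerivWithinAt (s := Set.Ici 0)).mul h1).add
    (h3.mul h2).hasDerivWithinAt
  convert! h4 using 1
  -- Along `-ν` at the boundary, `w = 0` has slope `1` and `u` has slope `β u - φ`. The total is `-β
  -- u + (β u - φ) + Φ = 0`.
  simp [hw0, hwν, hN x hx ν hν, hΦφ]

/-- The doubled function has no maximum with a boundary point as its first component. -/
theorem boundary_doubling_false {v w : Cn n → ℝ} {x y ν : Cn n} {L B W : ℝ} (hL : 0 < L)
    (hB : 0 ≤ B) (hW : ∀ z, Bounded2 w z W) (hw0 : w x = 0) (hwy : 0 ≤ w y) (hxy : x ≠ y)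
    (hBr : B * ‖x - y‖ < 1) (hν : ‖ν‖ = 1) (hwν : ∀ p, fderiv ℝ w x p = -inner ℝ ν p)
    (hin : ∀ᶠ t in 𝓝[>] (0 : ℝ), x + t • (-ν) ∈ Ω)
    (hv : HasDerivWithinAt (fun t : ℝ => v (x + t • (-ν))) 0 (Set.Ici 0) 0)
    (hmax : ∀ᶠ z in 𝓝 x, z ∈ closure Ω →
      v z - penalty L B (fun z => Real.exp (-(2 * W + 1) * w z)) z y
        ≤ v x - penalty L B (fun z => Real.exp (-(2 * W + 1) * w z)) x y) : False := by
  have hr : 0 < ‖x - y‖ := norm_pos_iff.2 (sub_ne_zero.2 hxy)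
  refine normal_doubling_false (ν := ν) (w := w) (c := W) (γ := 2 * W + 1) hL hB (hW x).nonneg
    (by linarith) hr hBr hν ?_ hv ?_ ?_
  -- As `w x = 0 ≤ w y`, Taylor's formula gives the one-sided bound `⟨x - y, ν⟩ ≥ -W |x - y|²`. This
  -- takes the place of convexity of the domain.
  · have h1 := le_taylor_of_bounded2 hW x (y - x)
    rw [add_sub_cancel, hw0, hwν, norm_sub_rev, ← inner_neg_right, neg_sub,
      real_inner_comm] at h1
    linarith
  · have h1 := hasDerivAt_line ((hW x).contDiffAt.differentiableAt (by simp)) (-ν)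
    rw [hwν, inner_neg_right, real_inner_self_eq_norm_sq, hν] at h1
    simpa using h1
  · have h1 := (show Tendsto (fun t : ℝ => x + t • (-ν)) (𝓝 0) (𝓝 x) by
      have : ContinuousAt (fun t : ℝ => x + t • (-ν)) 0 := by fun_prop
      simpa [ContinuousAt] using this).mono_left (nhdsWithin_le_nhds (s := Set.Ioi 0))
    filter_upwards [h1.eventually hmax, hin] with t h2 h3 using h2 (subset_closure h3)

theorem abs_le_on_closure {u : Cn n → ℝ} {M : ℝ} (hu : ContinuousOn u (closure Ω))
    (h : ∀ z ∈ Ω, |u z| ≤ M) {z : Cn n} (hz : z ∈ closure Ω) : |u z| ≤ M := by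
  have hne : (𝓝[Ω] z).NeBot := mem_closure_iff_nhdsWithin_neBot.1 hz
  have ht : Tendsto (fun z => |u z|) (𝓝[Ω] z) (𝓝 |u z|) :=
    ((hu z hz).mono subset_closure).abs
  exact le_of_tendsto ht (eventually_nhdsWithin_of_forall h)

theorem gradNorm_le_of_fderiv_le {u : Cn n → ℝ} {z : Cn n} {C : ℝ} (hu : DifferentiableAt ℝ u z)
    (h : ∀ p, |fderiv ℝ u z p| ≤ C * ‖p‖) : gradNorm u z ≤ Real.sqrt (n * C ^ 2) := by
  refine Real.sqrt_le_sqrt ?_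
  have hd : HasFDerivAt (fun w => (u w : ℂ)) (Complex.ofRealCLM.comp (fderiv ℝ u z)) z :=
    Complex.ofRealCLM.hasFDerivAt.comp z hu.hasFDerivAt
  have key : ∀ j : Fin n, ‖dz j (fun w => (u w : ℂ)) z‖ ≤ C := by
    intro j
    rw [dz, hd.fderiv]
    have h1 := h (EuclideanSpace.single j (1 : ℂ))
    have h2 := h (EuclideanSpace.single j Complex.I)
    simp only [PiLp.norm_single, norm_one, Complex.norm_I, mul_one] at h1 h2
    rw [norm_mul]
    refine (mul_le_mul_of_nonneg_left (norm_sub_le _ _) (norm_nonneg _)).trans ?_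
    simp only [ContinuousLinearMap.comp_apply, Complex.ofRealCLM_apply, norm_mul, Complex.norm_I,
      one_mul, Complex.norm_real, Real.norm_eq_abs, one_div, norm_inv, Complex.norm_ofNat]
    linarith
  calc ∑ j : Fin n, ‖dz j (fun w => (u w : ℂ)) z‖ ^ 2
      ≤ ∑ _j : Fin n, C ^ 2 :=
        Finset.sum_le_sum fun j _ => pow_le_pow_left₀ (norm_nonneg _) (key j) 2
    _ = n * C ^ 2 := by simp

/-- From a local Lipschitz bound for `a u + b` to a bound for the derivative of `u`. -/
theorem abs_fderiv_le_of_lipschitz {u a b : Cn n → ℝ} {z : Cn n} {L G M a₀ : ℝ}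
    (hu : DifferentiableAt ℝ u z) (huM : |u z| ≤ M) (ha : Bounded2 a z G) (hb : Bounded2 b z G)
    (ha0 : 0 < a₀) (haz : a₀ ≤ a z)
    (hlip : ∀ᶠ x in 𝓝 z, (a x * u x + b x) - (a z * u z + b z) ≤ L * ‖x - z‖) (p : Cn n) :
    |fderiv ℝ u z p| ≤ (|L| + G * M + G) / a₀ * ‖p‖ := by
  have hM := (abs_nonneg _).trans huM
  have hG := ha.nonneg
  have hapos : 0 < a z := ha0.trans_le haz
  have key : ∀ p, fderiv ℝ u z p ≤ (|L| + G * M + G) / a₀ * ‖p‖ := by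
    intro p
    have hv := (((hasDerivAt_line (ha.contDiffAt.differentiableAt (by simp)) p).mul
      (hasDerivAt_line hu p)).add
      (hasDerivAt_line (hb.contDiffAt.differentiableAt (by simp)) p)).sub
      ((hasDerivAt_id (0 : ℝ)).mul_const (L * ‖p‖))
    have h1 := nonpos_of_hasDerivWithinAt_right hv.hasDerivWithinAt (by
      have h1 := (show Tendsto (fun t : ℝ => z + t • p) (𝓝 0) (𝓝 z) by
        have : ContinuousAt (fun t : ℝ => z + t • p) 0 := by fun_prop
        simpa [ContinuousAt] using this).mono_left (nhdsWithin_le_nhds (s := Set.Ioi 0))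
      filter_upwards [h1.eventually hlip, self_mem_nhdsWithin] with t h2 h3
      have h3 : (0 : ℝ) < t := h3
      rw [add_sub_cancel_left, norm_smul, Real.norm_of_nonneg h3.le] at h2
      simp only [Pi.sub_apply, Pi.add_apply, Pi.mul_apply, id, zero_smul, add_zero, zero_mul,
        sub_zero]
      linarith)
    simp only [zero_smul, add_zero, one_mul] at h1
    have h2 := neg_le_of_abs_le (abs_mul_le (ha.abs_fderiv_le p) huM)
    have h3 := neg_le_of_abs_le (hb.abs_fderiv_le p)
    have h4 : L * ‖p‖ ≤ |L| * ‖p‖ := mul_le_mul_of_nonneg_right (le_abs_self L) (norm_nonneg p)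
    have h5 : a z * fderiv ℝ u z p ≤ (|L| + G * M + G) * ‖p‖ := by linarith
    refine le_of_mul_le_mul_left (h5.trans ?_) hapos
    have hrhs : 0 ≤ (|L| + G * M + G) / a₀ * ‖p‖ := by positivity
    refine le_trans (le_of_eq ?_) (mul_le_mul_of_nonneg_right haz hrhs)
    field_simp
  refine abs_le.2 ⟨?_, key p⟩
  have := key (-p)
  rw [map_neg, norm_neg] at this
  linarith

/-- The comparison of the doubled function with the penalisation. -/
theorem doubling_comparison {k : ℕ} (hΩo : IsOpen Ω) (hΩb : Bornology.IsBounded Ω)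
    {u a b w : Cn n → ℝ} {L B G M W m₀ : ℝ} (hL : 1 ≤ L) (hB : 1 ≤ B) (hm0 : 0 < m₀)
    (hW : ∀ z, Bounded2 w z W) (hw0 : ∀ x ∈ frontier Ω, w x = 0) (hwnn : ∀ x ∈ closure Ω, 0 ≤ w x)
    (hwν : ∀ x ∈ frontier Ω, ∃ ν, ‖ν‖ = 1 ∧ (∀ p, fderiv ℝ w x p = -inner ℝ ν p) ∧
      (∀ᶠ t in 𝓝[>] (0 : ℝ), x + t • (-ν) ∈ Ω) ∧
      HasDerivWithinAt (fun t : ℝ => a (x + t • (-ν)) * u (x + t • (-ν)) + b (x + t • (-ν))) 0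
        (Set.Ici 0) 0)
    (hm : ∀ z ∈ closure Ω, m₀ ≤ Real.exp (-(2 * W + 1) * w z))
    (hu : ContinuousOn u (closure Ω)) (huM : ∀ z ∈ closure Ω, |u z| ≤ M)
    (ha : ∀ z ∈ closure Ω, Bounded2 a z G) (hb : ∀ z ∈ closure Ω, Bounded2 b z G)
    (hLB : 8 * B * (G * M + G) < L * m₀ ^ 2)
    (hint : ∀ x ∈ Ω, ∀ y ∈ Ω, x ≠ y → ‖x - y‖ ≤ 1 → B * ‖x - y‖ < 1 →
      (∀ᶠ z : Cn n × Cn n in 𝓝 (x, y), (a z.1 * u z.1 + b z.1) - (a z.2 * u z.2 + b z.2)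
          - penalty L B (fun z => Real.exp (-(2 * W + 1) * w z)) z.1 z.2
        ≤ (a x * u x + b x) - (a y * u y + b y)
          - penalty L B (fun z => Real.exp (-(2 * W + 1) * w z)) x y) →
      ∀ j < k, L * sigma j (eta u y) ≤ sigma (j + 1) (eta u y))
    (hno : ∀ y ∈ Ω, ¬ ∀ j < k, L * sigma j (eta u y) ≤ sigma (j + 1) (eta u y))
    {x y : Cn n} (hx : x ∈ closure Ω) (hy : y ∈ closure Ω) (hxy : ‖x - y‖ ≤ 1 / (2 * B)) :
    (a x * u x + b x) - (a y * u y + b y)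
      ≤ penalty L B (fun z => Real.exp (-(2 * W + 1) * w z)) x y := by
  set m : Cn n → ℝ := fun z => Real.exp (-(2 * W + 1) * w z) with hmdef
  set v : Cn n → ℝ := fun z => a z * u z + b z with hvdef
  set δ : ℝ := 1 / (2 * B) with hδ
  have hB0 : 0 < B := by linarith
  have hBδ : B * δ = 1 / 2 := by rw [hδ]; field_simp
  have hδ1 : δ ≤ 1 := by rw [hδ, div_le_one (by positivity)]; linarith
  have hwc : Continuous w := continuous_iff_continuousAt.2 fun z => (hW z).contDiffAt.continuousAt
  have hmc : Continuous m := by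
    rw [hmdef]; fun_prop
  have hvc : ContinuousOn v (closure Ω) := by
    refine ContinuousOn.add (ContinuousOn.mul (fun z hz => ?_) hu) fun z hz => ?_
    · exact (ha z hz).contDiffAt.continuousAt.continuousWithinAt
    · exact (hb z hz).contDiffAt.continuousAt.continuousWithinAt
  have hcl : IsCompact (closure Ω) := hΩb.isCompact_closure
  set Z : Set (Cn n × Cn n) := (closure Ω ×ˢ closure Ω) ∩ {z | ‖z.1 - z.2‖ ≤ δ} with hZ
  have hZc : IsCompact Z :=
    (hcl.prod hcl).inter_right (isClosed_le (by fun_prop) continuous_const)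
  set Ψ : Cn n × Cn n → ℝ := fun z => v z.1 - v z.2 - penalty L B m z.1 z.2 with hΨ
  have hpc : Continuous fun z : Cn n × Cn n => penalty L B m z.1 z.2 := by
    unfold penalty modulus; fun_prop
  have hΨc : ContinuousOn Ψ Z := by
    refine ContinuousOn.sub (ContinuousOn.sub ?_ ?_) hpc.continuousOn
    · exact hvc.comp continuousOn_fst fun z hz => hz.1.1
    · exact hvc.comp continuousOn_snd fun z hz => hz.1.2
  obtain ⟨⟨x₀, y₀⟩, hz0, hzmax⟩ := hZc.exists_isMaxOn ⟨(x, y), ⟨hx, hy⟩, hxy⟩ hΨc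
  by_contra hcon
  rw [not_le] at hcon
  have hΨ0 : 0 < Ψ (x₀, y₀) := by
    have : Ψ (x, y) ≤ Ψ (x₀, y₀) := hzmax ⟨⟨hx, hy⟩, hxy⟩
    refine lt_of_lt_of_le ?_ this
    exact sub_pos.2 hcon
  obtain ⟨⟨hx0 : x₀ ∈ closure Ω, hy0 : y₀ ∈ closure Ω⟩, hr0 : ‖x₀ - y₀‖ ≤ δ⟩ := hz0
  have hne : x₀ ≠ y₀ := by
    rintro rfl
    simp [hΨ, penalty, modulus] at hΨ0
  have hvb : ∀ z ∈ closure Ω, |v z| ≤ G * M + G := fun z hz =>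
    (abs_add_le _ _).trans (add_le_add (abs_mul_le (ha z hz).abs_le (huM z hz)) (hb z hz).abs_le)
  -- At distance `δ` the penalty is at least `L m₀² / (4 B)`, more than twice the bound for `|v|`,
  -- so the doubled function would be negative there.
  have hlt : ‖x₀ - y₀‖ < δ := by
    refine lt_of_le_of_ne hr0 fun heq => ?_
    have h1 : δ / 2 ≤ modulus B ‖x₀ - y₀‖ := by
      rw [heq]
      exact half_le_modulus (by positivity) (by rw [hBδ]; norm_num)
    have h2 : m₀ ^ 2 ≤ m x₀ * m y₀ := by
      rw [sq]; exact mul_le_mul (hm _ hx0) (hm _ hy0) hm0.le (Real.exp_pos _).le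
    have h3 : L * (δ / 2) * m₀ ^ 2 ≤ penalty L B m x₀ y₀ := by
      have hmod : 0 ≤ modulus B ‖x₀ - y₀‖ := le_trans (by positivity) h1
      unfold penalty
      exact mul_le_mul (mul_le_mul_of_nonneg_left h1 (by linarith)) h2 (by positivity)
        (mul_nonneg (by linarith) hmod)
    have h4 := (abs_le.1 (hvb x₀ hx0)).2
    have h5 := (abs_le.1 (hvb y₀ hy0)).1
    have h6 : 2 * (G * M + G) < L * (δ / 2) * m₀ ^ 2 := by
      have : L * (δ / 2) * m₀ ^ 2 = (L * m₀ ^ 2) / (4 * B) := by rw [hδ]; field_simp; ring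
      rw [this, lt_div_iff₀ (by positivity)]
      linarith
    simp only [hΨ] at hΨ0
    linarith
  have hBr : B * ‖x₀ - y₀‖ < 1 := by
    have := mul_le_mul_of_nonneg_left hr0 hB0.le
    linarith
  have hnear : ∀ᶠ z : Cn n × Cn n in 𝓝 (x₀, y₀), ‖z.1 - z.2‖ < δ := by
    have hc : ContinuousAt (fun z : Cn n × Cn n => ‖z.1 - z.2‖) (x₀, y₀) := by fun_prop
    exact hc.eventually_lt continuousAt_const hlt
  have hmaxev : ∀ᶠ z : Cn n × Cn n in 𝓝 (x₀, y₀), z.1 ∈ closure Ω → z.2 ∈ closure Ω →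
      Ψ z ≤ Ψ (x₀, y₀) := by
    filter_upwards [hnear] with z hz h1 h2 using hzmax ⟨⟨h1, h2⟩, hz.le⟩
  have hdich : ∀ z ∈ closure Ω, z ∈ frontier Ω ∨ z ∈ Ω := fun z hz => by
    rw [hΩo.frontier_eq]
    by_cases h : z ∈ Ω
    · exact Or.inr h
    · exact Or.inl ⟨hz, h⟩
  have hL0 : 0 < L := by linarith
  rcases hdich x₀ hx0 with hxf | hxΩ
  · obtain ⟨ν, hν, hwd, hin, hvd⟩ := hwν x₀ hxf
    refine boundary_doubling_false (v := v) hL0 hB0.le hW (hw0 _ hxf) (hwnn _ hy0) hne hBr hν hwd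
      hin hvd ?_
    have ht : Tendsto (fun z : Cn n => (z, y₀)) (𝓝 x₀) (𝓝 (x₀, y₀)) :=
      (Continuous.prodMk_left y₀).tendsto x₀
    filter_upwards [ht.eventually hmaxev] with z hz hzc
    have := hz hzc hy0
    simp only [hΨ] at this
    linarith
  rcases hdich y₀ hy0 with hyf | hyΩ
  · obtain ⟨ν, hν, hwd, hin, hvd⟩ := hwν y₀ hyf
    refine boundary_doubling_false (v := fun z => -v z) (y := x₀) (B := B) hL0 hB0.le hW
      (hw0 _ hyf) (hwnn _ hx0) hne.symm (by rwa [norm_sub_rev]) hν hwd hin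
      (by have h := hvd.neg; rw [neg_zero] at h; exact h) ?_
    have ht : Tendsto (fun z : Cn n => (x₀, z)) (𝓝 y₀) (𝓝 (x₀, y₀)) :=
      (Continuous.prodMk_right x₀).tendsto y₀
    filter_upwards [ht.eventually hmaxev] with z hz hzc
    have := hz hx0 hzc
    simp only [hΨ] at this
    rw [penalty_comm L B _ z x₀, penalty_comm L B _ y₀ x₀]
    linarith
  refine hno y₀ hyΩ (hint x₀ hxΩ y₀ hyΩ hne (hr0.trans hδ1) hBr ?_)
  have h1 : ∀ᶠ z : Cn n × Cn n in 𝓝 (x₀, y₀), z.1 ∈ Ω ∧ z.2 ∈ Ω :=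
    (hΩo.prod hΩo).mem_nhds ⟨hxΩ, hyΩ⟩
  filter_upwards [hmaxev, h1] with z hz1 hz2
  exact hz1 (subset_closure hz2.1) (subset_closure hz2.2)

/-- The constants of the doubling argument. -/
theorem exists_doubling_constants (n : ℕ) {β W c a₀ m₀ M : ℝ} (K : ℝ) (hβ : 0 ≤ β) (hW : 0 ≤ W)
    (hc : 0 < c) (ha : 0 < a₀) (hm : 0 < m₀) (hM : 0 ≤ M) :
    ∃ G B L : ℝ, 0 ≤ G ∧ 1 + β * W + (β * W) ^ 2 ≤ G ∧
      1 + (2 * W + 1) * W + ((2 * W + 1) * W) ^ 2 ≤ G ∧ 4 * |K| * W ≤ G ∧ 1 ≤ B ∧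
      n ^ 2 * (6 * G ^ 2 + (2 * G * ((1 + 2 * G + G * M) / a₀) + G * M + G)) + 1
        ≤ c * (B * m₀ ^ 2) ∧
      1 ≤ L ∧ K < L ∧ 8 * B * (G * M + G) < L * m₀ ^ 2 := by
  have p1 : 0 ≤ 1 + β * W + (β * W) ^ 2 := by positivity
  have p2 : 0 ≤ 1 + (2 * W + 1) * W + ((2 * W + 1) * W) ^ 2 := by positivity
  have p3 : 0 ≤ 4 * |K| * W := by positivity
  obtain ⟨G, h1, h2, h3⟩ : ∃ G, 1 + β * W + (β * W) ^ 2 ≤ G ∧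
      1 + (2 * W + 1) * W + ((2 * W + 1) * W) ^ 2 ≤ G ∧ 4 * |K| * W ≤ G :=
    ⟨(1 + β * W + (β * W) ^ 2) + (1 + (2 * W + 1) * W + ((2 * W + 1) * W) ^ 2) + 4 * |K| * W, by linarith, by linarith, by linarith⟩
  have hG : 0 ≤ G := p1.trans h1
  obtain ⟨X, hX0, hX⟩ : ∃ X, 0 ≤ X ∧
      n ^ 2 * (6 * G ^ 2 + (2 * G * ((1 + 2 * G + G * M) / a₀) + G * M + G)) + 1 = X :=
    ⟨_, by positivity, rfl⟩
  obtain ⟨B, hB1, hB⟩ : ∃ B : ℝ, 1 ≤ B ∧ X ≤ c * (B * m₀ ^ 2) := by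
    refine ⟨1 + X / (c * m₀ ^ 2), le_add_of_nonneg_right (by positivity), ?_⟩
    have : c * ((1 + X / (c * m₀ ^ 2)) * m₀ ^ 2) = c * m₀ ^ 2 + X := by field_simp
    rw [this]
    exact le_add_of_nonneg_left (by positivity)
  have hq : 0 ≤ 8 * B * (G * M + G) / m₀ ^ 2 := by positivity
  -- The order of choice avoids circularity: `G` depends on the data, `B` on `G`, and `L` on both.
  refine ⟨G, B, 1 + |K| + 8 * B * (G * M + G) / m₀ ^ 2, hG, h1, h2, h3, hB1, hX.trans_le hB,
    by linarith [abs_nonneg K], by linarith [le_abs_self K], ?_⟩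
  rw [← div_lt_iff₀ (by positivity)]
  linarith [abs_nonneg K]

/-- The global gradient estimate. -/
theorem exists_gradient_bound (n k : ℕ) (hk : 1 ≤ k) (hkn : k + 1 ≤ n)
    (Ω : Set (Cn n)) (hΩ : IsC4Domain Ω)
    (β : ℝ) (hβ : 0 < β) (K M : ℝ) :
    ∃ C : ℝ, ∀ φ ψ u : Cn n → ℝ,
      C3BoundaryBound Ω φ K →
      C2ClosureBound Ω ψ K →
      (∀ z ∈ closure Ω, 0 ≤ ψ z) →
      ContDiffOn ℝ 3 u (closure Ω) →
      IsAdmissible k Ω u →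
      (SolvesHessian k Ω β φ ψ u ∨
        ∃ l : ℕ, 1 ≤ l ∧ l < k ∧ SolvesQuotient k l Ω β φ ψ u) →
      (∀ z ∈ Ω, |u z| ≤ M) →
      ∀ z ∈ Ω, gradNorm u z ≤ C := by
  obtain ⟨w, hwc2, hwsupp, hw0, hwnn, hwν⟩ := exists_boundary_function hΩ
  obtain ⟨W, hW0, hW⟩ := exists_bounded2_of_hasCompactSupport hwc2 hwsupp
  obtain ⟨c, hc, H⟩ := ratio_of_interior_doubling (n := n) hkn
  set a : Cn n → ℝ := fun z => Real.exp (-β * w z) with ha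
  set m : Cn n → ℝ := fun z => Real.exp (-(2 * W + 1) * w z) with hm
  obtain ⟨a₀, ha₀⟩ : ∃ a₀, Real.exp (-β * W) = a₀ := ⟨_, rfl⟩
  obtain ⟨m₀, hm₀⟩ : ∃ m₀, Real.exp (-(2 * W + 1) * W) = m₀ := ⟨_, rfl⟩
  have ha₀p : 0 < a₀ := ha₀ ▸ Real.exp_pos _
  have hm₀p : 0 < m₀ := hm₀ ▸ Real.exp_pos _
  obtain ⟨G, B, L, hG0, hG1, hG2, hG3, hB1, hcB, hL1, hLK, hLB⟩ :=
    exists_doubling_constants n K hβ.le hW0 hc ha₀p hm₀p (abs_nonneg M)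
  refine ⟨Real.sqrt (n * ((|L| + G * |M| + G) / a₀) ^ 2),
    fun φ ψ u hφ hψ _ hu hadm hsol hM z hz => ?_⟩
  obtain ⟨Φ, hΦ, hΦφ, hΦK⟩ := hφ
  have hN : NeumannCondition Ω β φ u := by
    rcases hsol with hs | ⟨l, -, -, hs⟩ <;> exact hs.2
  have huc : ContDiffOn ℝ 2 u (closure Ω) := hu.of_le (by norm_num)
  have hu2 : ∀ z ∈ Ω, ContDiffAt ℝ 2 u z := fun z hz =>
    huc.contDiffAt (Filter.mem_of_superset (hΩ.isOpen.mem_nhds hz) subset_closure)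
  have huM : ∀ z ∈ closure Ω, |u z| ≤ |M| := fun z hz =>
    (abs_le_on_closure huc.continuousOn hM hz).trans (le_abs_self M)
  have hwW : ∀ z, w z ≤ W := fun z => (le_abs_self _).trans (hW z).abs_le
  set b : Cn n → ℝ := fun z => Φ z * w z with hb
  have hab : ∀ z ∈ closure Ω, Bounded2 a z G := fun z hz =>
    (bounded2_exp (hW z) hβ.le (hwnn z hz)).mono hG1
  have hmb : ∀ z ∈ closure Ω, Bounded2 m z G := fun z hz =>
    (bounded2_exp (hW z) (by linarith) (hwnn z hz)).mono hG2
  have hbb : ∀ z, Bounded2 b z G := fun z =>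
    (((bounded2_of_iteratedFDeriv hΦ hΦK z).mono (le_abs_self K)).mul (hW z)).mono hG3
  have hexp1 : ∀ γ : ℝ, 0 ≤ γ → ∀ z ∈ closure Ω, Real.exp (-γ * w z) ≤ 1 := fun γ hγ z hz => by
    rw [Real.exp_le_one_iff]
    have := mul_nonneg hγ (hwnn z hz)
    linarith
  have hexp0 : ∀ γ : ℝ, 0 ≤ γ → ∀ z, Real.exp (-γ * W) ≤ Real.exp (-γ * w z) := fun γ hγ z => by
    rw [Real.exp_le_exp]
    have := mul_le_mul_of_nonneg_left (hwW z) hγ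
    linarith
  have hγ0 : 0 ≤ 2 * W + 1 := by linarith
  have hcomp : ∀ x ∈ closure Ω, ∀ y ∈ closure Ω, ‖x - y‖ ≤ 1 / (2 * B) →
      (a x * u x + b x) - (a y * u y + b y) ≤ penalty L B m x y := fun x hx y hy hxy =>
    doubling_comparison (u := u) (a := a) (b := b) (w := w) (k := k) hΩ.isOpen
    hΩ.isBounded hL1 hB1 hm₀p hW hw0 hwnn (fun x hx => by
      obtain ⟨ν, hν, hwd, hin⟩ := hwν x hx
      refine ⟨ν, hν.1, hwd, hin, ?_⟩
      exact hasDerivWithinAt_normal hx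
        ((huc x (frontier_subset_closure hx)).differentiableWithinAt (by simp))
        ((hW x).contDiffAt.differentiableAt (by simp))
        (hΦ.contDiffAt.differentiableAt (by simp)) (hΦφ x hx) hN hν (hw0 x hx)
        (by rw [hwd, real_inner_self_eq_norm_sq, hν.1]; simp) hin)
    (fun z _ => hm₀ ▸ hexp0 _ hγ0 z) huc.continuousOn huM hab (fun z _ => hbb z) hLB
    (fun x hx y hy hxy hr1 hBr hmax => H u a b m x y L B G |M| a₀ m₀ hL1 hB1 hxy hr1 hBr ha₀p hm₀p
      hG0 (abs_nonneg M) hcB (fun z => (Real.exp_pos _).le) (fun z hz => by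
        have hzΩ : z ∈ Ω := by rcases hz with rfl | rfl <;> assumption
        have hzc := subset_closure hzΩ
        exact ⟨hu2 z hzΩ, huM z hzc, hab z hzc, hbb z, hmb z hzc, ha₀ ▸ hexp0 _ hβ.le z,
          hexp1 _ hβ.le z hzc, hm₀ ▸ hexp0 _ hγ0 z, hexp1 _ hγ0 z hzc, hadm z hzΩ⟩) hmax)
    (fun y hy h => not_large_ratio hk hL1 hLK hy (hadm y hy) (by
      have := hψ.2 0 (by norm_num) y (subset_closure hy)
      rw [norm_iteratedFDerivWithin_zero] at this
      exact (le_abs_self _).trans this) hsol h)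
    hx hy hxy
  have hzc := subset_closure hz
  refine gradNorm_le_of_fderiv_le ((hu2 z hz).differentiableAt (by simp))
    (abs_fderiv_le_of_lipschitz ((hu2 z hz).differentiableAt (by simp)) (huM z hzc) (hab z hzc)
      (hbb z) ha₀p (ha₀ ▸ hexp0 _ hβ.le z) ?_)
  have hδ : 0 < 1 / (2 * B) := by positivity
  -- Since `θ(r) ≤ r` and `m ≤ 1` on the closure, the comparison is a Lipschitz bound near `z` with
  -- constant `L`.
  filter_upwards [Metric.ball_mem_nhds z hδ, hΩ.isOpen.mem_nhds hz] with x hx1 hx2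
  have hxc := subset_closure hx2
  refine (hcomp x hxc z hzc (by rw [← dist_eq_norm]; exact (Metric.mem_ball.1 hx1).le)).trans ?_
  have hmm : m x * m z ≤ 1 :=
    mul_le_one₀ (hexp1 _ hγ0 x hxc) (Real.exp_pos _).le (hexp1 _ hγ0 z hzc)
  have hmm0 : 0 ≤ m x * m z := mul_nonneg (Real.exp_pos _).le (Real.exp_pos _).le
  calc penalty L B m x z ≤ L * ‖x - z‖ * (m x * m z) :=
        mul_le_mul_of_nonneg_right (mul_le_mul_of_nonneg_left (modulus_le (by linarith))
          (by linarith)) hmm0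
    _ ≤ L * ‖x - z‖ := mul_le_of_le_one_right
        (mul_nonneg (by linarith) (norm_nonneg _)) hmm

end main

end NeumannHessian

end

theorem theorem3p2 (n k : ℕ) (hk : 1 ≤ k) (hkn : k + 1 ≤ n)
    (Ω : Set (NeumannHessian.Cn n)) (hΩ : NeumannHessian.IsC4Domain Ω)
    (β : ℝ) (hβ : 0 < β) (K M : ℝ) :
    ∃ C : ℝ, ∀ φ ψ u : NeumannHessian.Cn n → ℝ,
      NeumannHessian.C3BoundaryBound Ω φ K →
      NeumannHessian.C2ClosureBound Ω ψ K →
      (∀ z ∈ closure Ω, 0 ≤ ψ z) →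
      ContDiffOn ℝ 3 u (closure Ω) →
      NeumannHessian.IsAdmissible k Ω u →
      (NeumannHessian.SolvesHessian k Ω β φ ψ u ∨
        ∃ l : ℕ, 1 ≤ l ∧ l < k ∧ NeumannHessian.SolvesQuotient k l Ω β φ ψ u) →
      (∀ z ∈ Ω, |u z| ≤ M) →
      ∀ z ∈ Ω, NeumannHessian.gradNorm u z ≤ C :=
  NeumannHessian.exists_gradient_bound n k hk hkn Ω hΩ β hβ K M
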